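/- **Model.** Let $k_1\ge 0$, $k_2\ge 1$, $k_v\ge 1$, $k_F=k_1+k_2$. For each $(N,T)$ there are, on some probability space, observed factors $F_t=(F_{t,1},F_{t,2})\in\mathbb R^{k_1}\times\mathbb R^{k_2}$, unobserved factors $v_t\in\mathbb R^{k_v}$ and errors $e_{it}$, $i\le N$, $t\le T$, with $$r_{it}=\lambda'\beta_i+(F_t-EF_t)'\beta_i+v_t'\mu_i+e_{it},$$ where $v_t$ has mean zero and is uncorrelated with $F_t$, and $e_{it}$ has mean zero and is uncorrelated with $F_t$ and $v_t$. The loadings $\beta_i=(\beta_{i,1},\beta_{i,2})$, $\mu_i$ are non-random; they and the law of $(F,v,e)$ may change with $(N,T)$, while $\lambda\in\mathbb R^{k_F}$ and $\Sigma_F=\mathrm{var}(F_t)$ do not. All limits are for $N,T\to\infty$ jointly, without restriction on relative rates. Write $\widetilde F_t=F_t-\frac1T\sum_sF_s$, $\gamma_i=(\beta_{i,1}',\sqrt T\beta_{i,2}',\mu_i')'$, $\mathcal F=\sigma(F_1,\dots,F_T,v_1,\dots,v_T)$, $\eta_T=T^{-1/2}\sum_t\Sigma_F^{-1}\widetilde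 F_tv_t'$, $\eta_{v,T}=T^{-1/2}\sum_tv_t$. **Assumptions.** *Factors:* $(F_t)_{t\le T}$ is stationary with finite fourth moments, $\Sigma_F$ is nonsingular, $\frac1T\sum_t\widetilde F_t\widetilde F_t'\to^p\Sigma_F$, and jointly $\big(T^{-1/2}\sum_t(F_t-EF_t),\eta_T,\eta_{v,T}\big)\Rightarrow(\zeta,\eta,\eta_v)$ with $\zeta\sim N(0,\Omega_F)$, $\mathrm{vec}(\eta)\sim N(0,\Omega_{vF})$, $\eta_v\sim N(0,I_{k_v})$. *Loadings:* $\frac1N\sum_i\gamma_i\gamma_i'\to\Gamma$ with $\Gamma$ positive definite, and $\sup_{N,T}\frac1N\sum_i\|\gamma_i\|^4<\infty$. *Errors:* (i) conditionally on $\mathcal F$ the vectors $e_t=(e_{1t},\dots,e_{Nt})'$, $t\le T$, are independent with $E(e_t|\mathcal F)=0$; (ii) with $\rho(t,s)=N^{-1/2}\sum_ie_{it}e_{is}$, $E[(1+\|F_t\|^4)(\rho(s,t)^2+1)]\le C$ for all $s\ne t$; (iii) with $S_t=\frac1N\sum_ie_{it}^2$, $\frac{\sqrt N}T\sum_t\widetilde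 F_tS_t=o_p(1)$ and $\frac1T\sum_t\widetilde F_t\widetilde F_t'S_t\to^p\Sigma_{SF^2}$; (iv) with $W_t=N^{-1/2}\sum_i\gamma_ie_{it}$, $E[(1+\|F_t\|^2)\|W_t\|^2]\le C$. Here $C$ is a constant independent of $N,T,t,s$. **Notation.** The two-pass estimator is $\widehat\lambda_{TP}=(\sum_i\widehat\beta_i\widehat\beta_i')^{-1}\sum_i\widehat\beta_i\bar r_i$, where $\widehat\beta_i=(\sum_t\widetilde F_t\widetilde F_t')^{-1}\sum_t\widetilde F_tr_{it}$ and $\bar r_i=\frac1T\sum_tr_{it}$. Let $\widetilde\lambda=\lambda+\frac1T\sum_tF_t-EF_t$, $u_i=\frac1T\sum_t\Sigma_F^{-1}\widetilde F_te_{it}$, $$B^A=-\Big(\sum_i\widehat\beta_i\widehat\beta_i'\Big)^{-1}\sum_iu_iu_i'\widetilde\lambda,\qquad B^{OV}=\Big(\sum_i\widehat\beta_i\widehat\beta_i'\Big)^{-1}\sum_i\widehat\beta_i\frac{\mu_i'}{\sqrt T}(\eta_{v,T}-\eta_T'\widetilde\lambda)$$ (attenuation bias, omitted variable bias). Subscripts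 $1$, $2$ denote the first $k_1$ and the last $k_2$ components. Let $\Sigma_u=\Sigma_F^{-1}\Sigma_{SF^2}\Sigma_F^{-1}$, $\mathcal I_{k_2}=\mathrm{diag}(0_{k_1,k_1},I_{k_2})$, $\widetilde\eta=\mathcal I_{k_2}\eta$, $M=(I_{k_F};\widetilde\eta)\Gamma(I_{k_F};\widetilde\eta)'+\mathcal I_{k_2}\Sigma_u\mathcal I_{k_2}$, let $\Gamma_{\beta\mu}$ and $\Gamma_{\mu\mu}$ be the upper right $k_F\times k_v$ and the lower right $k_v\times k_v$ block of $\Gamma$, and $$X^{OV}=M^{-1}(\Gamma_{\beta\mu}+\widetilde\eta\,\Gamma_{\mu\mu})(\eta_v-\eta'\lambda),\qquad X^A=-M^{-1}\mathcal I_{k_2}\Sigma_u\lambda .$$ **Claim.** Under these assumptions: 1. $\sqrt T(\widehat\lambda_{TP,1}-\lambda_1)=\sqrt T(\widetilde\lambda_1-\lambda_1)+\sqrt TB^A_1+\sqrt TB^{OV}_1+o_p(1)$ and $\widehat\lambda_{TP,2}-\lambda_2=B^A_2+B^{OV}_2+o_p(1)$. 2. Jointly, $\sqrt T(\widetilde\lambda-\lambda)\Rightarrow\zeta$,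 $\binom{\sqrt TB^{OV}_1}{B^{OV}_2}\Rightarrow X^{OV}$ and $\binom{\sqrt TB^{A}_1}{B^{A}_2}\Rightarrow X^{A}$ (so on the strong factors the biases are of order $1/\sqrt T$, on the weak factors of order $1$), and $\widehat\lambda_{TP,2}-\lambda_2\Rightarrow X^A_2+X^{OV}_2$. 3. Suppose moreover that $(\mathrm{vec}(\eta),\eta_v)$ is jointly normal with a nonsingular covariance matrix. Then the law of $X^{OV}$ is not Gaussian. If $\mathcal I_{k_2}\Sigma_u\lambda\ne0$, then $X^A$ is not Gaussian either and $EX^A$ exists and is nonzero (if $\mathcal I_{k_2}\Sigma_u\lambda=0$, then $X^A=0$). The mean $EX^{OV}$ exists, and for fixed $\Sigma_u$ and fixed law of $(\eta,\eta_v)$ it is nonzero for Lebesgue-almost every pair $(\lambda,\Gamma)$ of a vector and a symmetric positive definite matrix. The law of $X^A_2+X^{OV}_2$ is not Gaussian, and $\widehat\lambda_{TP,2}$ is not a consistent estimator of $\lambda_2$; thus the usual asymptotic normality behind standard inference fails. -/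

import Mathlib

open MeasureTheory ProbabilityTheory Filter Topology Matrix
open scoped ENNReal BoundedContinuousFunction

universe u

/-- Index set of the observed factors: `k₁` strong ones (`Sum.inl`) and `k₂` weak ones
(`Sum.inr`). -/
abbrev ObsIdx (k₁ k₂ : ℕ) : Type := Fin k₁ ⊕ Fin k₂

/-- Index set of all factors: the observed ones, then the `kᵥ` missing ones. -/
abbrev AllIdx (k₁ k₂ kᵥ : ℕ) : Type := ObsIdx k₁ k₂ ⊕ Fin kᵥ

/-- The primitives of a factor-pricing model, as a triangular array: for each pair of sample sizes
`(N, T)` there is a probability space carrying the observed factors `F_t`, the missing factors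
`v_t` and the idiosyncratic errors `e_{it}`; the loadings `β_i`, `μ_i` are non-random and may
change with `(N, T)`.  The risk premia `lam` and the matrix `SigmaF` are fixed. -/
structure FactorPanel (k₁ k₂ kᵥ : ℕ) where
  Ω : ℕ → ℕ → Type u
  mΩ : ∀ N T, MeasurableSpace (Ω N T)
  P : ∀ N T, Measure (Ω N T)
  isProb : ∀ N T, IsProbabilityMeasure (P N T)
  F : ∀ N T, Fin T → Ω N T → (ObsIdx k₁ k₂ → ℝ)
  v : ∀ N T, Fin T → Ω N T → (Fin kᵥ → ℝ)
  e : ∀ N T, Fin N → Fin T → Ω N T → ℝ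
  measurable_F : ∀ N T t, Measurable (F N T t)
  measurable_v : ∀ N T t, Measurable (v N T t)
  measurable_e : ∀ N T i t, Measurable (e N T i t)
  β : ∀ N _T : ℕ, Fin N → (ObsIdx k₁ k₂ → ℝ)
  μ : ∀ N _T : ℕ, Fin N → (Fin kᵥ → ℝ)
  lam : ObsIdx k₁ k₂ → ℝ
  SigmaF : Matrix (ObsIdx k₁ k₂) (ObsIdx k₁ k₂) ℝ

attribute [instance] FactorPanel.mΩ FactorPanel.isProb

/-- The law `m` on `ℝ^ι` is the normal law `N(0, S)` (`S` may be singular). -/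
def IsCenteredNormal {ι : Type*} [Fintype ι] (m : Measure (ι → ℝ)) (S : Matrix ι ι ℝ) : Prop :=
  S.PosSemidef ∧
    ∀ w : ι → ℝ, m.map (fun x => w ⬝ᵥ x) = gaussianReal 0 (w ⬝ᵥ S *ᵥ w).toNNReal

/-- Space in which the limit `(ζ, η, η_v)` of the normalized factor averages takes its values. -/
abbrev LimitSpace (k₁ k₂ kᵥ : ℕ) : Type :=
  (ObsIdx k₁ k₂ → ℝ) × (ObsIdx k₁ k₂ → Fin kᵥ → ℝ) × (Fin kᵥ → ℝ)

/-- Multiplies the strong components by `√T` and leaves the weak ones unchanged. -/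
noncomputable def scaleStrong {k₁ k₂ : ℕ} (T : ℕ) (x : ObsIdx k₁ k₂ → ℝ) : ObsIdx k₁ k₂ → ℝ :=
  Sum.elim (fun a => √(T : ℝ) * x (Sum.inl a)) (fun b => x (Sum.inr b))

/-- Projection on the weak observed factors. -/
def weakProj (k₁ k₂ : ℕ) : Matrix (ObsIdx k₁ k₂) (ObsIdx k₁ k₂) ℝ :=
  Matrix.diagonal (Sum.elim (fun _ => 0) (fun _ => 1))

namespace FactorPanel

variable {k₁ k₂ kᵥ : ℕ} (D : FactorPanel.{u} k₁ k₂ kᵥ) (N T : ℕ)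

/-- The mean `E F_t`. -/
noncomputable def meanF (t : Fin T) : ObsIdx k₁ k₂ → ℝ :=
  fun j => ∫ ω, D.F N T t ω j ∂(D.P N T)

/-- Excess returns `r_{it} = λ'β_i + (F_t - E F_t)'β_i + v_t'μ_i + e_{it}`. -/
noncomputable def r (i : Fin N) (t : Fin T) (ω : D.Ω N T) : ℝ :=
  D.lam ⬝ᵥ D.β N T i + (D.F N T t ω - D.meanF N T t) ⬝ᵥ D.β N T i
    + D.v N T t ω ⬝ᵥ D.μ N T i + D.e N T i t ω

/-- Time average of the observed factors. -/
noncomputable def Fbar (ω : D.Ω N T) : ObsIdx k₁ k₂ → ℝ :=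
  (T : ℝ)⁻¹ • ∑ t, D.F N T t ω

/-- Demeaned observed factors. -/
noncomputable def Ftilde (t : Fin T) (ω : D.Ω N T) : ObsIdx k₁ k₂ → ℝ :=
  D.F N T t ω - D.Fbar N T ω

/-- First pass: OLS slope of `r_{it}` on a constant and `F_t`. -/
noncomputable def betaHat (i : Fin N) (ω : D.Ω N T) : ObsIdx k₁ k₂ → ℝ :=
  (∑ t, vecMulVec (D.Ftilde N T t ω) (D.Ftilde N T t ω))⁻¹ *ᵥ
    ∑ t, D.r N T i t ω • D.Ftilde N T t ω

/-- Time average of the returns of asset `i`. -/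
noncomputable def rbar (i : Fin N) (ω : D.Ω N T) : ℝ :=
  (T : ℝ)⁻¹ * ∑ t, D.r N T i t ω

/-- The matrix `∑ᵢ β̂ᵢ β̂ᵢ'`. -/
noncomputable def betaGram (ω : D.Ω N T) : Matrix (ObsIdx k₁ k₂) (ObsIdx k₁ k₂) ℝ :=
  ∑ i, vecMulVec (D.betaHat N T i ω) (D.betaHat N T i ω)

/-- Second pass, the two-pass estimator of `λ`: OLS of `r̄ᵢ` on `β̂ᵢ`. -/
noncomputable def lamTP (ω : D.Ω N T) : ObsIdx k₁ k₂ → ℝ :=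
  (D.betaGram N T ω)⁻¹ *ᵥ ∑ i, D.rbar N T i ω • D.betaHat N T i ω

/-- Ex-post risk premia `λ̃ = λ + T⁻¹ ∑ₜ F_t - E F_t`. -/
noncomputable def lamTilde (ω : D.Ω N T) : ObsIdx k₁ k₂ → ℝ :=
  D.lam + (T : ℝ)⁻¹ • ∑ t, (D.F N T t ω - D.meanF N T t)

/-- `uᵢ = T⁻¹ ∑ₜ Σ_F⁻¹ F̃_t e_{it}`. -/
noncomputable def uErr (i : Fin N) (ω : D.Ω N T) : ObsIdx k₁ k₂ → ℝ :=
  (T : ℝ)⁻¹ • ∑ t, D.e N T i t ω • (D.SigmaF⁻¹ *ᵥ D.Ftilde N T t ω)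

/-- `ζ_T = T^{-1/2} ∑ₜ (F_t - E F_t)`. -/
noncomputable def zetaT (ω : D.Ω N T) : ObsIdx k₁ k₂ → ℝ :=
  (√(T : ℝ))⁻¹ • ∑ t, (D.F N T t ω - D.meanF N T t)

/-- `η_T = T^{-1/2} ∑ₜ Σ_F⁻¹ F̃_t v_t'`. -/
noncomputable def etaT (ω : D.Ω N T) : ObsIdx k₁ k₂ → Fin kᵥ → ℝ :=
  fun j l => (√(T : ℝ))⁻¹ * ∑ t, (D.SigmaF⁻¹ *ᵥ D.Ftilde N T t ω) j * D.v N T t ω l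

/-- `η_{v,T} = T^{-1/2} ∑ₜ v_t`. -/
noncomputable def etaVT (ω : D.Ω N T) : Fin kᵥ → ℝ :=
  (√(T : ℝ))⁻¹ • ∑ t, D.v N T t ω

/-- Attenuation bias. -/
noncomputable def biasA (ω : D.Ω N T) : ObsIdx k₁ k₂ → ℝ :=
  -((D.betaGram N T ω)⁻¹ *ᵥ
    ((∑ i, vecMulVec (D.uErr N T i ω) (D.uErr N T i ω)) *ᵥ D.lamTilde N T ω))

/-- Omitted variable bias. -/
noncomputable def biasOV (ω : D.Ω N T) : ObsIdx k₁ k₂ → ℝ :=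
  (D.betaGram N T ω)⁻¹ *ᵥ
    ∑ i, ((√(T : ℝ))⁻¹ * (D.μ N T i ⬝ᵥ
      (D.etaVT N T ω - (Matrix.of (D.etaT N T ω))ᵀ *ᵥ D.lamTilde N T ω))) • D.betaHat N T i ω

/-- Normalized loadings `γᵢ' = (β_{i,1}', √T β_{i,2}', μᵢ')`. -/
noncomputable def gam (i : Fin N) : AllIdx k₁ k₂ kᵥ → ℝ :=
  Sum.elim
    (Sum.elim (fun a => D.β N T i (Sum.inl a)) (fun b => √(T : ℝ) * D.β N T i (Sum.inr b)))
    (D.μ N T i)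

/-- The σ-algebra generated by `F_1, …, F_T, v_1, …, v_T`. -/
abbrev factorSigma : MeasurableSpace (D.Ω N T) :=
  (⨆ t, MeasurableSpace.comap (D.F N T t) inferInstance) ⊔
    (⨆ t, MeasurableSpace.comap (D.v N T t) inferInstance)

/-- The vector `e_t = (e_{1t}, …, e_{Nt})`. -/
def eVec (t : Fin T) (ω : D.Ω N T) : Fin N → ℝ := fun i => D.e N T i t ω

/-- `ρ(t,s) = N^{-1/2} ∑ᵢ e_{it} e_{is}`. -/
noncomputable def rho (t s : Fin T) (ω : D.Ω N T) : ℝ :=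
  (√(N : ℝ))⁻¹ * ∑ i, D.e N T i t ω * D.e N T i s ω

/-- `S_t = N⁻¹ ∑ᵢ e_{it}²`. -/
noncomputable def S (t : Fin T) (ω : D.Ω N T) : ℝ :=
  (N : ℝ)⁻¹ * ∑ i, D.e N T i t ω ^ 2

/-- `W_t = N^{-1/2} ∑ᵢ γᵢ e_{it}`. -/
noncomputable def W (t : Fin T) (ω : D.Ω N T) : AllIdx k₁ k₂ kᵥ → ℝ :=
  (√(N : ℝ))⁻¹ • ∑ i, D.e N T i t ω • D.gam N T i

/-- Convergence in probability to the constant `c` as `N, T → ∞` jointly, without any restriction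
on their relative growth. -/
def ConvInProb (X : ∀ N T, D.Ω N T → ℝ) (c : ℝ) : Prop :=
  ∀ ε : ℝ, 0 < ε →
    Tendsto (fun p : ℕ × ℕ => D.P p.1 p.2 {ω | ε ≤ |X p.1 p.2 ω - c|}) atTop (𝓝 0)

/-- `v_t` has mean zero and is uncorrelated with `F_t`; the `e_{it}` have mean zero and are
uncorrelated with `F_t` and `v_t`. -/
structure IsPricingModel : Prop where
  integrable_v : ∀ N T t l, Integrable (fun ω => D.v N T t ω l) (D.P N T)
  mean_v : ∀ N T t l, ∫ ω, D.v N T t ω l ∂(D.P N T) = 0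
  integrable_Fv : ∀ N T t j l, Integrable (fun ω => D.F N T t ω j * D.v N T t ω l) (D.P N T)
  uncorr_Fv : ∀ N T t j l, ∫ ω, D.F N T t ω j * D.v N T t ω l ∂(D.P N T) = 0
  integrable_e : ∀ N T i t, Integrable (D.e N T i t) (D.P N T)
  mean_e : ∀ N T i t, ∫ ω, D.e N T i t ω ∂(D.P N T) = 0
  integrable_Fe : ∀ N T i t j, Integrable (fun ω => D.F N T t ω j * D.e N T i t ω) (D.P N T)
  uncorr_Fe : ∀ N T i t j, ∫ ω, D.F N T t ω j * D.e N T i t ω ∂(D.P N T) = 0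
  integrable_ve : ∀ N T i t l, Integrable (fun ω => D.v N T t ω l * D.e N T i t ω) (D.P N T)
  uncorr_ve : ∀ N T i t l, ∫ ω, D.v N T t ω l * D.e N T i t ω ∂(D.P N T) = 0

/-- The assumption on the factors.  The law `ν` of the limit `(ζ, η, η_v)` has normal marginals;
nothing is assumed on their dependence. -/
structure Factors (OmegaF : Matrix (ObsIdx k₁ k₂) (ObsIdx k₁ k₂) ℝ)
    (OmegavF : Matrix (Fin kᵥ × ObsIdx k₁ k₂) (Fin kᵥ × ObsIdx k₁ k₂) ℝ)
    (ν : Measure (LimitSpace k₁ k₂ kᵥ)) [IsProbabilityMeasure ν] : Prop where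
  stationary : ∀ (N T m h : ℕ) (hm : h + m ≤ T),
    (D.P N T).map (fun ω (s : Fin m) => D.F N T ⟨h + s, by omega⟩ ω) =
      (D.P N T).map (fun ω (s : Fin m) => D.F N T ⟨s, by omega⟩ ω)
  moments : ∀ N T t j, MemLp (fun ω => D.F N T t ω j) 4 (D.P N T)
  cov_eq : ∀ N T t j l,
    cov[fun ω => D.F N T t ω j, fun ω => D.F N T t ω l; D.P N T] = D.SigmaF j l
  posDef : D.SigmaF.PosDef
  lln : ∀ j l, D.ConvInProb
    (fun N T ω => (T : ℝ)⁻¹ * ∑ t, D.Ftilde N T t ω j * D.Ftilde N T t ω l) (D.SigmaF j l)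
  clt : TendstoInDistribution
    (fun (p : ℕ × ℕ) (ω : D.Ω p.1 p.2) =>
      (D.zetaT p.1 p.2 ω, D.etaT p.1 p.2 ω, D.etaVT p.1 p.2 ω))
    atTop id (fun p => D.P p.1 p.2) ν
  normal_zeta : IsCenteredNormal (ν.map fun x => x.1) OmegaF
  normal_eta : IsCenteredNormal (ν.map fun x => vec (Matrix.of x.2.1)) OmegavF
  normal_etaV : IsCenteredNormal (ν.map fun x => x.2.2) 1

/-- The assumption on the loadings. -/
structure Loadings (Γ : Matrix (AllIdx k₁ k₂ kᵥ) (AllIdx k₁ k₂ kᵥ) ℝ) : Prop where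
  posDef : Γ.PosDef
  tendsto : ∀ a b, Tendsto
    (fun p : ℕ × ℕ => (p.1 : ℝ)⁻¹ * ∑ i, D.gam p.1 p.2 i a * D.gam p.1 p.2 i b) atTop (𝓝 (Γ a b))
  bounded : ∃ C : ℝ, ∀ N T : ℕ, (N : ℝ)⁻¹ * ∑ i, (D.gam N T i ⬝ᵥ D.gam N T i) ^ 2 ≤ C

/-- The assumption on the idiosyncratic errors.  Moment bounds are uniform over `N`, `T` and over
the time indexes. -/
structure Errors (SigmaSF2 : Matrix (ObsIdx k₁ k₂) (ObsIdx k₁ k₂) ℝ) : Prop where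
  condIndep : ∀ (N T : ℕ) (B : Fin T → Set (Fin N → ℝ)), (∀ t, MeasurableSet (B t)) →
    (D.P N T)⟦⋂ t, D.eVec N T t ⁻¹' B t | D.factorSigma N T⟧
      =ᵐ[D.P N T] ∏ t, (D.P N T)⟦D.eVec N T t ⁻¹' B t | D.factorSigma N T⟧
  condMean : ∀ N T i t, (D.P N T)[D.e N T i t | D.factorSigma N T] =ᵐ[D.P N T] 0
  rho_bound : ∃ C : ℝ, ∀ (N T : ℕ) (t s : Fin T), s ≠ t →
    ∫⁻ ω, ENNReal.ofReal ((1 + (D.F N T t ω ⬝ᵥ D.F N T t ω) ^ 2) * (D.rho N T s t ω ^ 2 + 1))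
      ∂(D.P N T) ≤ ENNReal.ofReal C
  FS : ∀ j, D.ConvInProb (fun N T ω => √(N : ℝ) / T * ∑ t, D.Ftilde N T t ω j * D.S N T t ω) 0
  FFS : ∀ j l, D.ConvInProb
    (fun N T ω => (T : ℝ)⁻¹ * ∑ t, D.Ftilde N T t ω j * D.Ftilde N T t ω l * D.S N T t ω)
    (SigmaSF2 j l)
  W_bound : ∃ C : ℝ, ∀ (N T : ℕ) (t : Fin T),
    ∫⁻ ω, ENNReal.ofReal ((1 + D.F N T t ω ⬝ᵥ D.F N T t ω) * (D.W N T t ω ⬝ᵥ D.W N T t ω))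
      ∂(D.P N T) ≤ ENNReal.ofReal C

end FactorPanel

section Limits

variable {k₁ k₂ kᵥ : ℕ} (Γ : Matrix (AllIdx k₁ k₂ kᵥ) (AllIdx k₁ k₂ kᵥ) ℝ)
  (SigmaU : Matrix (ObsIdx k₁ k₂) (ObsIdx k₁ k₂) ℝ) (lam : ObsIdx k₁ k₂ → ℝ)

/-- `η̃ = 𝓘_{k₂} η`. -/
def etaTilde (η : ObsIdx k₁ k₂ → Fin kᵥ → ℝ) : Matrix (ObsIdx k₁ k₂) (Fin kᵥ) ℝ :=
  weakProj k₁ k₂ * Matrix.of η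

/-- `(I; η̃) Γ (I; η̃)' + 𝓘_{k₂} Σ_u 𝓘_{k₂}`. -/
def limGram (η : ObsIdx k₁ k₂ → Fin kᵥ → ℝ) : Matrix (ObsIdx k₁ k₂) (ObsIdx k₁ k₂) ℝ :=
  Matrix.fromCols (1 : Matrix (ObsIdx k₁ k₂) (ObsIdx k₁ k₂) ℝ) (etaTilde η) * Γ *
      (Matrix.fromCols (1 : Matrix (ObsIdx k₁ k₂) (ObsIdx k₁ k₂) ℝ) (etaTilde η))ᵀ
    + weakProj k₁ k₂ * SigmaU * weakProj k₁ k₂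

/-- Limit of the normalized omitted variable bias, as a function of `(ζ, η, η_v)`. -/
noncomputable def limOV (x : LimitSpace k₁ k₂ kᵥ) : ObsIdx k₁ k₂ → ℝ :=
  (limGram Γ SigmaU x.2.1)⁻¹ *ᵥ
    ((Γ.toBlocks₁₂ + etaTilde x.2.1 * Γ.toBlocks₂₂) *ᵥ (x.2.2 - (Matrix.of x.2.1)ᵀ *ᵥ lam))

/-- Limit of the normalized attenuation bias, as a function of `(ζ, η, η_v)`. -/
noncomputable def limA (x : LimitSpace k₁ k₂ kᵥ) : ObsIdx k₁ k₂ → ℝ :=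
  -((limGram Γ SigmaU x.2.1)⁻¹ *ᵥ ((weakProj k₁ k₂ * SigmaU) *ᵥ lam))

/-- `(vec η, η_v)` is jointly normal with mean zero and a nonsingular covariance matrix. -/
def NonsingularNormal (ν : Measure (LimitSpace k₁ k₂ kᵥ)) : Prop :=
  ∃ V : Matrix ((Fin kᵥ × ObsIdx k₁ k₂) ⊕ Fin kᵥ) ((Fin kᵥ × ObsIdx k₁ k₂) ⊕ Fin kᵥ) ℝ,
    V.PosDef ∧ IsCenteredNormal (ν.map fun x => Sum.elim (vec (Matrix.of x.2.1)) x.2.2) V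

end Limits

/-- The symmetric matrix whose free entries (one for each unordered pair of indexes) are `θ`. -/
def symMatrix {κ : Type*} (θ : Sym2 κ → ℝ) : Matrix κ κ ℝ := Matrix.of fun a b => θ s(a, b)

/-! Multiply the weak components of β̂ᵢ by √T. The first pass then reads exactly B mᵢ, where mᵢ =
(γᵢ, √T uᵢ) stacks the normalized loadings and first-pass errors of asset i, and B = (I, D G η_T, D
G) is common to all assets. Here G is the inverse sample second moment matrix of F̃ times Σ_F, and D
is diagonal with T^{-1/2} on the strong and 1 on the weak components (`scaleLoad_mul_betaHat`).
Hence all cross-sectional sums depend on the assets only through averages of products of the mᵢ and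
the averaged errors. The Gram matrix, the two biases and λ̂ - λ̃, suitably scaled, become the
explicit functions `repGram`, `repOV`, `repA`, `repTotal` of a random state (ζ_T, η_T, η_{v,T}) and
of statistics with non-random limits.

Those limits (`tendsToProb_constT`) rest on one computation. A moment of two error averages splits
into a diagonal part over t = s, controlled by assumption, and N^{-1/2} times a normalized sum of
ρ(t,s) over pairs t < s. By conditional independence distinct pairs are orthogonal, so the pair sums
are bounded in L² and the factor N^{-1/2} removes them, whatever the relative rates of N and T.

In the limit D becomes the projection on the weak factors and G the identity, so the Gram matrix
becomes M. It is bounded below by the smallest eigenvalue of Γ, uniformly in η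
(`mul_le_dotProduct_limGram_mulVec`). The functions above are therefore continuous at the limiting
constants, and Slutsky's theorem gives all weak limits. The decompositions hold because `repTotal` -
`repA` - `repOV` vanishes at these constants.

Non-normality of X^OV and of X^A + X^OV: with Z = `missingCoef`, the push-through identity writes a
weak coordinate of either, up to a constant, as Q⁻¹(a + A g₂) · (m + L g₃). Here g₂, g₃ are standard
normal, g₃ is independent of the remaining variables, and Q grows at most polynomially.
Conditionally this is normal with a variance that vanishes at a + A g₂ = 0, so its characteristic
function decays exactly like s^{-kᵥ}; no normal law behaves so (`not_isGaussian_map_dotProduct`).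

For X^A put c = 𝓘 Σ_u λ ≠ 0. Then c · X^A = -c'M⁻¹c < 0, which makes the mean nonzero. A normal law
on a half-line is a point mass, so normality would make c'M⁻¹c constant in η; letting η grow along c
refutes this.

The mean of X^OV is affine in λ, so for almost every λ it is nonzero once its slope in one weak
premium is nonzero. Adding t to the observed-loadings block of Γ replaces M by M + tI in the slope.
The slope is then analytic in t and, multiplied by t, tends to E η_j'Γ_μμ η_j > 0 up to sign, so it
vanishes for almost no t. Fubini along lines gives the claim for almost every (λ, Γ). -/

/-! ### Convergence in probability and Slutsky's theorem along varying probability spaces. -/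

section ConvergenceTools

variable {ι : Type*} {Ω : ι → Type*} {mΩ : ∀ i, MeasurableSpace (Ω i)}

/-- Convergence in probability to a constant, along a family of probability spaces. -/
def TendsToProb {E : Type*} [TopologicalSpace E] (P : ∀ i, Measure (Ω i)) (l : Filter ι)
    (X : ∀ i, Ω i → E) (c : E) : Prop :=
  ∀ U ∈ 𝓝 c, Tendsto (fun i => P i {ω | X i ω ∉ U}) l (𝓝 0)

variable {P : ∀ i, Measure (Ω i)} {l : Filter ι}

lemma tendsto_zero_of_le {f g : ι → ℝ≥0∞} (hg : Tendsto g l (𝓝 0)) (h : ∀ i, f i ≤ g i) :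
    Tendsto f l (𝓝 0) :=
  tendsto_of_tendsto_of_tendsto_of_le_of_le tendsto_const_nhds hg (fun _ => zero_le) h

lemma tendsto_measure_union {s t : ∀ i, Set (Ω i)} (hs : Tendsto (fun i => P i (s i)) l (𝓝 0))
    (ht : Tendsto (fun i => P i (t i)) l (𝓝 0)) :
    Tendsto (fun i => P i (s i ∪ t i)) l (𝓝 0) :=
  tendsto_zero_of_le (by simpa using hs.add ht) fun i => measure_union_le _ _

namespace TendsToProb

variable {E E' : Type*} [TopologicalSpace E] [TopologicalSpace E']

lemma comp {X : ∀ i, Ω i → E} {c : E} (h : TendsToProb P l X c) {f : E → E'}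
    (hf : ContinuousAt f c) : TendsToProb P l (fun i ω => f (X i ω)) (f c) :=
  fun U hU => h (f ⁻¹' U) (hf hU)

lemma prodMk {X : ∀ i, Ω i → E} {Y : ∀ i, Ω i → E'} {c : E} {d : E'}
    (hX : TendsToProb P l X c) (hY : TendsToProb P l Y d) :
    TendsToProb P l (fun i ω => (X i ω, Y i ω)) (c, d) := by
  intro U hU
  rw [nhds_prod_eq, mem_prod_iff] at hU
  obtain ⟨s, hs, t, ht, hst⟩ := hU
  refine tendsto_zero_of_le (tendsto_measure_union (hX s hs) (hY t ht)) fun i => measure_mono ?_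
  intro ω hω
  by_contra hcon
  simp only [Set.mem_union, Set.mem_ofPred_eq, not_or, not_not] at hcon
  exact hω (hst ⟨hcon.1, hcon.2⟩)

lemma pi {κ : Type*} [Fintype κ] {F : κ → Type*} [∀ k, TopologicalSpace (F k)]
    {X : ∀ i, Ω i → ∀ k, F k} {c : ∀ k, F k}
    (h : ∀ k, TendsToProb P l (fun i ω => X i ω k) (c k)) : TendsToProb P l X c := by
  intro U hU
  rw [nhds_pi, mem_pi'] at hU
  obtain ⟨I, t, ht, hU⟩ := hU
  have hsum : Tendsto (fun i => ∑ k, P i {ω | X i ω k ∉ t k}) l (𝓝 0) := by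
    simpa using tendsto_finsetSum (Finset.univ : Finset κ) fun k _ => h k (t k) (ht k)
  refine tendsto_zero_of_le hsum fun i => ?_
  refine (measure_mono ?_).trans (measure_iUnion_fintype_le _ _)
  intro ω hω
  by_contra hcon
  simp only [Set.mem_iUnion, Set.mem_ofPred_eq, not_exists, not_not] at hcon
  exact hω (hU fun k _ => hcon k)

lemma congr {X Y : ∀ i, Ω i → E} {c : E} (h : TendsToProb P l X c)
    (hXY : Tendsto (fun i => P i {ω | X i ω ≠ Y i ω}) l (𝓝 0)) : TendsToProb P l Y c := by
  intro U hU
  refine tendsto_zero_of_le (tendsto_measure_union (h U hU) hXY) fun i => measure_mono ?_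
  intro ω hω
  by_contra hcon
  simp only [Set.mem_union, Set.mem_ofPred_eq, not_or, not_not] at hcon
  exact hω (hcon.2 ▸ hcon.1)

lemma of_tendsto {x : ι → E} {c : E} (h : Tendsto x l (𝓝 c)) :
    TendsToProb P l (fun i _ => x i) c := by
  intro U hU
  refine tendsto_const_nhds.congr' ?_
  filter_upwards [h hU] with i hi
  have hi' : x i ∈ U := hi
  simp [hi']

lemma iff_real {X : ∀ i, Ω i → ℝ} {c : ℝ} : TendsToProb P l X c ↔
    ∀ ε : ℝ, 0 < ε → Tendsto (fun i => P i {ω | ε ≤ |X i ω - c|}) l (𝓝 0) := by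
  constructor
  · intro h ε hε
    refine tendsto_zero_of_le (h _ (Metric.ball_mem_nhds c hε)) fun i => measure_mono ?_
    intro ω hω
    simpa [Real.dist_eq] using hω
  · intro h U hU
    obtain ⟨ε, hε, hU⟩ := Metric.mem_nhds_iff.1 hU
    refine tendsto_zero_of_le (h ε hε) fun i => measure_mono ?_
    intro ω hω
    by_contra hcon
    exact hω (hU (by simpa [Real.dist_eq] using hcon))

end TendsToProb

variable [∀ i, IsProbabilityMeasure (P i)]

/-- **Slutsky's theorem** for a map that is continuous near the limit, along a family of
probability spaces. -/
theorem MeasureTheory.TendstoInDistribution.slutsky_map [l.IsCountablyGenerated]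
    {Ω' : Type*} {mΩ' : MeasurableSpace Ω'} {ν : Measure Ω'} [IsProbabilityMeasure ν]
    {E E' F : Type*} [TopologicalSpace E] [MeasurableSpace E] [OpensMeasurableSpace E]
    [HasOuterApproxClosed E]
    [TopologicalSpace E'] [FirstCountableTopology E']
    [TopologicalSpace F] [MeasurableSpace F] [OpensMeasurableSpace F]
    {X : ∀ i, Ω i → E} {Z : Ω' → E} {C : ∀ i, Ω i → E'} {c : E'} {Y : ∀ i, Ω i → F}
    (hX : TendstoInDistribution X l Z P ν) (hC : TendsToProb P l C c) {f : E × E' → F}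
    (hf : ∀ x, ContinuousAt f (x, c)) (hY : ∀ i, AEMeasurable (Y i) (P i))
    (hfZ : AEMeasurable (fun ω => f (Z ω, c)) ν)
    (hYf : Tendsto (fun i => P i {ω | Y i ω ≠ f (X i ω, C i ω)}) l (𝓝 0)) :
    TendstoInDistribution Y l (fun ω => f (Z ω, c)) P ν := by
  refine ⟨hY, hfZ, tendsto_of_forall_isOpen_le_liminf' fun G hG => ?_⟩
  simp only [ProbabilityMeasure.coe_mk]
  rw [Measure.map_apply_of_aemeasurable hfZ hG.measurableSet]
  obtain ⟨V, hV⟩ := (𝓝 c).exists_antitone_basis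
  -- Portmanteau with open sets. `O n` is the largest open set whose points are sent into G by f
  -- together with every y in `V n`. These sets increase, and continuity of f at the points (x, c)
  -- makes them exhaust the preimage of G, so it suffices to bound the mass of a single `O n`.
  let O : ℕ → Set E := fun n => ⋃₀ {W | IsOpen W ∧ ∀ x ∈ W, ∀ y ∈ V n, f (x, y) ∈ G}
  have hOo : ∀ n, IsOpen (O n) := fun n => isOpen_sUnion fun W hW => hW.1
  have hOm : Monotone O := by
    intro m n hmn x hx
    obtain ⟨W, hW, hxW⟩ := hx
    exact ⟨W, ⟨hW.1, fun x hx y hy => hW.2 x hx y (hV.antitone hmn hy)⟩, hxW⟩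
  have hsub : (fun ω => f (Z ω, c)) ⁻¹' G ⊆ ⋃ n, Z ⁻¹' O n := by
    intro ω hω
    have hmem : f ⁻¹' G ∈ 𝓝 (Z ω, c) := hf (Z ω) (hG.mem_nhds hω)
    rw [nhds_prod_eq, mem_prod_iff] at hmem
    obtain ⟨s, hs, t, ht, hst⟩ := hmem
    obtain ⟨W, hWs, hWo, hxW⟩ := mem_nhds_iff.1 hs
    obtain ⟨n, -, hn⟩ := hV.1.mem_iff.1 ht
    exact Set.mem_iUnion.2 ⟨n, W, ⟨hWo, fun x hx y hy => hst ⟨hWs hx, hn hy⟩⟩, hxW⟩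
  refine (measure_mono hsub).trans ?_
  have hmono : Monotone fun n => Z ⁻¹' O n := fun m n hmn => Set.preimage_mono (hOm hmn)
  rw [hmono.measure_iUnion]
  refine iSup_le fun n => ?_
  have h1 := ProbabilityMeasure.le_liminf_measure_open_of_tendsto hX.tendsto (hOo n)
  simp only [ProbabilityMeasure.coe_mk] at h1
  rw [Measure.map_apply_of_aemeasurable hX.aemeasurable_limit (hOo n).measurableSet] at h1
  refine h1.trans ?_
  -- Outside two events of vanishing probability, X ∈ `O n` forces Y ∈ G; such events do not change
  -- a liminf.
  have hsmall := (hC (V n) (hV.1.mem_of_mem trivial)).add hYf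
  rw [add_zero] at hsmall
  have h2 : l.liminf (fun i => (P i).map (X i) (O n)) ≤
      l.liminf ((fun i => (P i).map (Y i) G) + fun i => P i {ω | C i ω ∉ V n} +
        P i {ω | Y i ω ≠ f (X i ω, C i ω)}) := by
    refine liminf_le_liminf (Eventually.of_forall fun i => ?_)
    rw [Measure.map_apply_of_aemeasurable (hX.forall_aemeasurable i) (hOo n).measurableSet,
      Pi.add_apply, Measure.map_apply_of_aemeasurable (hY i) hG.measurableSet]
    refine (measure_mono ?_).trans ((measure_union_le _ _).trans
      (add_le_add le_rfl (measure_union_le _ _)))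
    intro ω hω
    by_contra hcon
    simp only [Set.mem_union, Set.mem_preimage, Set.mem_ofPred_eq, not_or, not_not] at hcon
    obtain ⟨W, hW, hxW⟩ := hω
    exact hcon.1 (hcon.2.2 ▸ hW.2 _ hxW _ hcon.2.1)
  refine h2.trans (le_of_eq ?_)
  exact ENNReal.liminf_add_of_right_tendsto_zero hsmall _

/-- Convergence in distribution to a constant implies convergence in probability. -/
lemma MeasureTheory.TendstoInDistribution.tendsToProb
    {Ω' : Type*} {mΩ' : MeasurableSpace Ω'} {ν : Measure Ω'} [IsProbabilityMeasure ν]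
    {E : Type*} [TopologicalSpace E] [MeasurableSpace E] [OpensMeasurableSpace E]
    [HasOuterApproxClosed E]
    {X : ∀ i, Ω i → E} {c : E}
    (hX : TendstoInDistribution X l (fun _ : Ω' => c) P ν) : TendsToProb P l X c := by
  intro U hU
  obtain ⟨W, hWU, hWo, hcW⟩ := mem_nhds_iff.1 hU
  rcases l.eq_or_neBot with rfl | hl
  · exact tendsto_bot
  have h1 := ProbabilityMeasure.limsup_measure_closed_le_of_tendsto hX.tendsto hWo.isClosed_compl
  simp only [ProbabilityMeasure.coe_mk] at h1
  rw [Measure.map_apply_of_aemeasurable hX.aemeasurable_limit hWo.measurableSet.compl] at h1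
  have h2 : (fun _ : Ω' => c) ⁻¹' Wᶜ = ∅ := by ext; simp [hcW]
  rw [h2, measure_empty] at h1
  have h3 : Tendsto (fun i => (P i).map (X i) Wᶜ) l (𝓝 0) :=
    tendsto_of_le_liminf_of_limsup_le zero_le h1
  refine tendsto_zero_of_le h3 fun i => ?_
  rw [Measure.map_apply_of_aemeasurable (hX.forall_aemeasurable i) hWo.measurableSet.compl]
  exact measure_mono fun ω hω h => hω (hWU h)

/-- Slutsky with a trivial random part: the constant family in the one-point space converges in law,
and f is the second projection. -/
lemma TendsToProb.tendstoInDistribution [l.IsCountablyGenerated]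
    {Ω' : Type*} {mΩ' : MeasurableSpace Ω'} {ν : Measure Ω'} [IsProbabilityMeasure ν]
    {E : Type*} [TopologicalSpace E] [FirstCountableTopology E] [MeasurableSpace E]
    [OpensMeasurableSpace E]
    {X : ∀ i, Ω i → E} {c : E} (h : TendsToProb P l X c) (hX : ∀ i, AEMeasurable (X i) (P i)) :
    TendstoInDistribution X l (fun _ : Ω' => c) P ν := by
  have h0 : TendstoInDistribution (fun (_ : ι) (_ : Ω _) => ()) l (fun _ : Ω' => ()) P ν := by
    refine ⟨fun i => aemeasurable_const, aemeasurable_const, ?_⟩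
    refine tendsto_const_nhds.congr fun i => ?_
    ext s hs
    simp only [ProbabilityMeasure.coe_mk, Measure.map_const, measure_univ, one_smul]
  exact h0.slutsky_map (f := fun p : Unit × E => p.2) h (fun _ => continuousAt_snd) hX
    aemeasurable_const (by simpa using tendsto_const_nhds)

end ConvergenceTools

/-! ### Families with bounded second moments. -/

section BoundedInL2

variable {ι : Type*} {Ω : ι → Type*} {mΩ : ∀ i, MeasurableSpace (Ω i)}

/-- The second moments are eventually bounded. -/
def BddSecondMoment (P : ∀ i, Measure (Ω i)) (l : Filter ι) (X : ∀ i, Ω i → ℝ) : Prop :=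
  ∃ C : ℝ≥0∞, C ≠ ⊤ ∧ ∀ᶠ i in l, ∫⁻ ω, ENNReal.ofReal (X i ω ^ 2) ∂(P i) ≤ C

variable {P : ∀ i, Measure (Ω i)} {l : Filter ι}

/-- A null sequence times a product of two families with bounded second moments vanishes in
probability. -/
lemma BddSecondMoment.tendsToProb_mul {X Y : ∀ i, Ω i → ℝ} (hX : BddSecondMoment P l X)
    (hY : BddSecondMoment P l Y) (hXm : ∀ i, Measurable (X i)) (hYm : ∀ i, Measurable (Y i))
    {a : ι → ℝ} (ha : Tendsto a l (𝓝 0)) :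
    TendsToProb P l (fun i ω => a i * (X i ω * Y i ω)) 0 := by
  obtain ⟨C, hC, hX⟩ := hX
  obtain ⟨D, hD, hY⟩ := hY
  rw [TendsToProb.iff_real]
  intro ε hε
  have hlim : Tendsto (fun i => ENNReal.ofReal (|a i| / ε) * (C + D)) l (𝓝 0) := by
    have h1 : Tendsto (fun i => ENNReal.ofReal (|a i| / ε)) l (𝓝 0) := by
      have : Tendsto (fun i => |a i| / ε) l (𝓝 0) := by simpa using ha.abs.div_const ε
      simpa using ENNReal.tendsto_ofReal this
    simpa using ENNReal.Tendsto.mul_const h1 (b := C + D)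
      (Or.inr (ENNReal.add_ne_top.2 ⟨hC, hD⟩))
  refine tendsto_of_tendsto_of_tendsto_of_le_of_le' tendsto_const_nhds hlim
    (Eventually.of_forall fun _ => zero_le) ?_
  filter_upwards [hX, hY] with i hXi hYi
  -- Since |XY| ≤ X² + Y², the event lies in a level set of a function with small integral, and
  -- Markov's inequality applies.
  have hsub : {ω | ε ≤ |a i * (X i ω * Y i ω) - 0|} ⊆
      {ω | 1 ≤ ENNReal.ofReal (|a i| / ε) *
        (ENNReal.ofReal (X i ω ^ 2) + ENNReal.ofReal (Y i ω ^ 2))} := by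
    intro ω hω
    simp only [Set.mem_ofPred_eq, sub_zero, abs_mul] at hω ⊢
    rw [← ENNReal.ofReal_add (sq_nonneg _) (sq_nonneg _), ← ENNReal.ofReal_mul (by positivity),
      ENNReal.one_le_ofReal, div_mul_eq_mul_div, one_le_div hε]
    refine hω.trans (mul_le_mul_of_nonneg_left ?_ (abs_nonneg _))
    nlinarith [sq_nonneg (|X i ω| - |Y i ω|), sq_abs (X i ω), sq_abs (Y i ω),
      abs_nonneg (X i ω), abs_nonneg (Y i ω), sq_nonneg (X i ω), sq_nonneg (Y i ω)]
  have hm1 : Measurable fun ω => ENNReal.ofReal (X i ω ^ 2) :=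
    ((hXm i).pow_const 2).ennreal_ofReal
  have hm2 : Measurable fun ω => ENNReal.ofReal (Y i ω ^ 2) :=
    ((hYm i).pow_const 2).ennreal_ofReal
  calc P i {ω | ε ≤ |a i * (X i ω * Y i ω) - 0|}
      ≤ _ := measure_mono hsub
    _ ≤ ∫⁻ ω, ENNReal.ofReal (|a i| / ε) *
        (ENNReal.ofReal (X i ω ^ 2) + ENNReal.ofReal (Y i ω ^ 2)) ∂(P i) := by
        simpa using mul_meas_ge_le_lintegral ((hm1.add hm2).const_mul
          (ENNReal.ofReal (|a i| / ε))) 1 (μ := P i)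
    _ = ENNReal.ofReal (|a i| / ε) * (∫⁻ ω, ENNReal.ofReal (X i ω ^ 2) ∂(P i) +
        ∫⁻ ω, ENNReal.ofReal (Y i ω ^ 2) ∂(P i)) := by
        rw [lintegral_const_mul _ (by exact hm1.add hm2), lintegral_add_left hm1]
    _ ≤ _ := by gcongr

end BoundedInL2

/-! ### Conditional independence and vanishing conditional means. -/

section ConditionalIndependence

set_option linter.unusedSectionVars false

variable {Ω τ κ : Type*} {m mΩ : MeasurableSpace Ω} {P : Measure Ω} [IsProbabilityMeasure P]
  [Fintype τ] [DecidableEq τ] [Fintype κ] {e : τ → Ω → κ → ℝ}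

/-- The sets determined by `m` and by the coordinates of the family `e` other than `s`. -/
def cylindersExcept (m : MeasurableSpace Ω) (e : τ → Ω → κ → ℝ) (s : τ) : Set (Set Ω) :=
  {H | ∃ (A : Set Ω) (B : τ → Set (κ → ℝ)), MeasurableSet[m] A ∧ (∀ t, MeasurableSet (B t)) ∧
    B s = Set.univ ∧ H = A ∩ ⋂ t, e t ⁻¹' B t}

lemma isPiSystem_cylindersExcept (s : τ) : IsPiSystem (cylindersExcept m e s) := by
  rintro _ ⟨A, B, hA, hB, hBs, rfl⟩ _ ⟨A', B', hA', hB', hBs', rfl⟩ -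
  refine ⟨A ∩ A', fun t => B t ∩ B' t, hA.inter hA', fun t => (hB t).inter (hB' t),
    by simp [hBs, hBs'], ?_⟩
  simp only [Set.preimage_inter, Set.iInter_inter_distrib]
  ext ω
  simp only [Set.mem_inter_iff]
  tauto

/-- The σ-algebra generated by `m` and the coordinates of `e` other than `s`. -/
abbrev sigmaExcept (m : MeasurableSpace Ω) (e : τ → Ω → κ → ℝ) (s : τ) : MeasurableSpace Ω :=
  MeasurableSpace.generateFrom (cylindersExcept m e s)

lemma le_sigmaExcept (s : τ) : m ≤ sigmaExcept m e s := fun A hA =>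
  MeasurableSpace.measurableSet_generateFrom
    ⟨A, fun _ => Set.univ, hA, fun _ => MeasurableSet.univ, rfl, by simp⟩

lemma measurable_sigmaExcept {s t : τ} (hts : t ≠ s) : Measurable[sigmaExcept m e s] (e t) := by
  intro S hS
  refine MeasurableSpace.measurableSet_generateFrom
    ⟨Set.univ, Function.update (fun _ => Set.univ) t S, MeasurableSet.univ, fun r => ?_, ?_, ?_⟩
  · rcases eq_or_ne r t with rfl | h
    · simpa using hS
    · simp [h]
  · simp [hts.symm]
  · ext ω
    simp only [Set.mem_preimage, Set.univ_inter, Set.mem_iInter]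
    constructor
    · intro h r
      rcases eq_or_ne r t with rfl | hr
      · simpa using h
      · simp [hr]
    · intro h
      simpa using h t

lemma sigmaExcept_le (hm : m ≤ mΩ) (he : ∀ t, Measurable (e t)) (s : τ) :
    sigmaExcept m e s ≤ mΩ := by
  refine MeasurableSpace.generateFrom_le ?_
  rintro _ ⟨A, B, hA, hB, -, rfl⟩
  exact (hm _ hA).inter (MeasurableSet.iInter fun t => he t (hB t))

section

variable (hm : m ≤ mΩ) (he : ∀ t, Measurable (e t))
  (hind : ∀ B : τ → Set (κ → ℝ), (∀ t, MeasurableSet (B t)) →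
    P⟦⋂ t, e t ⁻¹' B t | m⟧ =ᵐ[P] ∏ t, P⟦e t ⁻¹' B t | m⟧)
include hm he hind

/-- The constraint on the free coordinate s contributes the factor one to the product formula;
replacing it by S changes only this factor, into the conditional probability of S. -/
lemma condProb_inter_eq_mul {s : τ} {B : τ → Set (κ → ℝ)} (hB : ∀ t, MeasurableSet (B t))
    (hBs : B s = Set.univ) {S : Set (κ → ℝ)} (hS : MeasurableSet S) :
    P⟦(⋂ t, e t ⁻¹' B t) ∩ e s ⁻¹' S | m⟧ =ᵐ[P] P⟦⋂ t, e t ⁻¹' B t | m⟧ * P⟦e s ⁻¹' S | m⟧ := by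
  have hset : (⋂ t, e t ⁻¹' B t) ∩ e s ⁻¹' S = ⋂ t, e t ⁻¹' (Function.update B s S t) := by
    ext ω
    simp only [Set.mem_inter_iff, Set.mem_iInter, Set.mem_preimage]
    constructor
    · rintro ⟨h1, h2⟩ t
      rcases eq_or_ne t s with rfl | h
      · simpa using h2
      · simpa [h] using h1 t
    · intro h
      refine ⟨fun t => ?_, by simpa using h s⟩
      rcases eq_or_ne t s with rfl | ht
      · simp [hBs]
      · simpa [ht] using h t
  have hB' : ∀ t, MeasurableSet (Function.update B s S t) := by
    intro t
    rcases eq_or_ne t s with rfl | h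
    · simpa using hS
    · simpa [h] using hB t
  have h1 := hind _ hB'
  have h2 := hind _ hB
  have h3 : P⟦e s ⁻¹' B s | m⟧ =ᵐ[P] fun _ => 1 := by
    rw [hBs, Set.preimage_univ]
    have : (Set.univ : Set Ω).indicator (fun _ => (1 : ℝ)) = fun _ => 1 := by simp
    rw [this, condExp_const hm]
  rw [hset]
  filter_upwards [h1, h2, h3] with ω h1 h2 h3
  rw [h1, Pi.mul_apply, h2, Finset.prod_apply, Finset.prod_apply,
    ← Finset.mul_prod_erase _ _ (Finset.mem_univ s), ← Finset.mul_prod_erase _ _ (Finset.mem_univ s),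
    h3, one_mul, mul_comm, Function.update_self]
  congr 1
  refine Finset.prod_congr rfl fun t ht => ?_
  rw [Function.update_of_ne (Finset.ne_of_mem_erase ht)]

/-- Let E be the event imposed on the other coordinates and g = P(E | m). By conditional
independence, e_s has the same law under P restricted to A ∩ E as under the measure with density g
on A. As g is m-measurable, it can be pulled out, and what remains is the conditional mean of e_s
given m, which is zero. -/
lemma setIntegral_cylinder_eq_zero {s : τ} {k : κ} (hint : Integrable (fun ω => e s ω k) P)
    (hmean : P[fun ω => e s ω k | m] =ᵐ[P] 0) {A : Set Ω} (hA : MeasurableSet[m] A)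
    {B : τ → Set (κ → ℝ)} (hB : ∀ t, MeasurableSet (B t)) (hBs : B s = Set.univ) :
    ∫ ω in A ∩ ⋂ t, e t ⁻¹' B t, e s ω k ∂P = 0 := by
  set E : Set Ω := ⋂ t, e t ⁻¹' B t with hE
  have hEm : MeasurableSet E := MeasurableSet.iInter fun t => he t (hB t)
  have hA' := hm _ hA
  set g : Ω → ℝ := P⟦E | m⟧ with hg
  have hgm : StronglyMeasurable[m] g := stronglyMeasurable_condExp
  have hg0 : 0 ≤ᵐ[P] g := condExp_nonneg (ae_of_all _ fun ω => by
    simp only [Pi.zero_apply]; exact Set.indicator_nonneg (fun _ _ => zero_le_one) ω)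
  have hg1 : ∀ᵐ ω ∂P, ‖g ω‖ ≤ 1 := by
    have hle : g ≤ᵐ[P] fun _ => 1 := by
      have h := condExp_mono (m := m) (μ := P) (f := E.indicator fun _ => (1 : ℝ))
        (g := fun _ => 1) ((integrable_const 1).indicator hEm) (integrable_const 1)
        (ae_of_all _ fun ω => Set.indicator_le_self' (by simp) ω)
      rwa [condExp_const hm] at h
    filter_upwards [hg0, hle] with ω h0 h1
    rw [Real.norm_of_nonneg h0]
    exact h1
  have hgi : Integrable g P := integrable_condExp
  have hpull : ∀ f : Ω → ℝ, Integrable f P → ∫ ω in A, g ω * f ω ∂P =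
      ∫ ω in A, g ω * (P[f | m]) ω ∂P := by
    intro f hf
    have hgf : Integrable (fun ω => g ω * f ω) P :=
      hf.bdd_mul (hgm.mono hm).aestronglyMeasurable hg1
    rw [← setIntegral_condExp hm hgf hA]
    refine setIntegral_congr_ae hA' ?_
    filter_upwards [condExp_mul_of_stronglyMeasurable_left hgm hgf hf] with ω hω _
    exact hω
  have hlaw : (P.restrict (A ∩ E)).map (e s) =
      ((P.restrict A).withDensity fun ω => ENNReal.ofReal (g ω)).map (e s) := by
    ext S hS
    have hS' := he s hS
    rw [Measure.map_apply (he s) hS, Measure.map_apply (he s) hS, Measure.restrict_apply hS',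
      withDensity_apply _ hS', Measure.restrict_restrict hS']
    have h1 : ∫⁻ ω in e s ⁻¹' S ∩ A, ENNReal.ofReal (g ω) ∂P =
        ENNReal.ofReal (∫ ω in e s ⁻¹' S ∩ A, g ω ∂P) :=
      (ofReal_integral_eq_lintegral_ofReal hgi.integrableOn (ae_restrict_of_ae hg0)).symm
    have h2 : ∫ ω in e s ⁻¹' S ∩ A, g ω ∂P = P.real (e s ⁻¹' S ∩ (A ∩ E)) := by
      have h3 : ∫ ω in e s ⁻¹' S ∩ A, g ω ∂P =
          ∫ ω in A, g ω * (e s ⁻¹' S).indicator (fun _ => 1) ω ∂P := by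
        rw [← Measure.restrict_restrict hS', ← integral_indicator hS']
        congr 1 with ω
        by_cases h : ω ∈ e s ⁻¹' S <;> simp [h]
      rw [h3, hpull _ ((integrable_const 1).indicator hS')]
      have h4 : ∫ ω in A, g ω * (P⟦e s ⁻¹' S | m⟧) ω ∂P =
          ∫ ω in A, (P⟦E ∩ e s ⁻¹' S | m⟧) ω ∂P := by
        refine setIntegral_congr_ae hA' ?_
        filter_upwards [condProb_inter_eq_mul hm he hind hB hBs hS] with ω hω _
        exact hω.symm
      rw [h4, setIntegral_condExp hm ((integrable_const 1).indicator (hEm.inter hS')) hA,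
        setIntegral_indicator (hEm.inter hS')]
      simp only [integral_const, smul_eq_mul, mul_one, measureReal_restrict_apply_univ]
      congr 1
      ext ω
      simp only [Set.mem_inter_iff]
      tauto
    rw [h1, h2, ofReal_measureReal]
  have hk : ∀ μ : Measure Ω, ∫ ω, e s ω k ∂μ = ∫ x, x k ∂(μ.map (e s)) := fun μ =>
    (integral_map (he s).aemeasurable (measurable_pi_apply k).aestronglyMeasurable).symm
  -- The integral of a coordinate of e_s depends on the measure only through the law of e_s, so
  -- restriction to A ∩ E may be traded for the density g on A.
  rw [hk, hlaw, ← hk, integral_withDensity_eq_integral_toReal_smul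
    ((hgm.mono hm).measurable.ennreal_ofReal) (ae_of_all _ fun _ => ENNReal.ofReal_lt_top)]
  have h5 : ∫ ω in A, (ENNReal.ofReal (g ω)).toReal • e s ω k ∂P =
      ∫ ω in A, g ω * e s ω k ∂P := by
    refine setIntegral_congr_ae hA' ?_
    filter_upwards [hg0] with ω hω _
    rw [ENNReal.toReal_ofReal hω, smul_eq_mul]
  rw [h5, hpull _ hint]
  have h6 : ∫ ω in A, g ω * (P[fun ω => e s ω k | m]) ω ∂P = ∫ ω in A, 0 ∂P := by
    refine setIntegral_congr_ae hA' ?_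
    filter_upwards [hmean] with ω hω _
    rw [hω, Pi.zero_apply, mul_zero]
  rw [h6, integral_zero]

/-- Dynkin's π-λ argument: the integrals of e_s vanish over the cylinders, which form a π-system,
and the class of sets with this property is closed under complements, because the full mean is zero,
and under disjoint unions. -/
lemma condExp_sigmaExcept_eq_zero {s : τ} {k : κ} (hint : Integrable (fun ω => e s ω k) P)
    (hmean : P[fun ω => e s ω k | m] =ᵐ[P] 0) :
    P[fun ω => e s ω k | sigmaExcept m e s] =ᵐ[P] 0 := by
  have hle := sigmaExcept_le hm he s
  have key : ∀ H, MeasurableSet[sigmaExcept m e s] H → ∫ ω in H, e s ω k ∂P = 0 := by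
    refine MeasurableSpace.induction_on_inter rfl (isPiSystem_cylindersExcept s) ?_ ?_ ?_ ?_
    · simp
    · rintro _ ⟨A, B, hA, hB, hBs, rfl⟩
      exact setIntegral_cylinder_eq_zero hm he hind hint hmean hA hB hBs
    · intro H hH ih
      have hfull : ∫ ω, e s ω k ∂P = 0 := by
        rw [← integral_condExp hm, integral_congr_ae hmean]; simp
      have := integral_add_compl (hle H hH) hint
      rw [ih, hfull, zero_add] at this
      exact this
    · intro f hd hf ih
      rw [integral_iUnion (fun i => hle _ (hf i)) hd hint.integrableOn]
      simp [ih]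
  refine (ae_eq_condExp_of_forall_setIntegral_eq hle hint (fun _ _ _ => integrableOn_zero)
    (fun H hH _ => ?_) aestronglyMeasurable_zero).symm
  rw [key H hH]
  simp

/-- Conditionally independent and conditionally centered: a sum linear in the coordinate `s`, with
coefficients that depend only on the other coordinates, has mean zero. -/
lemma integral_sum_mul_eq_zero {s : τ} (hint : ∀ k, Integrable (fun ω => e s ω k) P)
    (hmean : ∀ k, P[fun ω => e s ω k | m] =ᵐ[P] 0) {Y : κ → Ω → ℝ}
    (hY : ∀ k, Measurable[sigmaExcept m e s] (Y k))
    (hX : Integrable (fun ω => ∑ k, e s ω k * Y k ω) P) :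
    ∫ ω, ∑ k, e s ω k * Y k ω ∂P = 0 := by
  have hle := sigmaExcept_le hm he s
  -- Only the whole sum is assumed integrable, not each product. On `A n` all coefficients are
  -- bounded by n, so there the terms can be treated one by one; the sets `A n` do not involve e_s
  -- and increase to the whole space.
  set A : ℕ → Set Ω := fun n => {ω | ∀ k, |Y k ω| ≤ n} with hAdef
  have hA : ∀ n, MeasurableSet[sigmaExcept m e s] (A n) := by
    intro n
    have : A n = ⋂ k, {ω | |Y k ω| ≤ n} := by ext; simp [hAdef]
    rw [this]
    refine MeasurableSet.iInter fun k => ?_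
    exact hY k (measurableSet_le measurable_id.abs (measurable_const (a := (n : ℝ))))
  have hmono : Monotone A := fun i j hij ω hω k => (hω k).trans (by exact_mod_cast hij)
  have hU : ⋃ n, A n = Set.univ := by
    refine Set.eq_univ_of_forall fun ω => ?_
    obtain ⟨n, hn⟩ := exists_nat_ge (∑ k, |Y k ω|)
    refine Set.mem_iUnion.2 ⟨n, fun k => le_trans ?_ hn⟩
    exact Finset.single_le_sum (f := fun k => |Y k ω|) (fun _ _ => abs_nonneg _)
      (Finset.mem_univ k)
  have hlim := tendsto_setIntegral_of_monotone (μ := P) (f := fun ω => ∑ k, e s ω k * Y k ω)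
    (fun n => hle _ (hA n)) hmono hX.integrableOn
  rw [hU, Measure.restrict_univ] at hlim
  refine tendsto_nhds_unique hlim (tendsto_const_nhds.congr fun n => ?_)
  have hYn : ∀ k, StronglyMeasurable[sigmaExcept m e s] ((A n).indicator (Y k)) := fun k =>
    (Measurable.stronglyMeasurable (hY k)).indicator (hA n)
  have hi : ∀ k, Integrable (fun ω => e s ω k * (A n).indicator (Y k) ω) P := by
    intro k
    refine (hint k).mul_bdd (c := n) ((hYn k).mono hle).aestronglyMeasurable (ae_of_all _ fun ω => ?_)
    by_cases h : ω ∈ A n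
    · simpa [h] using h k
    · simp [h]
  have hz : ∀ k, ∫ ω, e s ω k * (A n).indicator (Y k) ω ∂P = 0 := by
    intro k
    rw [← integral_condExp hle]
    have h1 := condExp_mul_of_stronglyMeasurable_right (hYn k) (hi k) (hint k)
    have h2 := condExp_sigmaExcept_eq_zero hm he hind (hint k) (hmean k)
    have h3 : P[fun ω => e s ω k * (A n).indicator (Y k) ω | sigmaExcept m e s] =ᵐ[P] 0 := by
      filter_upwards [h1, h2] with ω h1 h2
      refine h1.trans ?_
      simp [h2]
    rw [integral_congr_ae h3]
    simp
  rw [← integral_indicator (hle _ (hA n))]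
  have h4 : (A n).indicator (fun ω => ∑ k, e s ω k * Y k ω) =
      fun ω => ∑ k, e s ω k * (A n).indicator (Y k) ω := by
    ext ω
    by_cases h : ω ∈ A n <;> simp [h]
  rw [h4, integral_finsetSum _ fun k _ => hi k]
  simp [hz]

end

end ConditionalIndependence

/-! ### Second moments of orthogonal sums; L² bounds for the averages of errors and factors. -/

lemma dotProduct_self_nonneg_real {ι : Type*} [Fintype ι] (x : ι → ℝ) : 0 ≤ x ⬝ᵥ x :=
  Finset.sum_nonneg fun _ _ => mul_self_nonneg _

/-- Pythagoras in L². Orthogonality is required only when the product is integrable; the second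
moment bounds provide this, so users never have to check integrability of cross terms. -/
lemma lintegral_ofReal_sq_sum_le {Ω α : Type*} {mΩ : MeasurableSpace Ω} {P : Measure Ω}
    (s : Finset α) {ξ : α → Ω → ℝ} (hξ : ∀ a ∈ s, Measurable (ξ a)) {C : ℝ≥0∞} (hC : C ≠ ⊤)
    (hb : ∀ a ∈ s, ∫⁻ ω, ENNReal.ofReal (ξ a ω ^ 2) ∂P ≤ C)
    (horth : ∀ a ∈ s, ∀ b ∈ s, a ≠ b → Integrable (fun ω => ξ a ω * ξ b ω) P →
      ∫ ω, ξ a ω * ξ b ω ∂P = 0) :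
    ∫⁻ ω, ENNReal.ofReal ((∑ a ∈ s, ξ a ω) ^ 2) ∂P ≤ s.card * C := by
  have hsq : ∀ a ∈ s, Integrable (fun ω => ξ a ω ^ 2) P := fun a ha =>
    (lintegral_ofReal_ne_top_iff_integrable ((hξ a ha).pow_const 2).aestronglyMeasurable
      (ae_of_all _ fun ω => sq_nonneg _)).1 ((hb a ha).trans_lt hC.lt_top).ne
  have hint : ∀ a ∈ s, ∀ b ∈ s, Integrable (fun ω => ξ a ω * ξ b ω) P := fun a ha b hb' =>
    ((memLp_two_iff_integrable_sq (hξ a ha).aestronglyMeasurable).2 (hsq a ha)).integrable_mul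
      ((memLp_two_iff_integrable_sq (hξ b hb').aestronglyMeasurable).2 (hsq b hb'))
  have hexp : ∀ ω, (∑ a ∈ s, ξ a ω) ^ 2 = ∑ a ∈ s, ∑ b ∈ s, ξ a ω * ξ b ω := fun ω => by
    rw [sq, Finset.sum_mul_sum]
  have hI : Integrable (fun ω => (∑ a ∈ s, ξ a ω) ^ 2) P := by
    simp_rw [hexp]
    exact integrable_finsetSum _ fun a ha => integrable_finsetSum _ fun b hb' => hint a ha b hb'
  rw [← ofReal_integral_eq_lintegral_ofReal hI (ae_of_all _ fun ω => sq_nonneg _)]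
  have hval : ∫ ω, (∑ a ∈ s, ξ a ω) ^ 2 ∂P = ∑ a ∈ s, ∫ ω, ξ a ω ^ 2 ∂P := by
    simp_rw [hexp]
    rw [integral_finsetSum _ fun a ha => integrable_finsetSum _ fun b hb' => hint a ha b hb']
    refine Finset.sum_congr rfl fun a ha => ?_
    rw [integral_finsetSum _ fun b hb' => hint a ha b hb', Finset.sum_eq_single_of_mem a ha]
    · simp_rw [sq]
    · exact fun b hb' hab => horth a ha b hb' hab.symm (hint a ha b hb')
  rw [hval, ENNReal.ofReal_sum_of_nonneg fun a _ => integral_nonneg fun ω => sq_nonneg _]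
  calc ∑ a ∈ s, ENNReal.ofReal (∫ ω, ξ a ω ^ 2 ∂P) ≤ ∑ _a ∈ s, C := by
        refine Finset.sum_le_sum fun a ha => ?_
        rw [ofReal_integral_eq_lintegral_ofReal (hsq a ha) (ae_of_all _ fun ω => sq_nonneg _)]
        exact hb a ha
    _ = s.card * C := by simp

lemma sq_inv_mul_sum_le {τ : Type*} [Fintype τ] (x : τ → ℝ) :
    ((Fintype.card τ : ℝ)⁻¹ * ∑ t, x t) ^ 2 ≤ (Fintype.card τ : ℝ)⁻¹ * ∑ t, x t ^ 2 := by
  rcases isEmpty_or_nonempty τ with h | h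
  · simp
  have hpos : (0 : ℝ) < Fintype.card τ := by exact_mod_cast Fintype.card_pos
  have h1 := sq_sum_le_card_mul_sum_sq (s := (Finset.univ : Finset τ)) (f := x)
  rw [Finset.card_univ] at h1
  rw [mul_pow, inv_pow, inv_mul_le_iff₀ (by positivity)]
  calc (∑ t, x t) ^ 2 ≤ _ := h1
    _ = _ := by field_simp

lemma pow_four_inv_mul_sum_le {τ : Type*} [Fintype τ] (x : τ → ℝ) :
    ((Fintype.card τ : ℝ)⁻¹ * ∑ t, x t) ^ 4 ≤ (Fintype.card τ : ℝ)⁻¹ * ∑ t, x t ^ 4 := by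
  have h1 := sq_inv_mul_sum_le x
  have h2 := sq_inv_mul_sum_le fun t => x t ^ 2
  have h3 := pow_le_pow_left₀ (sq_nonneg _) h1 2
  calc ((Fintype.card τ : ℝ)⁻¹ * ∑ t, x t) ^ 4
      = (((Fintype.card τ : ℝ)⁻¹ * ∑ t, x t) ^ 2) ^ 2 := by ring
    _ ≤ _ := h3
    _ ≤ _ := h2
    _ = _ := by simp_rw [← pow_mul]

namespace FactorPanel

variable {k₁ k₂ kᵥ : ℕ} (D : FactorPanel.{u} k₁ k₂ kᵥ) (N T : ℕ)

attribute [fun_prop] FactorPanel.measurable_F FactorPanel.measurable_v FactorPanel.measurable_e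

@[fun_prop]
lemma measurable_F_apply (t : Fin T) (j : ObsIdx k₁ k₂) : Measurable fun ω => D.F N T t ω j :=
  (measurable_pi_apply j).comp (D.measurable_F N T t)

@[fun_prop]
lemma measurable_v_apply (t : Fin T) (l : Fin kᵥ) : Measurable fun ω => D.v N T t ω l :=
  (measurable_pi_apply l).comp (D.measurable_v N T t)

@[fun_prop]
lemma measurable_eVec (t : Fin T) : Measurable (D.eVec N T t) :=
  measurable_pi_lambda _ fun i => D.measurable_e N T i t

@[fun_prop]
lemma measurable_rho (t s : Fin T) : Measurable (D.rho N T t s) := by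
  unfold rho; fun_prop

lemma W_apply (t : Fin T) (ω : D.Ω N T) (a : AllIdx k₁ k₂ kᵥ) :
    D.W N T t ω a = (√(N : ℝ))⁻¹ * ∑ i, D.e N T i t ω * D.gam N T i a := by
  simp [W, Finset.sum_apply]

@[fun_prop]
lemma measurable_W_apply (t : Fin T) (a : AllIdx k₁ k₂ kᵥ) :
    Measurable fun ω => D.W N T t ω a := by
  simp_rw [W_apply]; fun_prop

lemma Fbar_apply (ω : D.Ω N T) (j : ObsIdx k₁ k₂) :
    D.Fbar N T ω j = (T : ℝ)⁻¹ * ∑ t, D.F N T t ω j := by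
  simp [Fbar, Finset.sum_apply]

@[fun_prop]
lemma measurable_Fbar_apply (j : ObsIdx k₁ k₂) : Measurable fun ω => D.Fbar N T ω j := by
  simp_rw [Fbar_apply]; fun_prop

lemma Ftilde_apply (t : Fin T) (ω : D.Ω N T) (j : ObsIdx k₁ k₂) :
    D.Ftilde N T t ω j = D.F N T t ω j - D.Fbar N T ω j := rfl

@[fun_prop]
lemma measurable_Ftilde_apply (t : Fin T) (j : ObsIdx k₁ k₂) :
    Measurable fun ω => D.Ftilde N T t ω j := by
  simp_rw [Ftilde_apply]; fun_prop

lemma factorSigma_le : D.factorSigma N T ≤ D.mΩ N T :=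
  sup_le (iSup_le fun t => (D.measurable_F N T t).comap_le)
    (iSup_le fun t => (D.measurable_v N T t).comap_le)

/-- A coordinate of `F_t`, or the constant `1`. -/
def weight (o : Option (ObsIdx k₁ k₂)) (t : Fin T) (ω : D.Ω N T) : ℝ :=
  o.elim 1 (D.F N T t ω)

@[fun_prop]
lemma measurable_weight (o : Option (ObsIdx k₁ k₂)) (t : Fin T) :
    Measurable (D.weight N T o t) := by
  cases o with
  | none => exact measurable_const
  | some j => exact D.measurable_F_apply N T t j

lemma measurable_weight_factorSigma (o : Option (ObsIdx k₁ k₂)) (t : Fin T) :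
    Measurable[D.factorSigma N T] (D.weight N T o t) := by
  cases o with
  | none => exact @measurable_const _ _ _ (D.factorSigma N T) _
  | some j =>
    have h1 : Measurable[D.factorSigma N T] (D.F N T t) :=
      Measurable.of_comap_le ((le_iSup (fun t => MeasurableSpace.comap (D.F N T t) inferInstance)
        t).trans le_sup_left)
    exact (measurable_pi_apply j).comp h1

lemma weight_sq_le (o : Option (ObsIdx k₁ k₂)) (t : Fin T) (ω : D.Ω N T) :
    D.weight N T o t ω ^ 2 ≤ 1 + D.F N T t ω ⬝ᵥ D.F N T t ω := by
  have h0 : 0 ≤ D.F N T t ω ⬝ᵥ D.F N T t ω := dotProduct_self_nonneg_real _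
  cases o with
  | none => simpa [weight] using h0
  | some j =>
    have h1 : D.F N T t ω j ^ 2 ≤ D.F N T t ω ⬝ᵥ D.F N T t ω := by
      rw [sq]
      exact Finset.single_le_sum (f := fun j => D.F N T t ω j * D.F N T t ω j)
        (fun i _ => mul_self_nonneg _) (Finset.mem_univ j)
    simp only [weight, Option.elim_some]
    linarith

lemma weight_pow_four_le (o : Option (ObsIdx k₁ k₂)) (t : Fin T) (ω : D.Ω N T) :
    D.weight N T o t ω ^ 4 ≤ 1 + (D.F N T t ω ⬝ᵥ D.F N T t ω) ^ 2 := by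
  cases o with
  | none => simp only [weight, Option.elim_none, one_pow]; nlinarith [sq_nonneg (D.F N T t ω ⬝ᵥ D.F N T t ω)]
  | some j =>
    have h1 : D.F N T t ω j ^ 2 ≤ D.F N T t ω ⬝ᵥ D.F N T t ω := by
      rw [sq]
      exact Finset.single_le_sum (f := fun j => D.F N T t ω j * D.F N T t ω j)
        (fun i _ => mul_self_nonneg _) (Finset.mem_univ j)
    simp only [weight, Option.elim_some]
    nlinarith [sq_nonneg (D.F N T t ω j)]

lemma rho_comm (t s : Fin T) (ω : D.Ω N T) : D.rho N T t s ω = D.rho N T s t ω := by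
  simp only [rho, mul_comm]

variable {D} {SigmaSF2 : Matrix (ObsIdx k₁ k₂) (ObsIdx k₁ k₂) ℝ}

section Orthogonality

lemma measurable_e_sigmaExcept {s t : Fin T} (hts : t ≠ s) (i : Fin N) :
    Measurable[sigmaExcept (D.factorSigma N T) (D.eVec N T) s] (D.e N T i t) :=
  (measurable_pi_apply i).comp (measurable_sigmaExcept (m := D.factorSigma N T) hts)

lemma measurable_weight_sigmaExcept (o : Option (ObsIdx k₁ k₂)) (s t : Fin T) :
    Measurable[sigmaExcept (D.factorSigma N T) (D.eVec N T) s] (D.weight N T o t) :=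
  (D.measurable_weight_factorSigma N T o t).mono (le_sigmaExcept s) le_rfl

lemma measurable_W_sigmaExcept {s t : Fin T} (hts : t ≠ s) (a : AllIdx k₁ k₂ kᵥ) :
    Measurable[sigmaExcept (D.factorSigma N T) (D.eVec N T) s] fun ω => D.W N T t ω a := by
  simp_rw [W_apply]
  exact (Finset.measurable_fun_sum _ fun i _ =>
    (measurable_e_sigmaExcept N T hts i).mul_const _).const_mul _

lemma measurable_rho_sigmaExcept {r s t : Fin T} (ht : t ≠ r) (hs : s ≠ r) :
    Measurable[sigmaExcept (D.factorSigma N T) (D.eVec N T) r] (D.rho N T t s) := by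
  unfold rho
  exact (Finset.measurable_fun_sum _ fun i _ => (measurable_e_sigmaExcept N T ht i).mul
    (measurable_e_sigmaExcept N T hs i)).const_mul _

variable (hm : D.IsPricingModel) (he : D.Errors SigmaSF2)
include hm he

lemma integral_linear_eVec_eq_zero {t : Fin T} {Y : Fin N → D.Ω N T → ℝ}
    (hY : ∀ i, Measurable[sigmaExcept (D.factorSigma N T) (D.eVec N T) t] (Y i))
    (hX : Integrable (fun ω => ∑ i, D.e N T i t ω * Y i ω) (D.P N T)) :
    ∫ ω, ∑ i, D.e N T i t ω * Y i ω ∂(D.P N T) = 0 :=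
  integral_sum_mul_eq_zero (D.factorSigma_le N T) (D.measurable_eVec N T)
    (he.condIndep N T) (fun i => hm.integrable_e N T i t) (fun i => he.condMean N T i t) hY hX

/-- `T^{-1/2} ∑ₜ w_t W_{t}` has bounded second moments. -/
lemma bddSecondMoment_W (o : Option (ObsIdx k₁ k₂)) (a : AllIdx k₁ k₂ kᵥ) :
    BddSecondMoment (fun p : ℕ × ℕ => D.P p.1 p.2) atTop
      (fun p ω => (√(p.2 : ℝ))⁻¹ * ∑ t, D.weight p.1 p.2 o t ω * D.W p.1 p.2 t ω a) := by
  obtain ⟨C, hC⟩ := he.W_bound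
  refine ⟨ENNReal.ofReal C, ENNReal.ofReal_ne_top, Eventually.of_forall ?_⟩
  rintro ⟨N, T⟩
  dsimp only
  have key := lintegral_ofReal_sq_sum_le (P := D.P N T) (Finset.univ : Finset (Fin T))
    (ξ := fun t ω => D.weight N T o t ω * D.W N T t ω a) (fun t _ => by fun_prop)
    (C := ENNReal.ofReal C) ENNReal.ofReal_ne_top (fun t _ => ?_) (fun t _ s _ hts hint => ?_)
  · have h1 : ∀ ω, ENNReal.ofReal (((√(T : ℝ))⁻¹ *
        ∑ t, D.weight N T o t ω * D.W N T t ω a) ^ 2) = ENNReal.ofReal ((T : ℝ)⁻¹) *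
        ENNReal.ofReal ((∑ t, D.weight N T o t ω * D.W N T t ω a) ^ 2) := fun ω => by
      rw [mul_pow, inv_pow, Real.sq_sqrt (Nat.cast_nonneg _), ENNReal.ofReal_mul (by positivity)]
    simp_rw [h1]
    rw [lintegral_const_mul _ (by fun_prop)]
    refine (mul_le_mul_right key _).trans ?_
    rw [Finset.card_univ, Fintype.card_fin, ← mul_assoc]
    -- T⁻¹ T ≤ 1 also holds for T = 0, with 0⁻¹ = 0, so no lower bound on T is needed.
    refine mul_le_of_le_one_left zero_le ?_
    rw [← ENNReal.ofReal_natCast, ← ENNReal.ofReal_mul (by positivity)]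
    exact ENNReal.ofReal_le_one.2 (inv_mul_le_one)
  · refine (lintegral_mono fun ω => ENNReal.ofReal_le_ofReal ?_).trans (hC N T t)
    rw [mul_pow]
    refine mul_le_mul (D.weight_sq_le N T o t ω) ?_ (sq_nonneg _) ?_
    · rw [sq]
      exact Finset.single_le_sum (f := fun j => D.W N T t ω j * D.W N T t ω j)
        (fun i _ => mul_self_nonneg _) (Finset.mem_univ a)
    · have := dotProduct_self_nonneg_real (D.F N T t ω); linarith
  -- For t ≠ s the cross term is linear in e_t, with coefficients built from the factors and e_s
  -- only.
  · have h2 : (fun ω => D.weight N T o t ω * D.W N T t ω a *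
        (D.weight N T o s ω * D.W N T s ω a)) = fun ω => ∑ i, D.e N T i t ω *
        ((√(N : ℝ))⁻¹ * D.gam N T i a * D.weight N T o t ω * D.weight N T o s ω *
          D.W N T s ω a) := by
      ext ω
      rw [W_apply D N T t, Finset.mul_sum, Finset.mul_sum, Finset.sum_mul]
      exact Finset.sum_congr rfl fun i _ => by ring
    rw [h2] at hint ⊢
    refine integral_linear_eVec_eq_zero N T hm he (fun i => ?_) hint
    exact (((measurable_weight_sigmaExcept N T o t t).const_mul _).mul
      (measurable_weight_sigmaExcept N T o t s)).mul
      (measurable_W_sigmaExcept N T hts.symm a)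

/-- Two different increasing pairs cannot have the same two elements, so some date r of the first
pair is absent from the second. The product is then linear in e_r, with coefficients that depend on
the factors and on errors at other dates. -/
lemma integral_rho_mul_rho_eq_zero (o o' : Option (ObsIdx k₁ k₂)) {t s t' s' : Fin T}
    (hts : t < s) (hts' : t' < s') (hne : (t, s) ≠ (t', s'))
    (hint : Integrable (fun ω => D.weight N T o t ω * D.weight N T o' s ω * D.rho N T t s ω *
      (D.weight N T o t' ω * D.weight N T o' s' ω * D.rho N T t' s' ω)) (D.P N T)) :
    ∫ ω, D.weight N T o t ω * D.weight N T o' s ω * D.rho N T t s ω *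
      (D.weight N T o t' ω * D.weight N T o' s' ω * D.rho N T t' s' ω) ∂(D.P N T) = 0 := by
  have main : ∀ r q : Fin T, q ≠ r → t' ≠ r → s' ≠ r →
      (∀ ω, D.rho N T t s ω = D.rho N T r q ω) →
      ∫ ω, D.weight N T o t ω * D.weight N T o' s ω * D.rho N T t s ω *
      (D.weight N T o t' ω * D.weight N T o' s' ω * D.rho N T t' s' ω) ∂(D.P N T) = 0 := by
    intro r q hq ht' hs' hr
    have h2 : (fun ω => D.weight N T o t ω * D.weight N T o' s ω * D.rho N T t s ω *
        (D.weight N T o t' ω * D.weight N T o' s' ω * D.rho N T t' s' ω)) =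
        fun ω => ∑ i, D.e N T i r ω * ((√(N : ℝ))⁻¹ * D.e N T i q ω * D.weight N T o t ω *
          D.weight N T o' s ω * D.weight N T o t' ω * D.weight N T o' s' ω *
          D.rho N T t' s' ω) := by
      ext ω
      rw [hr ω, rho.eq_def D N T r q, Finset.mul_sum, Finset.mul_sum, Finset.sum_mul]
      exact Finset.sum_congr rfl fun i _ => by ring
    rw [h2] at hint ⊢
    refine integral_linear_eVec_eq_zero N T hm he (fun i => ?_) hint
    exact ((((((measurable_e_sigmaExcept N T hq i).const_mul _).mul
      (measurable_weight_sigmaExcept N T o r t)).mul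
      (measurable_weight_sigmaExcept N T o' r s)).mul
      (measurable_weight_sigmaExcept N T o r t')).mul
      (measurable_weight_sigmaExcept N T o' r s')).mul
      (measurable_rho_sigmaExcept N T ht' hs')
  by_cases h1 : t' ≠ t ∧ s' ≠ t
  · exact main t s hts.ne' h1.1 h1.2 fun _ => rfl
  by_cases h2 : t' ≠ s ∧ s' ≠ s
  · exact main s t hts.ne h2.1 h2.2 fun ω => D.rho_comm N T t s ω
  exfalso
  apply hne
  rw [Prod.mk.injEq]
  constructor <;> omega

/-- `T⁻¹ ∑_{t < s} w_t w'_s ρ(t,s)` has bounded second moments. -/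
lemma bddSecondMoment_rho (o o' : Option (ObsIdx k₁ k₂)) :
    BddSecondMoment (fun p : ℕ × ℕ => D.P p.1 p.2) atTop
      (fun p ω => (p.2 : ℝ)⁻¹ * ∑ x : Fin p.2 × Fin p.2 with x.1 < x.2,
        D.weight p.1 p.2 o x.1 ω * D.weight p.1 p.2 o' x.2 ω * D.rho p.1 p.2 x.1 x.2 ω) := by
  obtain ⟨C, hC⟩ := he.rho_bound
  -- The two weights sit at different dates. Their squared product is bounded by the sum of their
  -- fourth powers, and the moment assumption is applied once for each date; hence twice the
  -- constant.
  refine ⟨ENNReal.ofReal C + ENNReal.ofReal C, by simp, Eventually.of_forall ?_⟩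
  rintro ⟨N, T⟩
  dsimp only
  have key := lintegral_ofReal_sq_sum_le (P := D.P N T)
    (Finset.univ.filter fun x : Fin T × Fin T => x.1 < x.2)
    (ξ := fun x ω => D.weight N T o x.1 ω * D.weight N T o' x.2 ω * D.rho N T x.1 x.2 ω)
    (fun t _ => by fun_prop)
    (C := ENNReal.ofReal C + ENNReal.ofReal C) (by simp) (fun x hx => ?_) (fun x hx y hy hxy hint => ?_)
  · have h1 : ∀ ω, ENNReal.ofReal (((T : ℝ)⁻¹ * ∑ x : Fin T × Fin T with x.1 < x.2,
        D.weight N T o x.1 ω * D.weight N T o' x.2 ω * D.rho N T x.1 x.2 ω) ^ 2) =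
        ENNReal.ofReal ((T : ℝ)⁻¹ ^ 2) * ENNReal.ofReal ((∑ x : Fin T × Fin T with x.1 < x.2,
        D.weight N T o x.1 ω * D.weight N T o' x.2 ω * D.rho N T x.1 x.2 ω) ^ 2) := fun ω => by
      rw [mul_pow, ENNReal.ofReal_mul (by positivity)]
    simp_rw [h1]
    rw [lintegral_const_mul _ (by fun_prop)]
    refine (mul_le_mul_right key _).trans ?_
    rw [← mul_assoc]
    refine mul_le_of_le_one_left zero_le ?_
    rw [← ENNReal.ofReal_natCast, ← ENNReal.ofReal_mul (by positivity)]
    refine ENNReal.ofReal_le_one.2 ?_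
    have hcard : ((Finset.univ.filter fun x : Fin T × Fin T => x.1 < x.2).card : ℝ) ≤
        (T : ℝ) ^ 2 := by
      have := Finset.card_filter_le (Finset.univ : Finset (Fin T × Fin T)) fun x => x.1 < x.2
      simp only [Finset.card_univ, Fintype.card_prod, Fintype.card_fin] at this
      rw [sq]; exact_mod_cast this
    rw [inv_pow]
    exact (mul_le_mul_of_nonneg_left hcard (by positivity)).trans inv_mul_le_one
  · have hne : x.1 < x.2 := (Finset.mem_filter.1 hx).2
    refine le_trans ?_ (add_le_add (hC N T x.1 x.2 hne.ne') (hC N T x.2 x.1 hne.ne))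
    rw [← lintegral_add_left (by
      have : Measurable fun ω => D.F N T x.1 ω ⬝ᵥ D.F N T x.1 ω := by
        unfold dotProduct; fun_prop
      fun_prop)]
    refine lintegral_mono fun ω => ?_
    rw [← ENNReal.ofReal_add (by positivity) (by positivity)]
    refine ENNReal.ofReal_le_ofReal ?_
    rw [D.rho_comm N T x.2 x.1 ω, ← add_mul, mul_pow, mul_pow]
    have h4 := D.weight_pow_four_le N T o x.1 ω
    have h5 := D.weight_pow_four_le N T o' x.2 ω
    have h6 : D.weight N T o x.1 ω ^ 2 * D.weight N T o' x.2 ω ^ 2 ≤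
        1 + (D.F N T x.1 ω ⬝ᵥ D.F N T x.1 ω) ^ 2 +
          (1 + (D.F N T x.2 ω ⬝ᵥ D.F N T x.2 ω) ^ 2) := by
      nlinarith [sq_nonneg (D.weight N T o x.1 ω ^ 2 - D.weight N T o' x.2 ω ^ 2)]
    exact mul_le_mul h6 (by linarith) (sq_nonneg _) (by positivity)
  · exact integral_rho_mul_rho_eq_zero N T hm he o o' (Finset.mem_filter.1 hx).2
      (Finset.mem_filter.1 hy).2 hxy hint

end Orthogonality

section MeanBounds

variable (he : D.Errors SigmaSF2)
include he

/-- Uniform fourth moments of F_t are contained in the bound on ρ, after ρ² + 1 ≥ 1. That bound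
requires a second date s ≠ t, whence T ≥ 2. The power mean inequality passes to the time average. -/
lemma exists_lintegral_Fbar_pow_four_le (j : ObsIdx k₁ k₂) : ∃ C : ℝ≥0∞, C ≠ ⊤ ∧
    ∀ᶠ p : ℕ × ℕ in atTop,
      ∫⁻ ω, ENNReal.ofReal (D.Fbar p.1 p.2 ω j ^ 4) ∂(D.P p.1 p.2) ≤ C := by
  obtain ⟨C, hC⟩ := he.rho_bound
  refine ⟨ENNReal.ofReal C, ENNReal.ofReal_ne_top, ?_⟩
  filter_upwards [eventually_ge_atTop (0, 2)] with p hp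
  obtain ⟨N, T⟩ := p
  have hT : 2 ≤ T := hp.2
  dsimp only
  have hF : ∀ t : Fin T, ∫⁻ ω, ENNReal.ofReal (D.F N T t ω j ^ 4) ∂(D.P N T) ≤
      ENNReal.ofReal C := by
    intro t
    obtain ⟨s, hs⟩ : ∃ s : Fin T, s ≠ t := by
      have : Nontrivial (Fin T) := Fin.nontrivial_iff_two_le.2 hT
      exact exists_ne t
    refine (lintegral_mono fun ω => ENNReal.ofReal_le_ofReal ?_).trans (hC N T t s hs)
    have h4 := D.weight_pow_four_le N T (some j) t ω
    simp only [weight, Option.elim_some] at h4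
    nlinarith [mul_nonneg (sq_nonneg (D.F N T t ω ⬝ᵥ D.F N T t ω)) (sq_nonneg (D.rho N T s t ω)),
      sq_nonneg (D.rho N T s t ω)]
  have h1 : ∀ ω, ENNReal.ofReal (D.Fbar N T ω j ^ 4) ≤
      ENNReal.ofReal ((T : ℝ)⁻¹) * ∑ t, ENNReal.ofReal (D.F N T t ω j ^ 4) := fun ω => by
    have := pow_four_inv_mul_sum_le fun t => D.F N T t ω j
    rw [Fintype.card_fin] at this
    rw [← ENNReal.ofReal_sum_of_nonneg fun _ _ => by positivity,
      ← ENNReal.ofReal_mul (by positivity), Fbar_apply]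
    exact ENNReal.ofReal_le_ofReal this
  refine (lintegral_mono h1).trans ?_
  rw [lintegral_const_mul _ (by fun_prop), lintegral_finsetSum _ fun t _ => by fun_prop]
  refine (mul_le_mul_right (Finset.sum_le_sum fun t _ => hF t) _).trans ?_
  rw [Finset.sum_const, Finset.card_univ, Fintype.card_fin, nsmul_eq_mul, ← mul_assoc]
  refine mul_le_of_le_one_left zero_le ?_
  rw [← ENNReal.ofReal_natCast, ← ENNReal.ofReal_mul (by positivity)]
  exact ENNReal.ofReal_le_one.2 inv_mul_le_one

lemma bddSecondMoment_Fbar_mul (j l : ObsIdx k₁ k₂) :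
    BddSecondMoment (fun p : ℕ × ℕ => D.P p.1 p.2) atTop
      (fun p ω => D.Fbar p.1 p.2 ω j * D.Fbar p.1 p.2 ω l) := by
  obtain ⟨C, hC, h1⟩ := exists_lintegral_Fbar_pow_four_le he j
  obtain ⟨C', hC', h2⟩ := exists_lintegral_Fbar_pow_four_le he l
  refine ⟨C + C', ENNReal.add_ne_top.2 ⟨hC, hC'⟩, ?_⟩
  filter_upwards [h1, h2] with p h1 h2
  refine le_trans ?_ (add_le_add h1 h2)
  rw [← lintegral_add_left (by fun_prop)]
  refine lintegral_mono fun ω => ?_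
  rw [← ENNReal.ofReal_add (by positivity) (by positivity)]
  refine ENNReal.ofReal_le_ofReal ?_
  nlinarith [sq_nonneg (D.Fbar p.1 p.2 ω j ^ 2 - D.Fbar p.1 p.2 ω l ^ 2),
    sq_nonneg (D.Fbar p.1 p.2 ω j ^ 2), sq_nonneg (D.Fbar p.1 p.2 ω l ^ 2)]

lemma bddSecondMoment_Fbar (j : ObsIdx k₁ k₂) :
    BddSecondMoment (fun p : ℕ × ℕ => D.P p.1 p.2) atTop
      (fun p ω => D.Fbar p.1 p.2 ω j) := by
  obtain ⟨C, hC, h1⟩ := exists_lintegral_Fbar_pow_four_le he j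
  refine ⟨1 + C, ENNReal.add_ne_top.2 ⟨ENNReal.one_ne_top, hC⟩, ?_⟩
  filter_upwards [h1] with p h1
  refine le_trans ?_ (add_le_add_right h1 _)
  rw [← one_mul (1 : ℝ≥0∞), ← measure_univ (μ := D.P p.1 p.2), ← lintegral_const,
    measure_univ, ← lintegral_add_left (by fun_prop)]
  refine lintegral_mono fun ω => ?_
  rw [← ENNReal.ofReal_one, ← ENNReal.ofReal_add (by positivity) (by positivity)]
  refine ENNReal.ofReal_le_ofReal ?_
  nlinarith [sq_nonneg (D.Fbar p.1 p.2 ω j ^ 2 - 1)]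

end MeanBounds

end FactorPanel

/-! ### Arithmetic of limits in probability; cross-sectional moments of the error averages. -/

lemma BddSecondMoment.one {ι : Type*} {Ω : ι → Type*} {mΩ : ∀ i, MeasurableSpace (Ω i)}
    {P : ∀ i, Measure (Ω i)} [∀ i, IsProbabilityMeasure (P i)] {l : Filter ι} :
    BddSecondMoment P l fun _ _ => 1 :=
  ⟨1, ENNReal.one_ne_top, by simp⟩

namespace TendsToProb

variable {ι : Type*} {Ω : ι → Type*} {mΩ : ∀ i, MeasurableSpace (Ω i)}
  {P : ∀ i, Measure (Ω i)} {l : Filter ι}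

lemma congr_eventually {E : Type*} [TopologicalSpace E] {X Y : ∀ i, Ω i → E} {c : E}
    (h : TendsToProb P l X c) (hXY : ∀ᶠ i in l, ∀ ω, X i ω = Y i ω) : TendsToProb P l Y c := by
  refine h.congr (tendsto_const_nhds.congr' ?_)
  filter_upwards [hXY] with i hi
  simp [hi]

lemma add {X Y : ∀ i, Ω i → ℝ} {c d : ℝ} (hX : TendsToProb P l X c) (hY : TendsToProb P l Y d) :
    TendsToProb P l (fun i ω => X i ω + Y i ω) (c + d) :=
  (hX.prodMk hY).comp (f := fun p : ℝ × ℝ => p.1 + p.2) (by fun_prop)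

lemma sub {X Y : ∀ i, Ω i → ℝ} {c d : ℝ} (hX : TendsToProb P l X c) (hY : TendsToProb P l Y d) :
    TendsToProb P l (fun i ω => X i ω - Y i ω) (c - d) :=
  (hX.prodMk hY).comp (f := fun p : ℝ × ℝ => p.1 - p.2) (by fun_prop)

lemma mul {X Y : ∀ i, Ω i → ℝ} {c d : ℝ} (hX : TendsToProb P l X c) (hY : TendsToProb P l Y d) :
    TendsToProb P l (fun i ω => X i ω * Y i ω) (c * d) :=
  (hX.prodMk hY).comp (f := fun p : ℝ × ℝ => p.1 * p.2) (by fun_prop)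

lemma const_mul {X : ∀ i, Ω i → ℝ} {c : ℝ} (a : ℝ) (hX : TendsToProb P l X c) :
    TendsToProb P l (fun i ω => a * X i ω) (a * c) :=
  hX.comp (f := fun x : ℝ => a * x) (by fun_prop)

lemma sum {κ : Type*} [Fintype κ] {X : κ → ∀ i, Ω i → ℝ} {c : κ → ℝ}
    (h : ∀ k, TendsToProb P l (X k) (c k)) :
    TendsToProb P l (fun i ω => ∑ k, X k i ω) (∑ k, c k) :=
  (TendsToProb.pi (X := fun i ω k => X k i ω) h).comp (f := fun x : κ → ℝ => ∑ k, x k)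
    (by fun_prop)

end TendsToProb

lemma tendsto_inv_sqrt_fst : Tendsto (fun p : ℕ × ℕ => (√(p.1 : ℝ))⁻¹) atTop (𝓝 0) :=
  (tendsto_inv_atTop_zero.comp (Real.tendsto_sqrt_atTop.comp tendsto_natCast_atTop_atTop)).comp
    (by rw [← prod_atTop_atTop_eq]; exact tendsto_fst)

lemma tendsto_inv_sqrt_snd : Tendsto (fun p : ℕ × ℕ => (√(p.2 : ℝ))⁻¹) atTop (𝓝 0) :=
  (tendsto_inv_atTop_zero.comp (Real.tendsto_sqrt_atTop.comp tendsto_natCast_atTop_atTop)).comp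
    (by rw [← prod_atTop_atTop_eq]; exact tendsto_snd)

lemma sum_filter_ne_eq_lt_add_lt {T : ℕ} (f : Fin T → Fin T → ℝ) :
    ∑ t, ∑ s, f t s = ∑ t, f t t + (∑ x : Fin T × Fin T with x.1 < x.2, f x.1 x.2 +
      ∑ x : Fin T × Fin T with x.1 < x.2, f x.2 x.1) := by
  have h1 : ∑ t, ∑ s, f t s = ∑ x : Fin T × Fin T, f x.1 x.2 := by
    rw [Fintype.sum_prod_type]
  have h2 : ∑ x : Fin T × Fin T with x.1 < x.2, f x.2 x.1 =
      ∑ x : Fin T × Fin T, if x.2 < x.1 then f x.1 x.2 else 0 := by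
    rw [Finset.sum_filter]
    exact Fintype.sum_equiv (Equiv.prodComm _ _) _ _ fun x => rfl
  have h3 : ∑ t, f t t = ∑ x : Fin T × Fin T, if x.1 = x.2 then f x.1 x.2 else 0 := by
    rw [Fintype.sum_prod_type]
    simp
  rw [h1, h2, h3, Finset.sum_filter, ← Finset.sum_add_distrib, ← Finset.sum_add_distrib]
  refine Finset.sum_congr rfl fun x _ => ?_
  rcases lt_trichotomy x.1 x.2 with h | h | h
  · simp [h, h.ne, h.not_gt]
  · simp [h]
  · simp [h, h.ne', h.not_gt]

lemma sqrt_mul_inv_sq (x : ℝ) (hx : 0 ≤ x) : √x * x⁻¹ * (√x * x⁻¹) = x⁻¹ := by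
  have h := Real.mul_self_sqrt hx
  rcases hx.eq_or_lt with rfl | hpos
  · simp
  · field_simp
    exact (Real.sq_sqrt hx)

lemma sqrt_mul_inv (x : ℝ) : √x * x⁻¹ = (√x)⁻¹ := by
  rw [← div_eq_mul_inv, Real.sqrt_div_self]

namespace FactorPanel

variable {k₁ k₂ kᵥ : ℕ} (D : FactorPanel.{u} k₁ k₂ kᵥ) (N T : ℕ)

/-- `T^{-1/2} ∑ₜ c_t e_{it}`. -/
noncomputable def errSum (c : Fin T → ℝ) (i : Fin N) (ω : D.Ω N T) : ℝ :=
  √(T : ℝ) * ((T : ℝ)⁻¹ * ∑ t, D.e N T i t ω * c t)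

/-- `T⁻¹ ∑_{t < s} c_t d_s ρ(t,s)`. -/
noncomputable def rhoSum (c d : Fin T → ℝ) (ω : D.Ω N T) : ℝ :=
  (T : ℝ)⁻¹ * ∑ x : Fin T × Fin T with x.1 < x.2, c x.1 * d x.2 * D.rho N T x.1 x.2 ω

/-- Expand over pairs of dates: t = s produces S_t, and t ≠ s produces ρ(t,s)/√N. The two orders of
an off-diagonal pair are kept in separate sums over t < s, since orthogonality holds within each of
these. -/
lemma mean_errSum_mul_errSum (c d : Fin T → ℝ) (ω : D.Ω N T) :
    (N : ℝ)⁻¹ * ∑ i, D.errSum N T c i ω * D.errSum N T d i ω =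
      (T : ℝ)⁻¹ * ∑ t, c t * d t * D.S N T t ω +
        (√(N : ℝ))⁻¹ * (D.rhoSum N T c d ω + D.rhoSum N T d c ω) := by
  have hN : (N : ℝ)⁻¹ = (√(N : ℝ))⁻¹ * (√(N : ℝ))⁻¹ := by
    rw [← mul_inv, Real.mul_self_sqrt (Nat.cast_nonneg _)]
  have h1 : ∀ i, D.errSum N T c i ω * D.errSum N T d i ω =
      (T : ℝ)⁻¹ * ∑ t, ∑ s, c t * d s * (D.e N T i t ω * D.e N T i s ω) := by
    intro i
    rw [errSum, errSum, ← mul_assoc (√(T : ℝ)) _ (∑ t, D.e N T i t ω * d t),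
      ← mul_assoc (√(T : ℝ)) _ (∑ t, D.e N T i t ω * c t), mul_mul_mul_comm, sqrt_mul_inv_sq _ (Nat.cast_nonneg _), Finset.sum_mul_sum]
    congr 1
    exact Finset.sum_congr rfl fun t _ => Finset.sum_congr rfl fun s _ => by ring
  have h2 : (N : ℝ)⁻¹ * ∑ i, D.errSum N T c i ω * D.errSum N T d i ω =
      (T : ℝ)⁻¹ * ∑ t, ∑ s, c t * d s * ((N : ℝ)⁻¹ * ∑ i, D.e N T i t ω * D.e N T i s ω) := by
    simp_rw [h1, ← Finset.mul_sum]
    rw [← mul_assoc, mul_comm ((N : ℝ)⁻¹), mul_assoc]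
    congr 1
    rw [Finset.sum_comm, Finset.mul_sum]
    refine Finset.sum_congr rfl fun t _ => ?_
    rw [Finset.sum_comm, Finset.mul_sum]
    refine Finset.sum_congr rfl fun s _ => ?_
    rw [← Finset.mul_sum]
    ring
  rw [h2, sum_filter_ne_eq_lt_add_lt, rhoSum, rhoSum, ← mul_add, mul_left_comm _ (T : ℝ)⁻¹,
    mul_add (√(N : ℝ))⁻¹, Finset.mul_sum _ _ (√(N : ℝ))⁻¹, Finset.mul_sum _ _ (√(N : ℝ))⁻¹,
    ← mul_add]
  refine congrArg₂ _ rfl (congrArg₂ _ ?_ (congrArg₂ _ ?_ ?_))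
  · refine Finset.sum_congr rfl fun t _ => ?_
    simp only [S, sq]
  · refine Finset.sum_congr rfl fun x _ => ?_
    rw [rho, hN]; ring
  · refine Finset.sum_congr rfl fun x _ => ?_
    rw [rho, hN]
    simp_rw [mul_comm (D.e N T _ x.2 ω)]
    ring

/-- Interchanging the sums over assets and dates exposes W_t and a spare factor N^{-1/2}. -/
lemma mean_gam_mul_errSum (c : Fin T → ℝ) (a : AllIdx k₁ k₂ kᵥ) (ω : D.Ω N T) :
    (N : ℝ)⁻¹ * ∑ i, D.gam N T i a * D.errSum N T c i ω =
      (√(N : ℝ))⁻¹ * ((√(T : ℝ))⁻¹ * ∑ t, c t * D.W N T t ω a) := by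
  have hN : (N : ℝ)⁻¹ = (√(N : ℝ))⁻¹ * (√(N : ℝ))⁻¹ := by
    rw [← mul_inv, Real.mul_self_sqrt (Nat.cast_nonneg _)]
  simp only [errSum, ← mul_assoc, sqrt_mul_inv, W_apply, Finset.mul_sum]
  rw [Finset.sum_comm]
  refine Finset.sum_congr rfl fun t _ => Finset.sum_congr rfl fun i _ => ?_
  rw [hN]; ring

/-- The family of underlying probability measures. -/
abbrev PP (p : ℕ × ℕ) : Measure (D.Ω p.1 p.2) := D.P p.1 p.2

variable {D} {SigmaSF2 : Matrix (ObsIdx k₁ k₂) (ObsIdx k₁ k₂) ℝ}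

/-- A demeaned factor, or the constant `1`. -/
noncomputable def weightTilde (o : Option (ObsIdx k₁ k₂)) (ω : D.Ω N T) (t : Fin T) : ℝ :=
  o.elim 1 (D.Ftilde N T t ω)

/-- The coefficient of the constant in the expansion of `weightTilde`. -/
noncomputable def weightMean (o : Option (ObsIdx k₁ k₂)) (ω : D.Ω N T) : ℝ :=
  o.elim 0 (D.Fbar N T ω)

/-- The moment bounds concern F_t, not F̃_t. Demeaning enters only through F̄, which does not depend
on t and comes out of every sum over dates; what is left are sums weighted by F_t or by 1. -/
lemma weightTilde_eq (o : Option (ObsIdx k₁ k₂)) (t : Fin T) (ω : D.Ω N T) :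
    weightTilde N T o ω t =
      D.weight N T o t ω - weightMean N T o ω * D.weight N T none t ω := by
  cases o <;> simp [weightTilde, weightMean, weight, Ftilde_apply]

lemma measurable_weightMean (o : Option (ObsIdx k₁ k₂)) :
    Measurable (weightMean (D := D) N T o) := by
  cases o with
  | none => exact measurable_const
  | some j => exact D.measurable_Fbar_apply N T j

section

variable (he : D.Errors SigmaSF2)
include he

lemma bddSecondMoment_weightMean_mul (o o' : Option (ObsIdx k₁ k₂)) :
    BddSecondMoment D.PP atTop
      (fun p ω => weightMean p.1 p.2 o ω * weightMean p.1 p.2 o' ω) := by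
  cases o with
  | none => exact ⟨0, ENNReal.zero_ne_top, by simp [weightMean]⟩
  | some j =>
    cases o' with
    | none => exact ⟨0, ENNReal.zero_ne_top, by simp [weightMean]⟩
    | some l => exact bddSecondMoment_Fbar_mul he j l

lemma bddSecondMoment_weightMean (o : Option (ObsIdx k₁ k₂)) :
    BddSecondMoment D.PP atTop (fun p ω => weightMean p.1 p.2 o ω) := by
  cases o with
  | none => exact ⟨0, ENNReal.zero_ne_top, by simp [weightMean]⟩
  | some j => exact bddSecondMoment_Fbar he j

variable (hm : D.IsPricingModel)
include hm

/-- Expanding both demeaned weights gives four terms. Each is N^{-1/2} times a monomial in F̄ times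
a pair sum with undemeaned weights, and both of these are bounded in L². -/
lemma tendsToProb_rhoSum (o o' : Option (ObsIdx k₁ k₂)) :
    TendsToProb D.PP atTop (fun p ω => (√(p.1 : ℝ))⁻¹ *
      D.rhoSum p.1 p.2 (weightTilde p.1 p.2 o ω) (weightTilde p.1 p.2 o' ω) ω) 0 := by
  have hmeas : ∀ (q q' : Option (ObsIdx k₁ k₂)) (p : ℕ × ℕ), Measurable fun ω : D.Ω p.1 p.2 =>
      (p.2 : ℝ)⁻¹ * ∑ x : Fin p.2 × Fin p.2 with x.1 < x.2,
        D.weight p.1 p.2 q x.1 ω * D.weight p.1 p.2 q' x.2 ω * D.rho p.1 p.2 x.1 x.2 ω :=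
    fun q q' p => by fun_prop
  have key : ∀ (A : ∀ p : ℕ × ℕ, D.Ω p.1 p.2 → ℝ) (q q' : Option (ObsIdx k₁ k₂)),
      BddSecondMoment D.PP atTop A → (∀ p, Measurable (A p)) →
      TendsToProb D.PP atTop (fun p ω => (√(p.1 : ℝ))⁻¹ * (A p ω *
        ((p.2 : ℝ)⁻¹ * ∑ x : Fin p.2 × Fin p.2 with x.1 < x.2,
          D.weight p.1 p.2 q x.1 ω * D.weight p.1 p.2 q' x.2 ω * D.rho p.1 p.2 x.1 x.2 ω))) 0 :=
    fun A q q' hA hAm => hA.tendsToProb_mul (bddSecondMoment_rho hm he q q') hAm (hmeas q q')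
      tendsto_inv_sqrt_fst
  have h1 := key (fun _ _ => 1) o o' BddSecondMoment.one fun _ => measurable_const
  have h2 := key _ o none (bddSecondMoment_weightMean he o') fun p =>
    measurable_weightMean p.1 p.2 o'
  have h3 := key _ none o' (bddSecondMoment_weightMean he o) fun p =>
    measurable_weightMean p.1 p.2 o
  have h4 := key _ none none (bddSecondMoment_weightMean_mul he o o') fun p =>
    (measurable_weightMean p.1 p.2 o).mul (measurable_weightMean p.1 p.2 o')
  have h5 := ((h1.sub h2).sub h3).add h4
  simp only [sub_zero, add_zero] at h5
  refine h5.congr_eventually (Eventually.of_forall fun p ω => ?_)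
  simp only [rhoSum, weightTilde_eq, ← mul_sub, ← mul_add]
  congr 1
  simp only [Finset.mul_sum, ← Finset.sum_sub_distrib, ← Finset.sum_add_distrib]
  exact Finset.sum_congr rfl fun x _ => by ring

lemma tendsToProb_gam_errSum (o : Option (ObsIdx k₁ k₂)) (a : AllIdx k₁ k₂ kᵥ) :
    TendsToProb D.PP atTop (fun p ω => (p.1 : ℝ)⁻¹ *
      ∑ i, D.gam p.1 p.2 i a * D.errSum p.1 p.2 (weightTilde p.1 p.2 o ω) i ω) 0 := by
  have hmeas : ∀ (q : Option (ObsIdx k₁ k₂)) (p : ℕ × ℕ), Measurable fun ω : D.Ω p.1 p.2 =>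
      (√(p.2 : ℝ))⁻¹ * ∑ t, D.weight p.1 p.2 q t ω * D.W p.1 p.2 t ω a :=
    fun q p => by fun_prop
  have h1 := (BddSecondMoment.one (P := D.PP)).tendsToProb_mul
    (bddSecondMoment_W hm he o a) (fun _ => measurable_const) (hmeas o) tendsto_inv_sqrt_fst
  have h2 := (bddSecondMoment_weightMean he o).tendsToProb_mul
    (bddSecondMoment_W hm he none a) (fun p => measurable_weightMean p.1 p.2 o)
    (hmeas none) tendsto_inv_sqrt_fst
  have h5 := h1.sub h2
  rw [sub_zero] at h5
  refine h5.congr_eventually (Eventually.of_forall fun p ω => ?_)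
  simp only [mean_gam_mul_errSum, weightTilde_eq, ← mul_sub]
  congr 1
  simp only [Finset.mul_sum, ← Finset.sum_sub_distrib]
  exact Finset.sum_congr rfl fun x _ => by ring

/-- Only the diagonal part survives, and its limit is an assumption. -/
lemma tendsToProb_errSum_some (j l : ObsIdx k₁ k₂) :
    TendsToProb D.PP atTop (fun p ω => (p.1 : ℝ)⁻¹ *
      ∑ i, D.errSum p.1 p.2 (weightTilde p.1 p.2 (some j) ω) i ω *
        D.errSum p.1 p.2 (weightTilde p.1 p.2 (some l) ω) i ω) (SigmaSF2 j l) := by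
  have h1 : TendsToProb D.PP atTop _ _ := TendsToProb.iff_real.2 (he.FFS j l)
  have h2 := (h1.add (tendsToProb_rhoSum he hm (some j) (some l))).add
    (tendsToProb_rhoSum he hm (some l) (some j))
  rw [add_zero, add_zero] at h2
  refine h2.congr_eventually (Eventually.of_forall fun p ω => ?_)
  rw [mean_errSum_mul_errSum, mul_add, ← add_assoc]
  rfl

/-- With one weight equal to 1, the diagonal part is N^{-1/2} times (√N/T) ∑ F̃_t S_t, which is
o_p(1) by assumption. N ≥ 1 is needed to cancel √N. -/
lemma tendsToProb_errSum_none (j : ObsIdx k₁ k₂) :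
    TendsToProb D.PP atTop (fun p ω => (p.1 : ℝ)⁻¹ *
      ∑ i, D.errSum p.1 p.2 (weightTilde p.1 p.2 (some j) ω) i ω *
        D.errSum p.1 p.2 (weightTilde p.1 p.2 none ω) i ω) 0 := by
  have h1 : TendsToProb D.PP atTop _ _ := TendsToProb.iff_real.2 (he.FS j)
  have h0 := (TendsToProb.of_tendsto (P := D.PP) tendsto_inv_sqrt_fst).mul h1
  have h2 := (h0.add (tendsToProb_rhoSum he hm (some j) none)).add
    (tendsToProb_rhoSum he hm none (some j))
  simp only [add_zero, mul_zero] at h2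
  refine h2.congr_eventually ?_
  filter_upwards [eventually_ge_atTop (1, 0)] with p hp ω
  have hN : (0 : ℝ) < p.1 := by exact_mod_cast hp.1
  rw [mean_errSum_mul_errSum, mul_add, ← add_assoc]
  congr 2
  simp only [weightTilde, Option.elim_some, Option.elim_none, mul_one]
  have : √(p.1 : ℝ) ≠ 0 := (Real.sqrt_pos.2 hN).ne'
  field_simp

end

end FactorPanel

/-! ### Measurability and continuity of the matrix inverse. -/

section MatrixInverse

variable {n : Type*} [Fintype n] [DecidableEq n]

lemma measurable_matrix_det {𝕜 Ω : Type*} [RCLike 𝕜] {mΩ : MeasurableSpace Ω}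
    {A : Ω → Matrix n n 𝕜}
    (hA : ∀ i j, Measurable fun ω => A ω i j) : Measurable fun ω => (A ω).det := by
  simp_rw [Matrix.det_apply']
  fun_prop

/-- The adjugate formula also describes the inverse of a singular matrix, which is zero by
convention, so invertibility plays no role for measurability. -/
lemma measurable_matrix_inv_apply {𝕜 Ω : Type*} [RCLike 𝕜] {mΩ : MeasurableSpace Ω}
    {A : Ω → Matrix n n 𝕜}
    (hA : ∀ i j, Measurable fun ω => A ω i j) (i j : n) : Measurable fun ω => (A ω)⁻¹ i j := by
  simp_rw [Matrix.inv_def, Ring.inverse_eq_inv', Matrix.smul_apply, Matrix.adjugate_apply]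
  refine (measurable_matrix_det hA).inv.smul (measurable_matrix_det fun k l => ?_)
  by_cases h : k = j
  · subst h; simp
  · simpa [Matrix.updateRow_ne h] using hA k l

lemma measurable_matrix_inv_mulVec_apply {𝕜 Ω : Type*} [RCLike 𝕜] {mΩ : MeasurableSpace Ω}
    {A : Ω → Matrix n n 𝕜} {y : Ω → n → 𝕜} (hA : ∀ i j, Measurable fun ω => A ω i j)
    (hy : ∀ j, Measurable fun ω => y ω j) (i : n) :
    Measurable fun ω => ((A ω)⁻¹ *ᵥ y ω) i := by
  simp only [Matrix.mulVec, dotProduct]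
  exact Finset.measurable_fun_sum _ fun j _ => (measurable_matrix_inv_apply hA i j).mul (hy j)

lemma ContinuousAt.nonsing_inv {X : Type*} [TopologicalSpace X] {A : X → Matrix n n ℝ} {x : X}
    (hA : ContinuousAt A x) (h : (A x).det ≠ 0) : ContinuousAt (fun y => (A y)⁻¹) x := by
  simp_rw [Matrix.inv_def, Ring.inverse_eq_inv']
  have h1 : ContinuousAt (fun y => (A y).det) x :=
    (Continuous.matrix_det continuous_id).continuousAt.comp hA
  have h2 : ContinuousAt (fun y => (A y).adjugate) x :=
    (Continuous.matrix_adjugate continuous_id).continuousAt.comp hA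
  exact (h1.inv₀ h).smul h2

end MatrixInverse

/-! ### The scaled estimator and biases as functions of finitely many statistics, and their values
at the limit. -/

section Representation

variable {k₁ k₂ kᵥ : ℕ}

/-- Index set of the normalized loadings and of the first-pass errors. -/
abbrev MomentIdx (k₁ k₂ kᵥ : ℕ) : Type := AllIdx k₁ k₂ kᵥ ⊕ ObsIdx k₁ k₂

/-- The quantities with a non-random limit on which the estimator depends: second moments of the
loadings and first-pass errors, their moments with the averaged errors, the ratio of the two
normalizations of the factors, the relative scales of the components, and `T^{-1/2}`. -/
abbrev ConstSpace (k₁ k₂ kᵥ : ℕ) : Type :=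
  (MomentIdx k₁ k₂ kᵥ → MomentIdx k₁ k₂ kᵥ → ℝ) × (MomentIdx k₁ k₂ kᵥ → ℝ) ×
    (ObsIdx k₁ k₂ → ObsIdx k₁ k₂ → ℝ) × (ObsIdx k₁ k₂ → ℝ) × ℝ

/-- Coefficients of the normalized first-pass estimates on loadings and errors. -/
noncomputable def repB (y : LimitSpace k₁ k₂ kᵥ × ConstSpace k₁ k₂ kᵥ) :
    Matrix (ObsIdx k₁ k₂) (MomentIdx k₁ k₂ kᵥ) ℝ :=
  Matrix.fromCols (Matrix.fromCols 1
    (Matrix.diagonal y.2.2.2.2.1 * Matrix.of y.2.2.2.1 * Matrix.of y.1.2.1))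
    (Matrix.diagonal y.2.2.2.2.1 * Matrix.of y.2.2.2.1)

/-- The normalized Gram matrix of the first-pass estimates. -/
noncomputable def repGram (y : LimitSpace k₁ k₂ kᵥ × ConstSpace k₁ k₂ kᵥ) :
    Matrix (ObsIdx k₁ k₂) (ObsIdx k₁ k₂) ℝ :=
  repB y * Matrix.of y.2.1 * (repB y)ᵀ

/-- The ex-post risk premia. -/
noncomputable def repLam (lam : ObsIdx k₁ k₂ → ℝ)
    (y : LimitSpace k₁ k₂ kᵥ × ConstSpace k₁ k₂ kᵥ) : ObsIdx k₁ k₂ → ℝ :=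
  lam + y.2.2.2.2.2 • y.1.1

/-- The normalized omitted variable bias. -/
noncomputable def repOV (lam : ObsIdx k₁ k₂ → ℝ)
    (y : LimitSpace k₁ k₂ kᵥ × ConstSpace k₁ k₂ kᵥ) : ObsIdx k₁ k₂ → ℝ :=
  (repGram y)⁻¹ *ᵥ (repB y *ᵥ (Matrix.of y.2.1 *ᵥ
    Sum.elim (Sum.elim 0 (y.1.2.2 - (Matrix.of y.1.2.1)ᵀ *ᵥ repLam lam y)) 0))

/-- The normalized attenuation bias. -/
noncomputable def repA (lam : ObsIdx k₁ k₂ → ℝ)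
    (y : LimitSpace k₁ k₂ kᵥ × ConstSpace k₁ k₂ kᵥ) : ObsIdx k₁ k₂ → ℝ :=
  -((repGram y)⁻¹ *ᵥ (Matrix.fromCols (0 : Matrix (ObsIdx k₁ k₂) (AllIdx k₁ k₂ kᵥ) ℝ)
    (Matrix.diagonal y.2.2.2.2.1) *ᵥ (Matrix.of y.2.1 *ᵥ Sum.elim 0 (repLam lam y))))

/-- The normalized difference of the two-pass estimator and the ex-post risk premia. -/
noncomputable def repTotal (lam : ObsIdx k₁ k₂ → ℝ)
    (y : LimitSpace k₁ k₂ kᵥ × ConstSpace k₁ k₂ kᵥ) : ObsIdx k₁ k₂ → ℝ :=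
  (repGram y)⁻¹ *ᵥ (repB y *ᵥ (Matrix.of y.2.1 *ᵥ
    Sum.elim (Sum.elim 0
      (y.1.2.2 - (Matrix.of y.1.2.1)ᵀ *ᵥ ((Matrix.of y.2.2.2.1)ᵀ *ᵥ repLam lam y)))
      (-((Matrix.of y.2.2.2.1)ᵀ *ᵥ repLam lam y)) + y.2.2.1))

/-- The limit of the quantities collected in `ConstSpace`. -/
def limConst (Γ : Matrix (AllIdx k₁ k₂ kᵥ) (AllIdx k₁ k₂ kᵥ) ℝ)
    (SigmaU : Matrix (ObsIdx k₁ k₂) (ObsIdx k₁ k₂) ℝ) : ConstSpace k₁ k₂ kᵥ :=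
  (Matrix.fromBlocks Γ 0 0 SigmaU, 0, (1 : Matrix (ObsIdx k₁ k₂) (ObsIdx k₁ k₂) ℝ),
    Sum.elim (fun _ => 0) (fun _ => 1), 0)

variable (Γ : Matrix (AllIdx k₁ k₂ kᵥ) (AllIdx k₁ k₂ kᵥ) ℝ)
  (SigmaU : Matrix (ObsIdx k₁ k₂) (ObsIdx k₁ k₂) ℝ) (lam : ObsIdx k₁ k₂ → ℝ)
  (x : LimitSpace k₁ k₂ kᵥ)

lemma repB_limConst : repB (x, limConst Γ SigmaU) =
    Matrix.fromCols (Matrix.fromCols 1 (etaTilde x.2.1)) (weakProj k₁ k₂) := by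
  have h1 : Matrix.of (1 : Matrix (ObsIdx k₁ k₂) (ObsIdx k₁ k₂) ℝ) = 1 := rfl
  simp only [repB, limConst, h1, mul_one, etaTilde, weakProj]

lemma weakProj_transpose : (weakProj k₁ k₂)ᵀ = weakProj k₁ k₂ := by
  simp [weakProj]

lemma repGram_limConst : repGram (x, limConst Γ SigmaU) = limGram Γ SigmaU x.2.1 := by
  rw [repGram, repB_limConst]
  have h1 : Matrix.of (limConst Γ SigmaU).1 = Matrix.fromBlocks Γ 0 0 SigmaU := rfl
  simp only [h1, Matrix.fromCols_mul_fromBlocks, Matrix.mul_zero, zero_add, add_zero,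
    Matrix.transpose_fromCols (A₁ := Matrix.fromCols 1 (etaTilde x.2.1)),
    Matrix.fromCols_mul_fromRows, weakProj_transpose, limGram]

lemma repLam_limConst : repLam lam (x, limConst Γ SigmaU) = lam := by
  simp [repLam, limConst]

lemma mulVec_elim_limConst (d : Fin kᵥ → ℝ) (w : ObsIdx k₁ k₂ → ℝ) :
    Matrix.of (limConst Γ SigmaU).1 *ᵥ Sum.elim (Sum.elim 0 d) w =
      Sum.elim (Γ *ᵥ Sum.elim 0 d) (SigmaU *ᵥ w) := by
  have h1 : Matrix.of (limConst Γ SigmaU).1 = Matrix.fromBlocks Γ 0 0 SigmaU := rfl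
  rw [h1, Matrix.fromBlocks_mulVec]
  simp

lemma fromCols_mulVec_loadings (d : Fin kᵥ → ℝ) :
    Matrix.fromCols 1 (etaTilde x.2.1) *ᵥ (Γ *ᵥ Sum.elim 0 d) =
      (Γ.toBlocks₁₂ + etaTilde x.2.1 * Γ.toBlocks₂₂) *ᵥ d := by
  conv_lhs => rw [← Matrix.fromBlocks_toBlocks Γ]
  rw [Matrix.fromBlocks_mulVec, Matrix.fromCols_mulVec_sumElim]
  simp [Matrix.add_mulVec]

lemma repOV_limConst : repOV lam (x, limConst Γ SigmaU) = limOV Γ SigmaU lam x := by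
  rw [repOV, repGram_limConst, repLam_limConst, repB_limConst, mulVec_elim_limConst,
    Matrix.fromCols_mulVec_sumElim, fromCols_mulVec_loadings, limOV]
  simp

lemma repA_limConst : repA lam (x, limConst Γ SigmaU) = limA Γ SigmaU lam x := by
  have h0 : (Sum.elim (0 : AllIdx k₁ k₂ kᵥ → ℝ) lam : MomentIdx k₁ k₂ kᵥ → ℝ) =
      Sum.elim (Sum.elim (0 : ObsIdx k₁ k₂ → ℝ) (0 : Fin kᵥ → ℝ)) lam := by
    ext i; rcases i with (i | i) | i <;> rfl
  rw [repA, repGram_limConst, repLam_limConst, h0, mulVec_elim_limConst,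
    Matrix.fromCols_mulVec_sumElim, limA]
  simp [limConst, weakProj, Matrix.mulVec_mulVec]

/-- In the limit G is the identity and the moments with the averaged errors vanish. The
block-diagonal moment matrix then sends the missing-factor part of the score to X^OV and the error
part to X^A. -/
lemma repTotal_limConst : repTotal lam (x, limConst Γ SigmaU) =
    limA Γ SigmaU lam x + limOV Γ SigmaU lam x := by
  have h1 : Matrix.of (limConst Γ SigmaU (kᵥ := kᵥ)).2.2.1 = 1 := rfl
  have h2 : (limConst Γ SigmaU (kᵥ := kᵥ)).2.1 = 0 := rfl
  rw [repTotal, repGram_limConst, repLam_limConst, repB_limConst]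
  simp only [h1, h2, Matrix.transpose_one, Matrix.one_mulVec, add_zero]
  rw [mulVec_elim_limConst, Matrix.fromCols_mulVec_sumElim, fromCols_mulVec_loadings, limOV, limA,
    Matrix.mulVec_add, add_comm]
  simp [Matrix.mulVec_neg, Matrix.mulVec_mulVec]

lemma continuous_repB : Continuous (repB (k₁ := k₁) (k₂ := k₂) (kᵥ := kᵥ)) := by
  refine continuous_matrix fun i j => ?_
  rcases j with (j | j) | j
  · exact continuous_const
  · simp only [repB, Matrix.fromCols_apply_inl, Matrix.fromCols_apply_inr, Matrix.mul_apply,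
      Matrix.of_apply]
    fun_prop
  · simp only [repB, Matrix.fromCols_apply_inr, Matrix.diagonal_mul, Matrix.of_apply]
    fun_prop

lemma continuous_moments : Continuous fun y : LimitSpace k₁ k₂ kᵥ × ConstSpace k₁ k₂ kᵥ =>
    Matrix.of y.2.1 :=
  continuous_matrix fun i j => by simp only [Matrix.of_apply]; fun_prop

lemma continuous_repGram : Continuous (repGram (k₁ := k₁) (k₂ := k₂) (kᵥ := kᵥ)) :=
  (continuous_repB.matrix_mul continuous_moments).matrix_mul continuous_repB.matrix_transpose

lemma continuous_repLam : Continuous (repLam (kᵥ := kᵥ) lam) := by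
  unfold repLam; fun_prop

lemma continuous_sumElim_pi {X m n : Type*} [TopologicalSpace X] {f : X → m → ℝ} {g : X → n → ℝ}
    (hf : Continuous f) (hg : Continuous g) : Continuous fun y => Sum.elim (f y) (g y) :=
  continuous_pi fun i => by
    rcases i with i | i
    · exact (continuous_apply i).comp hf
    · exact (continuous_apply i).comp hg

section

variable {Γ SigmaU} (h : (limGram Γ SigmaU x.2.1).det ≠ 0)
include h

/-- Slutsky's theorem needs continuity only at points with limiting second component, where the Gram
matrix is `limGram`. -/
lemma continuousAt_repGram_inv :
    ContinuousAt (fun y => (repGram y)⁻¹) (x, limConst Γ SigmaU) :=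
  ContinuousAt.nonsing_inv (A := repGram) continuous_repGram.continuousAt
    (by rw [repGram_limConst]; exact h)

lemma continuousAt_repOV : ContinuousAt (repOV lam) (x, limConst Γ SigmaU) := by
  have h1 : Continuous fun y : LimitSpace k₁ k₂ kᵥ × ConstSpace k₁ k₂ kᵥ =>
      (Matrix.of y.1.2.1)ᵀ :=
    continuous_matrix fun i j => by simp only [Matrix.transpose_apply, Matrix.of_apply]; fun_prop
  have h2 : Continuous fun y : LimitSpace k₁ k₂ kᵥ × ConstSpace k₁ k₂ kᵥ =>
      repB y *ᵥ (Matrix.of y.2.1 *ᵥ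
        Sum.elim (Sum.elim 0 (y.1.2.2 - (Matrix.of y.1.2.1)ᵀ *ᵥ repLam lam y)) 0) := by
    refine continuous_repB.matrix_mulVec (continuous_moments.matrix_mulVec
      (continuous_sumElim_pi (continuous_sumElim_pi continuous_const ?_) continuous_const))
    exact Continuous.sub (by fun_prop) (h1.matrix_mulVec (continuous_repLam lam))
  exact (Continuous.matrix_mulVec continuous_fst continuous_snd).continuousAt.comp
    ((continuousAt_repGram_inv x h).prodMk h2.continuousAt)

lemma continuousAt_repA : ContinuousAt (repA lam) (x, limConst Γ SigmaU) := by
  have h1 : Continuous fun y : LimitSpace k₁ k₂ kᵥ × ConstSpace k₁ k₂ kᵥ =>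
      Matrix.fromCols (0 : Matrix (ObsIdx k₁ k₂) (AllIdx k₁ k₂ kᵥ) ℝ)
        (Matrix.diagonal y.2.2.2.2.1) := by
    refine continuous_matrix fun i j => ?_
    rcases j with j | j
    · exact continuous_const
    · simp only [Matrix.fromCols_apply_inr, Matrix.diagonal_apply]
      split_ifs <;> fun_prop
  have h2 := h1.matrix_mulVec (continuous_moments.matrix_mulVec
      (continuous_sumElim_pi (f := fun _ => (0 : AllIdx k₁ k₂ kᵥ → ℝ)) continuous_const
        (continuous_repLam lam)))
  exact ((Continuous.matrix_mulVec continuous_fst continuous_snd).continuousAt.comp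
    ((continuousAt_repGram_inv x h).prodMk h2.continuousAt)).neg

lemma continuousAt_repTotal : ContinuousAt (repTotal lam) (x, limConst Γ SigmaU) := by
  have h1 : Continuous fun y : LimitSpace k₁ k₂ kᵥ × ConstSpace k₁ k₂ kᵥ =>
      (Matrix.of y.1.2.1)ᵀ :=
    continuous_matrix fun i j => by simp only [Matrix.transpose_apply, Matrix.of_apply]; fun_prop
  have h3 : Continuous fun y : LimitSpace k₁ k₂ kᵥ × ConstSpace k₁ k₂ kᵥ =>
      (Matrix.of y.2.2.2.1)ᵀ :=
    continuous_matrix fun i j => by simp only [Matrix.transpose_apply, Matrix.of_apply]; fun_prop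
  have h4 := h3.matrix_mulVec (continuous_repLam lam)
  have h2 : Continuous fun y : LimitSpace k₁ k₂ kᵥ × ConstSpace k₁ k₂ kᵥ =>
      repB y *ᵥ (Matrix.of y.2.1 *ᵥ Sum.elim (Sum.elim 0
        (y.1.2.2 - (Matrix.of y.1.2.1)ᵀ *ᵥ ((Matrix.of y.2.2.2.1)ᵀ *ᵥ repLam lam y)))
        (-((Matrix.of y.2.2.2.1)ᵀ *ᵥ repLam lam y)) + y.2.2.1) := by
    refine continuous_repB.matrix_mulVec ((continuous_moments.matrix_mulVec
      (continuous_sumElim_pi (continuous_sumElim_pi continuous_const ?_) h4.neg)).add (by fun_prop))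
    exact Continuous.sub (by fun_prop) (h1.matrix_mulVec h4)
  exact (Continuous.matrix_mulVec continuous_fst continuous_snd).continuousAt.comp
    ((continuousAt_repGram_inv x h).prodMk h2.continuousAt)

end

end Representation

/-! ### Exact finite-sample identities for the two passes. -/

namespace FactorPanel

variable {k₁ k₂ kᵥ : ℕ} (D : FactorPanel.{u} k₁ k₂ kᵥ) (N T : ℕ)

/-- The sample second moment matrix of the demeaned factors. -/
noncomputable def gramF (ω : D.Ω N T) : Matrix (ObsIdx k₁ k₂) (ObsIdx k₁ k₂) ℝ :=
  Matrix.of fun j l => (T : ℝ)⁻¹ * ∑ t, D.Ftilde N T t ω j * D.Ftilde N T t ω l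

/-- The normalized loadings and first-pass errors of asset `i`. -/
noncomputable def momVec (i : Fin N) (ω : D.Ω N T) : MomentIdx k₁ k₂ kᵥ → ℝ :=
  Sum.elim (D.gam N T i) (√(T : ℝ) • D.uErr N T i ω)

/-- The normalized average error of asset `i`. -/
noncomputable def errBar (i : Fin N) (ω : D.Ω N T) : ℝ :=
  √(T : ℝ) * ((T : ℝ)⁻¹ * ∑ t, D.e N T i t ω)

/-- The components of the estimator that have a non-random limit. -/
noncomputable def constT (ω : D.Ω N T) : ConstSpace k₁ k₂ kᵥ :=
  (fun a b => (N : ℝ)⁻¹ * ∑ i, D.momVec N T i ω a * D.momVec N T i ω b,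
    fun a => (N : ℝ)⁻¹ * ∑ i, D.momVec N T i ω a * D.errBar N T i ω,
    fun j l => ((D.gramF N T ω)⁻¹ * D.SigmaF) j l,
    Sum.elim (fun _ => (√(T : ℝ))⁻¹) (fun _ => 1), (√(T : ℝ))⁻¹)

/-- The components of the estimator that have a random limit. -/
noncomputable def stateT (ω : D.Ω N T) : LimitSpace k₁ k₂ kᵥ :=
  (D.zetaT N T ω, D.etaT N T ω, D.etaVT N T ω)

/-- All the quantities on which the estimator depends. -/
noncomputable def rep (ω : D.Ω N T) : LimitSpace k₁ k₂ kᵥ × ConstSpace k₁ k₂ kᵥ :=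
  (D.stateT N T ω, D.constT N T ω)

/-- Multiplies the weak components by `√T`. -/
noncomputable def scaleLoad (k₁ k₂ T : ℕ) : ObsIdx k₁ k₂ → ℝ :=
  Sum.elim (fun _ => 1) (fun _ => √(T : ℝ))

lemma sum_vecMulVec_Ftilde (hT : 0 < T) (ω : D.Ω N T) :
    ∑ t, vecMulVec (D.Ftilde N T t ω) (D.Ftilde N T t ω) = (T : ℝ) • D.gramF N T ω := by
  have hT' : (T : ℝ) ≠ 0 := by exact_mod_cast hT.ne'
  ext j l
  simp [gramF, Matrix.sum_apply, vecMulVec_apply, hT']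

lemma sum_Ftilde (hT : 0 < T) (ω : D.Ω N T) (j : ObsIdx k₁ k₂) :
    ∑ t, D.Ftilde N T t ω j = 0 := by
  have hT' : (T : ℝ) ≠ 0 := by exact_mod_cast hT.ne'
  simp only [Ftilde_apply, Fbar_apply, Finset.sum_sub_distrib, Finset.sum_const, Finset.card_univ,
    Fintype.card_fin, nsmul_eq_mul]
  field_simp
  ring

lemma lamTilde_eq_repLam (ω : D.Ω N T) : D.lamTilde N T ω = repLam D.lam (D.rep N T ω) := by
  have h : (√(T : ℝ))⁻¹ * (√(T : ℝ))⁻¹ = (T : ℝ)⁻¹ := by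
    rw [← mul_inv, Real.mul_self_sqrt (Nat.cast_nonneg _)]
  simp only [lamTilde, repLam, rep, stateT, constT, zetaT, smul_smul, h]

section Identities

variable {D N T} (hT : 0 < T) (hmean : ∀ t s, D.meanF N T t = D.meanF N T s)
  (hSig : IsUnit D.SigmaF.det) {ω : D.Ω N T} (hA : IsUnit (D.gramF N T ω).det)

include hT hmean in
-- As E F_t does not depend on t, F_t - E F_t differs from F̃_t by a term constant in t. This term
-- and λ'βᵢ drop out because the demeaned factors sum to zero.
lemma sum_r_smul_Ftilde (i : Fin N) (j : ObsIdx k₁ k₂) :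
    ∑ t, D.r N T i t ω * D.Ftilde N T t ω j =
      (T : ℝ) * (D.gramF N T ω *ᵥ D.β N T i) j +
        ∑ l, (∑ t, D.Ftilde N T t ω j * D.v N T t ω l) * D.μ N T i l +
        ∑ t, D.e N T i t ω * D.Ftilde N T t ω j := by
  have hT' : (T : ℝ) ≠ 0 := by exact_mod_cast hT.ne'
  set c : ℝ := D.lam ⬝ᵥ D.β N T i + (D.Fbar N T ω - D.meanF N T ⟨0, hT⟩) ⬝ᵥ D.β N T i with hc
  have h1 : ∀ t, D.r N T i t ω * D.Ftilde N T t ω j =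
      c * D.Ftilde N T t ω j + (D.Ftilde N T t ω ⬝ᵥ D.β N T i) * D.Ftilde N T t ω j +
        (D.v N T t ω ⬝ᵥ D.μ N T i) * D.Ftilde N T t ω j +
        D.e N T i t ω * D.Ftilde N T t ω j := by
    intro t
    rw [r, hmean t ⟨0, hT⟩, hc]
    have : D.F N T t ω - D.meanF N T ⟨0, hT⟩ =
        D.Ftilde N T t ω + (D.Fbar N T ω - D.meanF N T ⟨0, hT⟩) := by
      rw [Ftilde]; abel
    rw [this, add_dotProduct]
    ring
  simp_rw [h1, Finset.sum_add_distrib]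
  rw [← Finset.mul_sum, D.sum_Ftilde N T hT, mul_zero, zero_add]
  congr 2
  · simp only [gramF, mulVec, dotProduct, Matrix.of_apply, Finset.mul_sum, Finset.sum_mul]
    rw [Finset.sum_comm]
    refine Finset.sum_congr rfl fun l _ => Finset.sum_congr rfl fun t _ => ?_
    field_simp
  · simp only [dotProduct, Finset.sum_mul]
    rw [Finset.sum_comm]
    exact Finset.sum_congr rfl fun l _ => Finset.sum_congr rfl fun t _ => by ring

include hSig in
lemma sum_Ftilde_mul_v (j : ObsIdx k₁ k₂) (l : Fin kᵥ) :
    ∑ t, D.Ftilde N T t ω j * D.v N T t ω l =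
      √(T : ℝ) * (D.SigmaF * Matrix.of (D.etaT N T ω)) j l := by
  rcases Nat.eq_zero_or_pos T with rfl | hT
  · simp
  have hT' : √(T : ℝ) ≠ 0 := (Real.sqrt_pos.2 (by exact_mod_cast hT)).ne'
  have h1 : Matrix.of (D.etaT N T ω) = (√(T : ℝ))⁻¹ • (D.SigmaF⁻¹ *
      Matrix.of fun j l => ∑ t, D.Ftilde N T t ω j * D.v N T t ω l) := by
    ext j l
    simp only [etaT, Matrix.of_apply, Matrix.smul_apply, Matrix.mul_apply, smul_eq_mul, mulVec,
      dotProduct, Finset.mul_sum, Finset.sum_mul]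
    rw [Finset.sum_comm]
    exact Finset.sum_congr rfl fun k _ => Finset.sum_congr rfl fun t _ => by ring
  rw [h1, Matrix.mul_smul, ← Matrix.mul_assoc, Matrix.mul_nonsing_inv _ hSig, Matrix.one_mul]
  simp [hT']

include hSig in
lemma sum_e_mul_Ftilde (i : Fin N) (j : ObsIdx k₁ k₂) :
    ∑ t, D.e N T i t ω * D.Ftilde N T t ω j = (T : ℝ) * (D.SigmaF *ᵥ D.uErr N T i ω) j := by
  rcases Nat.eq_zero_or_pos T with rfl | hT
  · simp
  have hT' : (T : ℝ) ≠ 0 := by exact_mod_cast hT.ne'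
  have h1 : D.uErr N T i ω = (T : ℝ)⁻¹ • (D.SigmaF⁻¹ *ᵥ
      ∑ t, D.e N T i t ω • D.Ftilde N T t ω) := by
    rw [uErr, Matrix.mulVec_sum]
    simp_rw [Matrix.mulVec_smul]
  rw [h1, Matrix.mulVec_smul, Matrix.mulVec_mulVec, Matrix.mul_nonsing_inv _ hSig,
    Matrix.one_mulVec]
  simp [hT', Finset.sum_apply]

include hT hmean hSig hA in
-- Loading plus noise from the missing factors plus noise from the errors. The noise carries the
-- factor G because η_T and uᵢ are normalized by the population Σ_F, whereas the regression uses the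
-- sample second moments.
lemma betaHat_eq (i : Fin N) : D.betaHat N T i ω = D.β N T i +
    ((D.gramF N T ω)⁻¹ * D.SigmaF) *ᵥ
      ((√(T : ℝ))⁻¹ • (Matrix.of (D.etaT N T ω) *ᵥ D.μ N T i) + D.uErr N T i ω) := by
  have hT' : (T : ℝ) ≠ 0 := by exact_mod_cast hT.ne'
  have hs : √(T : ℝ) * (T : ℝ)⁻¹ = (√(T : ℝ))⁻¹ := sqrt_mul_inv _
  have h1 : ∑ t, D.r N T i t ω • D.Ftilde N T t ω = (T : ℝ) • (D.gramF N T ω *ᵥ D.β N T i +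
      D.SigmaF *ᵥ ((√(T : ℝ))⁻¹ • (Matrix.of (D.etaT N T ω) *ᵥ D.μ N T i) +
        D.uErr N T i ω)) := by
    ext j
    simp only [Finset.sum_apply, Pi.smul_apply, smul_eq_mul, Pi.add_apply, mulVec_add, mulVec_smul]
    rw [sum_r_smul_Ftilde hT hmean, sum_e_mul_Ftilde hSig]
    simp_rw [sum_Ftilde_mul_v hSig, mul_assoc]
    rw [← Finset.mul_sum, mul_add, mul_add, add_assoc]
    congr 2
    rw [← hs, Matrix.mulVec_mulVec]
    have h2 : ∀ x : ℝ, (T : ℝ) * (√(T : ℝ) * (T : ℝ)⁻¹ * x) = √(T : ℝ) * x := by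
      intro x; field_simp
    rw [h2]
    rfl
  have hinv : ((T : ℝ) • D.gramF N T ω)⁻¹ = (T : ℝ)⁻¹ • (D.gramF N T ω)⁻¹ := by
    have := Matrix.inv_smul' (A := D.gramF N T ω) (Units.mk0 _ hT') hA
    simpa [Units.smul_def] using this
  rw [betaHat, D.sum_vecMulVec_Ftilde N T hT, h1, hinv, Matrix.smul_mulVec, Matrix.mulVec_smul,
    smul_smul, inv_mul_cancel₀ hT', one_smul, Matrix.mulVec_add, Matrix.mulVec_mulVec,
    Matrix.nonsing_inv_mul _ hA, Matrix.one_mulVec, Matrix.mulVec_mulVec]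

include hT hmean hSig hA in
-- The scaling brings weak loadings and first-pass noise to the same order: weak noise stays of
-- order one, while strong noise is damped by T^{-1/2}. The coefficient matrix is the same for all
-- assets, so cross-sectional sums reduce to moments of the `momVec`.
lemma scaleLoad_mul_betaHat (i : Fin N) :
    scaleLoad k₁ k₂ T * D.betaHat N T i ω = repB (D.rep N T ω) *ᵥ D.momVec N T i ω := by
  have hs : √(T : ℝ) ≠ 0 := (Real.sqrt_pos.2 (by exact_mod_cast hT)).ne'
  have hβ : D.gam N T i = Sum.elim (scaleLoad k₁ k₂ T * D.β N T i) (D.μ N T i) := by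
    ext a; rcases a with (a | a) | a <;> simp [gam, scaleLoad]
  have hG : Matrix.of (fun j l => ((D.gramF N T ω)⁻¹ * D.SigmaF) j l) =
    (D.gramF N T ω)⁻¹ * D.SigmaF := rfl
  have hP : scaleLoad k₁ k₂ T = √(T : ℝ) •
      (Sum.elim (fun _ => (√(T : ℝ))⁻¹) (fun _ => 1) : ObsIdx k₁ k₂ → ℝ) := by
    ext a; rcases a with a | a <;> simp [scaleLoad, hs]
  rw [betaHat_eq hT hmean hSig hA, momVec, hβ]
  simp only [repB, rep, stateT, constT, hG, Matrix.fromCols_mulVec_sumElim, Matrix.one_mulVec,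
    mul_add, add_assoc, ← Matrix.mulVec_mulVec, Matrix.mulVec_add, Matrix.mulVec_smul]
  congr 1
  ext a
  simp only [Pi.add_apply, Pi.mul_apply, Pi.smul_apply, smul_eq_mul, Matrix.mulVec_diagonal, hP]
  field_simp

lemma mulVec_moments (τ : MomentIdx k₁ k₂ kᵥ → ℝ) :
    Matrix.of (D.rep N T ω).2.1 *ᵥ τ =
      (N : ℝ)⁻¹ • ∑ i, (D.momVec N T i ω ⬝ᵥ τ) • D.momVec N T i ω := by
  ext a
  simp only [rep, constT, mulVec, dotProduct, Matrix.of_apply, Pi.smul_apply, Finset.sum_apply,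
    smul_eq_mul, Finset.mul_sum, Finset.sum_mul]
  rw [Finset.sum_comm]
  exact Finset.sum_congr rfl fun i _ => Finset.sum_congr rfl fun b _ => by ring

include hT hmean hSig hA in
lemma repGram_eq : Matrix.diagonal (scaleLoad k₁ k₂ T) * D.betaGram N T ω *
    Matrix.diagonal (scaleLoad k₁ k₂ T) = ∑ i, vecMulVec (repB (D.rep N T ω) *ᵥ D.momVec N T i ω)
      (repB (D.rep N T ω) *ᵥ D.momVec N T i ω) := by
  simp_rw [← scaleLoad_mul_betaHat hT hmean hSig hA]
  ext j l
  simp only [betaGram, Matrix.mul_diagonal, Matrix.diagonal_mul, Matrix.sum_apply, vecMulVec_apply,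
    Finset.mul_sum, Finset.sum_mul, Pi.mul_apply]
  exact Finset.sum_congr rfl fun i _ => by ring

lemma repGram_rep : repGram (D.rep N T ω) = (N : ℝ)⁻¹ •
    ∑ i, vecMulVec (repB (D.rep N T ω) *ᵥ D.momVec N T i ω)
      (repB (D.rep N T ω) *ᵥ D.momVec N T i ω) := by
  have hΨ : Matrix.of (D.rep N T ω).2.1 =
      (N : ℝ)⁻¹ • ∑ i, vecMulVec (D.momVec N T i ω) (D.momVec N T i ω) := by
    ext a b
    simp [rep, constT, Matrix.sum_apply, vecMulVec_apply]
  rw [repGram, hΨ, Matrix.mul_smul, Matrix.smul_mul, Matrix.mul_sum, Matrix.sum_mul]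
  simp_rw [Matrix.mul_vecMulVec, Matrix.vecMulVec_mul, Matrix.vecMul_transpose]

variable (hN : 0 < N)

include hT hmean hSig hA hN in
lemma scaleLoad_betaGram : Matrix.diagonal (scaleLoad k₁ k₂ T) * D.betaGram N T ω *
    Matrix.diagonal (scaleLoad k₁ k₂ T) = (N : ℝ) • repGram (D.rep N T ω) := by
  have hN' : (N : ℝ) ≠ 0 := by exact_mod_cast hN.ne'
  rw [repGram_eq hT hmean hSig hA, repGram_rep, smul_smul, mul_inv_cancel₀ hN', one_smul]

include hT in
lemma isUnit_det_scaleLoad : IsUnit (Matrix.diagonal (scaleLoad k₁ k₂ T)).det := by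
  have hs : √(T : ℝ) ≠ 0 := (Real.sqrt_pos.2 (by exact_mod_cast hT)).ne'
  rw [Matrix.det_diagonal, isUnit_iff_ne_zero, Finset.prod_ne_zero_iff]
  rintro (a | a) - <;> simp [scaleLoad, hs]

include hT hmean hSig hA hN in
lemma isUnit_det_betaGram (hH : (repGram (D.rep N T ω)).det ≠ 0) :
    IsUnit (D.betaGram N T ω).det := by
  have hN' : (N : ℝ) ≠ 0 := by exact_mod_cast hN.ne'
  have h := congrArg Matrix.det (scaleLoad_betaGram hT hmean hSig hA hN)
  rw [Matrix.det_mul, Matrix.det_mul, Matrix.det_smul] at h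
  rw [isUnit_iff_ne_zero]
  intro h0
  rw [h0, mul_zero, zero_mul] at h
  exact mul_ne_zero (pow_ne_zero _ hN') hH h.symm

include hT hmean hSig hA hN in
-- With Sc the diagonal scaling of the loadings, `scaleStrong` is √T Sc⁻¹, and inserting Sc Sc⁻¹ on
-- the right of the inverse turns it into the inverse of the scaled Gram matrix. Invertibility of
-- the Gram matrix is not required.
lemma scaleStrong_betaGram_inv_mulVec (y : ObsIdx k₁ k₂ → ℝ) :
    scaleStrong T ((D.betaGram N T ω)⁻¹ *ᵥ y) =
      (repGram (D.rep N T ω))⁻¹ *ᵥ ((N : ℝ)⁻¹ • √(T : ℝ) • (scaleLoad k₁ k₂ T * y)) := by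
  have hN' : (N : ℝ) ≠ 0 := by exact_mod_cast hN.ne'
  have hs : √(T : ℝ) ≠ 0 := (Real.sqrt_pos.2 (by exact_mod_cast hT)).ne'
  have hu := isUnit_det_scaleLoad (k₁ := k₁) (k₂ := k₂) hT
  set Sc := Matrix.diagonal (scaleLoad k₁ k₂ T) with hSc
  have h1 : (repGram (D.rep N T ω))⁻¹ = (N : ℝ) • (Sc⁻¹ * (D.betaGram N T ω)⁻¹ * Sc⁻¹) := by
    have h2 : repGram (D.rep N T ω) = (N : ℝ)⁻¹ • (Sc * D.betaGram N T ω * Sc) := by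
      rw [scaleLoad_betaGram hT hmean hSig hA hN, smul_smul, inv_mul_cancel₀ hN', one_smul]
    rw [h2]
    by_cases hd : IsUnit (Sc * D.betaGram N T ω * Sc).det
    · have := Matrix.inv_smul' (A := Sc * D.betaGram N T ω * Sc)
        (Units.mk0 _ (inv_ne_zero hN')) hd
      simp only [Units.smul_def, Units.val_mk0, Units.val_inv_eq_inv_val] at this
      rw [this, Matrix.mul_inv_rev, Matrix.mul_inv_rev, Matrix.mul_assoc]
      simp
    -- In the singular case both inverses are zero by convention.
    · have hd' : ¬ IsUnit ((N : ℝ)⁻¹ • (Sc * D.betaGram N T ω * Sc)).det := by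
        rw [Matrix.det_smul]
        simpa [isUnit_iff_ne_zero, hN'] using hd
      have hd2 : ¬ IsUnit (D.betaGram N T ω).det := by
        intro h
        apply hd
        rw [Matrix.det_mul, Matrix.det_mul]
        exact (hu.mul h).mul hu
      rw [Matrix.nonsing_inv_apply_not_isUnit _ hd', Matrix.nonsing_inv_apply_not_isUnit _ hd2]
      simp
  have h3 : scaleLoad k₁ k₂ T * y = Sc *ᵥ y := by
    ext a; simp [hSc, Matrix.mulVec_diagonal]
  have h4 : ∀ z, scaleStrong T z = √(T : ℝ) • (Sc⁻¹ *ᵥ z) := by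
    intro z
    have h5 : scaleStrong T z = (√(T : ℝ) • Sc⁻¹) *ᵥ z := by
      have h6 : Sc *ᵥ scaleStrong T z = √(T : ℝ) • z := by
        ext a
        rw [hSc, Matrix.mulVec_diagonal]
        rcases a with a | a <;> simp [scaleLoad, scaleStrong]
      rw [Matrix.smul_mulVec, ← Matrix.mulVec_smul, ← h6, Matrix.mulVec_mulVec,
        Matrix.nonsing_inv_mul _ hu, Matrix.one_mulVec]
    rw [h5, Matrix.smul_mulVec]
  rw [h3, h4, h1, Matrix.smul_mulVec, Matrix.mulVec_smul, Matrix.mulVec_smul, smul_smul,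
    mul_inv_cancel₀ hN', one_smul, Matrix.mulVec_mulVec, Matrix.mulVec_mulVec,
    Matrix.mul_assoc _ Sc⁻¹ Sc, Matrix.nonsing_inv_mul _ hu, Matrix.mul_one]

include hT hmean hSig hA hN in
lemma scaleStrong_betaGram_inv_mulVec_sum (c : Fin N → ℝ) :
    scaleStrong T ((D.betaGram N T ω)⁻¹ *ᵥ ∑ i, c i • D.betaHat N T i ω) =
      (repGram (D.rep N T ω))⁻¹ *ᵥ (repB (D.rep N T ω) *ᵥ
        ((N : ℝ)⁻¹ • ∑ i, (√(T : ℝ) * c i) • D.momVec N T i ω)) := by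
  rw [scaleStrong_betaGram_inv_mulVec hT hmean hSig hA hN]
  congr 1
  rw [Matrix.mulVec_smul, Matrix.mulVec_sum, Finset.mul_sum, Finset.smul_sum]
  congr 1
  refine Finset.sum_congr rfl fun i _ => ?_
  rw [Matrix.mulVec_smul, ← scaleLoad_mul_betaHat hT hmean hSig hA, mul_smul_comm, smul_smul]

include hT hmean hSig hA hN in
lemma scaleStrong_biasOV : scaleStrong T (D.biasOV N T ω) = repOV D.lam (D.rep N T ω) := by
  have hs : √(T : ℝ) ≠ 0 := (Real.sqrt_pos.2 (by exact_mod_cast hT)).ne'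
  rw [biasOV, scaleStrong_betaGram_inv_mulVec_sum hT hmean hSig hA hN, repOV, mulVec_moments,
    ← lamTilde_eq_repLam]
  congr 4
  ext1 i
  congr 1
  rw [← mul_assoc, mul_inv_cancel₀ hs, one_mul]
  simp only [momVec, sumElim_dotProduct_sumElim, dotProduct_zero, add_zero, gam, zero_add]
  rfl

include hT hmean hSig hA hN in
lemma scaleStrong_biasA : scaleStrong T (D.biasA N T ω) = repA D.lam (D.rep N T ω) := by
  have hneg : ∀ z : ObsIdx k₁ k₂ → ℝ, scaleStrong T (-z) = -scaleStrong T z := by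
    intro z; ext a; rcases a with a | a <;> simp [scaleStrong]
  have hs : √(T : ℝ) ≠ 0 := (Real.sqrt_pos.2 (by exact_mod_cast hT)).ne'
  rw [biasA, hneg, scaleStrong_betaGram_inv_mulVec hT hmean hSig hA hN, repA, mulVec_moments,
    ← lamTilde_eq_repLam]
  congr 2
  rw [Matrix.mulVec_smul, Matrix.mulVec_sum, Matrix.sum_mulVec]
  congr 1
  rw [Finset.mul_sum, Finset.smul_sum]
  refine Finset.sum_congr rfl fun i _ => ?_
  rw [Matrix.mulVec_smul, momVec, Matrix.fromCols_mulVec_sumElim, sumElim_dotProduct_sumElim,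
    dotProduct_zero, zero_add, Matrix.zero_mulVec, zero_add, Matrix.vecMulVec_mulVec]
  ext a
  simp only [Pi.smul_apply, Pi.mul_apply, smul_eq_mul, Matrix.mulVec_diagonal, rep, constT,
    smul_dotProduct, MulOpposite.smul_eq_mul_unop, MulOpposite.unop_op]
  rcases a with a | a <;> simp [scaleLoad] <;> field_simp

include hT in
lemma sqrt_mul_rbar (i : Fin N) : √(T : ℝ) * D.rbar N T i ω =
    √(T : ℝ) * (D.lamTilde N T ω ⬝ᵥ D.β N T i) + D.etaVT N T ω ⬝ᵥ D.μ N T i +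
      D.errBar N T i ω := by
  have hT' : (T : ℝ) ≠ 0 := by exact_mod_cast hT.ne'
  have h1 : ∑ t, D.r N T i t ω = (T : ℝ) * (D.lam ⬝ᵥ D.β N T i) +
      (∑ t, (D.F N T t ω - D.meanF N T t)) ⬝ᵥ D.β N T i + (∑ t, D.v N T t ω) ⬝ᵥ D.μ N T i +
      ∑ t, D.e N T i t ω := by
    simp only [r, Finset.sum_add_distrib, Finset.sum_const, Finset.card_univ, Fintype.card_fin,
      nsmul_eq_mul, sum_dotProduct]
  rw [rbar, h1, lamTilde, etaVT, errBar, add_dotProduct, smul_dotProduct, smul_dotProduct,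
    ← sqrt_mul_inv, smul_eq_mul, smul_eq_mul]
  field_simp

include hT hmean hSig hA hN in
-- Write λ̃ as Gram⁻¹ · Gram · λ̃, which needs an invertible Gram matrix. The estimation error then
-- becomes the regression on β̂ᵢ of the residuals r̄ᵢ - β̂ᵢ'λ̃, in which the loadings βᵢ cancel:
-- only μᵢ, uᵢ and the averaged error remain. Here λ̃ occurs as G'λ̃, which is the sole reason,
-- apart from the averaged errors, why the sum of the two biases is not exact.
lemma scaleStrong_lamTP_sub (hH : (repGram (D.rep N T ω)).det ≠ 0) :
    scaleStrong T (D.lamTP N T ω - D.lamTilde N T ω) = repTotal D.lam (D.rep N T ω) := by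
  have hs : √(T : ℝ) ≠ 0 := (Real.sqrt_pos.2 (by exact_mod_cast hT)).ne'
  have hB := isUnit_det_betaGram hT hmean hSig hA hN hH
  have h1 : D.lamTP N T ω - D.lamTilde N T ω = (D.betaGram N T ω)⁻¹ *ᵥ
      ∑ i, (D.rbar N T i ω - D.betaHat N T i ω ⬝ᵥ D.lamTilde N T ω) • D.betaHat N T i ω := by
    have h2 : D.lamTilde N T ω = (D.betaGram N T ω)⁻¹ *ᵥ
        ∑ i, (D.betaHat N T i ω ⬝ᵥ D.lamTilde N T ω) • D.betaHat N T i ω := by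
      have h3 : ∑ i, (D.betaHat N T i ω ⬝ᵥ D.lamTilde N T ω) • D.betaHat N T i ω =
          D.betaGram N T ω *ᵥ D.lamTilde N T ω := by
        rw [betaGram, Matrix.sum_mulVec]
        refine Finset.sum_congr rfl fun i _ => ?_
        rw [Matrix.vecMulVec_mulVec]
        ext a; simp [mul_comm]
      rw [h3, Matrix.mulVec_mulVec, Matrix.nonsing_inv_mul _ hB, Matrix.one_mulVec]
    conv_lhs => rw [h2, lamTP]
    simp_rw [sub_smul, Finset.sum_sub_distrib, Matrix.mulVec_sub]
  rw [h1, scaleStrong_betaGram_inv_mulVec_sum hT hmean hSig hA hN, repTotal, mulVec_moments,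
    ← lamTilde_eq_repLam]
  have h5 : (D.rep N T ω).2.2.1 = (N : ℝ)⁻¹ • ∑ i, D.errBar N T i ω • D.momVec N T i ω := by
    ext a
    simp [rep, constT, Finset.sum_apply, mul_comm]
  rw [h5, ← smul_add, ← Finset.sum_add_distrib]
  congr 4
  ext1 i
  rw [← add_smul]
  congr 1
  set G := Matrix.of (D.rep N T ω).2.2.2.1 with hG
  have hG' : G = (D.gramF N T ω)⁻¹ * D.SigmaF := rfl
  rw [mul_sub, sqrt_mul_rbar hT, betaHat_eq hT hmean hSig hA, ← hG', add_dotProduct]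
  simp only [momVec, gam, sumElim_dotProduct_sumElim, dotProduct_zero, zero_add]
  have h6 : ∀ z : ObsIdx k₁ k₂ → ℝ, (G *ᵥ z) ⬝ᵥ D.lamTilde N T ω =
      z ⬝ᵥ (Gᵀ *ᵥ D.lamTilde N T ω) := by
    intro z
    rw [Matrix.mulVec_transpose, dotProduct_comm z, ← Matrix.dotProduct_mulVec, dotProduct_comm]
  have h7 : ∀ y, (Matrix.of (D.etaT N T ω) *ᵥ D.μ N T i) ⬝ᵥ y =
      D.μ N T i ⬝ᵥ ((Matrix.of (D.etaT N T ω))ᵀ *ᵥ y) := by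
    intro y
    rw [Matrix.mulVec_transpose, dotProduct_comm (D.μ N T i), ← Matrix.dotProduct_mulVec,
      dotProduct_comm]
  rw [h6, add_dotProduct, smul_dotProduct, h7, dotProduct_neg, smul_dotProduct, smul_eq_mul,
    smul_eq_mul, dotProduct_sub, dotProduct_comm (D.lamTilde N T ω)]
  simp only [rep, stateT, dotProduct_comm (D.etaVT N T ω)]
  field_simp
  ring

end Identities

end FactorPanel

/-! ### Non-random limits of the statistics. -/

namespace FactorPanel

variable {k₁ k₂ kᵥ : ℕ} (D : FactorPanel.{u} k₁ k₂ kᵥ) (N T : ℕ)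

lemma sqrt_mul_uErr (i : Fin N) (ω : D.Ω N T) (j : ObsIdx k₁ k₂) :
    √(T : ℝ) * D.uErr N T i ω j =
      ∑ l, D.SigmaF⁻¹ j l * D.errSum N T (weightTilde N T (some l) ω) i ω := by
  simp only [uErr, errSum, weightTilde, Option.elim_some, Pi.smul_apply, Finset.sum_apply,
    smul_eq_mul, mulVec, dotProduct, Finset.mul_sum]
  rw [Finset.sum_comm]
  exact Finset.sum_congr rfl fun t _ => Finset.sum_congr rfl fun l _ => by ring

lemma errBar_eq_errSum (i : Fin N) (ω : D.Ω N T) :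
    D.errBar N T i ω = D.errSum N T (weightTilde N T none ω) i ω := by
  simp [errBar, errSum, weightTilde]

variable {D} {N T} {OmegaF : Matrix (ObsIdx k₁ k₂) (ObsIdx k₁ k₂) ℝ}
    {OmegavF : Matrix (Fin kᵥ × ObsIdx k₁ k₂) (Fin kᵥ × ObsIdx k₁ k₂) ℝ}
    {ν : Measure (LimitSpace k₁ k₂ kᵥ)} [IsProbabilityMeasure ν]
    {Γ : Matrix (AllIdx k₁ k₂ kᵥ) (AllIdx k₁ k₂ kᵥ) ℝ}
    {SigmaSF2 SigmaU : Matrix (ObsIdx k₁ k₂) (ObsIdx k₁ k₂) ℝ}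

lemma tendsToProb_gramF (hf : D.Factors OmegaF OmegavF ν) :
    TendsToProb D.PP atTop (fun p ω => D.gramF p.1 p.2 ω) D.SigmaF :=
  TendsToProb.pi fun j => TendsToProb.pi fun l => TendsToProb.iff_real.2 (hf.lln j l)

lemma tendsto_measure_not_isUnit_gramF (hf : D.Factors OmegaF OmegavF ν) :
    Tendsto (fun p => D.PP p {ω | ¬ IsUnit (D.gramF p.1 p.2 ω).det}) atTop (𝓝 0) := by
  have hS : D.SigmaF.det ≠ 0 := hf.posDef.det_pos.ne'
  have h1 : ContinuousAt (fun A : Matrix (ObsIdx k₁ k₂) (ObsIdx k₁ k₂) ℝ => A.det) D.SigmaF :=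
    (Continuous.matrix_det continuous_id).continuousAt
  refine tendsto_zero_of_le ((tendsToProb_gramF hf).comp h1 _ (isOpen_ne.mem_nhds hS))
    fun p => measure_mono fun ω hω => ?_
  simpa [isUnit_iff_ne_zero] using hω

lemma tendsToProb_gramF_inv_mul (hf : D.Factors OmegaF OmegavF ν) :
    TendsToProb D.PP atTop (fun p ω => (D.gramF p.1 p.2 ω)⁻¹ * D.SigmaF) 1 := by
  have hS : D.SigmaF.det ≠ 0 := hf.posDef.det_pos.ne'
  have h1 : ContinuousAt (fun A : Matrix (ObsIdx k₁ k₂) (ObsIdx k₁ k₂) ℝ => A⁻¹ * D.SigmaF)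
      D.SigmaF :=
    (Continuous.matrix_mul continuous_fst continuous_snd).continuousAt.comp
      ((ContinuousAt.nonsing_inv continuousAt_id hS).prodMk continuousAt_const)
  have h2 := (tendsToProb_gramF hf).comp h1
  rwa [Matrix.nonsing_inv_mul _ (isUnit_iff_ne_zero.2 hS)] at h2

lemma tendsToProb_gam_uErr (he : D.Errors SigmaSF2) (hm : D.IsPricingModel)
    (a : AllIdx k₁ k₂ kᵥ) (j : ObsIdx k₁ k₂) :
    TendsToProb D.PP atTop (fun p ω => (p.1 : ℝ)⁻¹ * ∑ i, D.gam p.1 p.2 i a *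
      (√(p.2 : ℝ) * D.uErr p.1 p.2 i ω j)) 0 := by
  have h1 := TendsToProb.sum fun l =>
    (tendsToProb_gam_errSum he hm (some l) a).const_mul (D.SigmaF⁻¹ j l)
  simp only [mul_zero, Finset.sum_const_zero] at h1
  refine h1.congr_eventually (Eventually.of_forall fun p ω => ?_)
  simp only [sqrt_mul_uErr, Finset.mul_sum]
  rw [Finset.sum_comm]
  exact Finset.sum_congr rfl fun i _ => Finset.sum_congr rfl fun l _ => by ring

lemma tendsToProb_uErr_errBar (he : D.Errors SigmaSF2) (hm : D.IsPricingModel)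
    (j : ObsIdx k₁ k₂) :
    TendsToProb D.PP atTop (fun p ω => (p.1 : ℝ)⁻¹ * ∑ i,
      (√(p.2 : ℝ) * D.uErr p.1 p.2 i ω j) * D.errBar p.1 p.2 i ω) 0 := by
  have h1 := TendsToProb.sum fun l =>
    (tendsToProb_errSum_none he hm l).const_mul (D.SigmaF⁻¹ j l)
  simp only [mul_zero, Finset.sum_const_zero] at h1
  refine h1.congr_eventually (Eventually.of_forall fun p ω => ?_)
  simp only [sqrt_mul_uErr, errBar_eq_errSum, Finset.mul_sum, Finset.sum_mul]
  rw [Finset.sum_comm]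
  exact Finset.sum_congr rfl fun i _ => Finset.sum_congr rfl fun l _ => by ring

lemma tendsToProb_uErr_uErr (he : D.Errors SigmaSF2) (hm : D.IsPricingModel)
    (hSym : D.SigmaF.IsHermitian) (j l : ObsIdx k₁ k₂) :
    TendsToProb D.PP atTop (fun p ω => (p.1 : ℝ)⁻¹ * ∑ i,
      (√(p.2 : ℝ) * D.uErr p.1 p.2 i ω j) * (√(p.2 : ℝ) * D.uErr p.1 p.2 i ω l))
      ((D.SigmaF⁻¹ * SigmaSF2 * D.SigmaF⁻¹) j l) := by
  have h1 := TendsToProb.sum fun k' => TendsToProb.sum fun k =>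
    (tendsToProb_errSum_some he hm k k').const_mul (D.SigmaF⁻¹ j k * D.SigmaF⁻¹ k' l)
  have h2 : ∑ k', ∑ k, D.SigmaF⁻¹ j k * D.SigmaF⁻¹ k' l * SigmaSF2 k k' =
      (D.SigmaF⁻¹ * SigmaSF2 * D.SigmaF⁻¹) j l := by
    simp only [Matrix.mul_apply, Finset.sum_mul]
    exact Finset.sum_congr rfl fun i _ => Finset.sum_congr rfl fun l _ => by ring
  rw [h2] at h1
  refine h1.congr_eventually (Eventually.of_forall fun p ω => ?_)
  have hs : ∀ k, D.SigmaF⁻¹ k l = D.SigmaF⁻¹ l k := fun k => by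
    have := hSym.inv.apply k l
    simpa using this.symm
  simp only [sqrt_mul_uErr, Finset.mul_sum, Finset.sum_mul]
  symm
  rw [Finset.sum_comm]
  refine Finset.sum_congr rfl fun k' _ => ?_
  rw [Finset.sum_comm]
  refine Finset.sum_congr rfl fun k _ => Finset.sum_congr rfl fun i _ => ?_
  rw [hs]
  ring

/-- Loadings and first-pass errors are asymptotically uncorrelated across assets, hence the
block-diagonal limit; the averaged errors are asymptotically uncorrelated with both. -/
theorem tendsToProb_constT (hm : D.IsPricingModel) (hf : D.Factors OmegaF OmegavF ν)
    (hl : D.Loadings Γ) (he : D.Errors SigmaSF2)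
    (hSU : SigmaU = D.SigmaF⁻¹ * SigmaSF2 * D.SigmaF⁻¹) :
    TendsToProb D.PP atTop (fun p ω => D.constT p.1 p.2 ω) (limConst Γ SigmaU) := by
  refine .prodMk (.pi fun a => .pi fun b => ?_) (.prodMk (.pi fun a => ?_)
    (.prodMk (.pi fun j => .pi fun l => ?_) (.prodMk (.pi fun j => ?_) ?_)))
  · rcases a with a | j <;> rcases b with b | l
    · exact TendsToProb.of_tendsto (hl.tendsto a b)
    · exact tendsToProb_gam_uErr he hm a l
    · refine (tendsToProb_gam_uErr he hm b j).congr_eventually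
        (Eventually.of_forall fun p ω => ?_)
      simp only [momVec, Sum.elim_inl, Sum.elim_inr, Pi.smul_apply, smul_eq_mul]
      congr 1
      exact Finset.sum_congr rfl fun i _ => mul_comm _ _
    · subst hSU
      exact tendsToProb_uErr_uErr he hm hf.posDef.isHermitian j l
  · rcases a with a | j
    · simp_rw [errBar_eq_errSum]
      exact tendsToProb_gam_errSum he hm none a
    · exact tendsToProb_uErr_errBar he hm j
  · exact (tendsToProb_gramF_inv_mul hf).comp
      (f := fun A : Matrix (ObsIdx k₁ k₂) (ObsIdx k₁ k₂) ℝ => A j l)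
      ((continuous_apply l).comp (continuous_apply j)).continuousAt
  · rcases j with j | j
    · exact TendsToProb.of_tendsto tendsto_inv_sqrt_snd
    · exact TendsToProb.of_tendsto tendsto_const_nhds
  · exact TendsToProb.of_tendsto tendsto_inv_sqrt_snd

/-- Stationarity for blocks of length one, shifted by t. -/
lemma meanF_eq (hf : D.Factors OmegaF OmegavF ν) (t s : Fin T) :
    D.meanF N T t = D.meanF N T s := by
  have key : ∀ t : Fin T, ∀ j, D.meanF N T t j =
      ∫ x, x 0 j ∂((D.P N T).map fun ω (_ : Fin 1) => D.F N T ⟨0, t.pos⟩ ω) := by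
    intro t j
    have h := hf.stationary N T 1 t t.isLt
    have h1 : (fun ω (s : Fin 1) => D.F N T ⟨s, s.isLt.trans_le t.pos⟩ ω) =
        fun ω (_ : Fin 1) => D.F N T ⟨0, t.pos⟩ ω := by
      ext ω s j
      have hs : (⟨s, s.isLt.trans_le t.pos⟩ : Fin T) = ⟨0, t.pos⟩ := by ext; simp
      rw [hs]
    have h2 : (fun ω (s : Fin 1) => D.F N T ⟨t + s,
        (Nat.add_lt_add_left s.isLt _).trans_le t.isLt⟩ ω) = fun ω (_ : Fin 1) => D.F N T t ω := by
      ext ω s j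
      have hs : (⟨t + s, (Nat.add_lt_add_left s.isLt _).trans_le t.isLt⟩ : Fin T) = t := by
        ext; simp
      rw [hs]
    rw [h1, h2] at h
    have hmeas : Measurable fun x : Fin 1 → ObsIdx k₁ k₂ → ℝ => x 0 j :=
      (measurable_pi_apply j).comp (measurable_pi_apply 0)
    rw [← h, integral_map (measurable_pi_lambda _ fun _ => D.measurable_F N T t).aemeasurable
      hmeas.aestronglyMeasurable, meanF]
  ext j
  rw [key t j, key s j]

end FactorPanel

/-! ### Positive definiteness of the limiting matrices. -/

lemma TendsToProb.mem_of_isClosed {ι : Type*} {Ω : ι → Type*} {mΩ : ∀ i, MeasurableSpace (Ω i)}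
    {P : ∀ i, Measure (Ω i)} {l : Filter ι} [l.NeBot] [∀ i, IsProbabilityMeasure (P i)]
    {E : Type*} [TopologicalSpace E] {X : ∀ i, Ω i → E} {c : E} (h : TendsToProb P l X c)
    {S : Set E} (hS : IsClosed S) (hX : ∀ i ω, X i ω ∈ S) : c ∈ S := by
  by_contra hc
  have h1 := h _ (hS.isOpen_compl.mem_nhds hc)
  simp only [Set.mem_compl_iff, not_not, hX, Set.ofPred_true, measure_univ] at h1
  exact one_ne_zero (tendsto_nhds_unique tendsto_const_nhds h1)

section PosDef

variable {n : Type*} [Fintype n]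

lemma Matrix.isClosed_posSemidef : IsClosed {A : Matrix n n ℝ | A.PosSemidef} := by
  have h : {A : Matrix n n ℝ | A.PosSemidef} =
      {A | Aᵀ = A} ∩ ⋂ x : n → ℝ, {A | 0 ≤ x ⬝ᵥ A *ᵥ x} := by
    ext A
    simp [Matrix.posSemidef_iff_dotProduct_mulVec, Matrix.IsHermitian,
      Matrix.conjTranspose_eq_transpose_of_trivial]
  rw [h]
  refine (isClosed_eq (by fun_prop) (by fun_prop)).inter (isClosed_iInter fun x => ?_)
  exact isClosed_le continuous_const (Continuous.dotProduct continuous_const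
    (Continuous.matrix_mulVec continuous_id continuous_const))

/-- Compactness of the unit sphere. The sphere is that of the sup norm, on which x ⬝ᵥ x is not
constant, so the constant is the minimum of the quadratic form divided by the maximum of x ⬝ᵥ x. -/
lemma Matrix.PosDef.exists_pos_mul_le {A : Matrix n n ℝ} (hA : A.PosDef) :
    ∃ c : ℝ, 0 < c ∧ ∀ x : n → ℝ, c * (x ⬝ᵥ x) ≤ x ⬝ᵥ A *ᵥ x := by
  classical
  have hpos : ∀ x : n → ℝ, x ≠ 0 → 0 < x ⬝ᵥ A *ᵥ x := fun x hx => by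
    simpa using hA.dotProduct_mulVec_pos hx
  have hcont : Continuous fun x : n → ℝ => x ⬝ᵥ A *ᵥ x :=
    Continuous.dotProduct continuous_id (Continuous.matrix_mulVec continuous_const continuous_id)
  have hcont1 : Continuous fun x : n → ℝ => x ⬝ᵥ x := Continuous.dotProduct continuous_id continuous_id
  rcases isEmpty_or_nonempty n with hn | hn
  · exact ⟨1, one_pos, fun x => by simp [dotProduct]⟩
  have hK : IsCompact (Metric.sphere (0 : n → ℝ) 1) := isCompact_sphere 0 1
  have hne : (Metric.sphere (0 : n → ℝ) 1).Nonempty := NormedSpace.sphere_nonempty.2 zero_le_one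
  have h0 : ∀ x ∈ Metric.sphere (0 : n → ℝ) 1, x ≠ 0 := fun x hx => by
    rintro rfl; simp at hx
  obtain ⟨y, hy, hymin⟩ := hK.exists_isMinOn hne hcont.continuousOn
  obtain ⟨z, hz, hzmax⟩ := hK.exists_isMaxOn hne hcont1.continuousOn
  have hzp : 0 < z ⬝ᵥ z := by
    have := dotProduct_self_eq_zero.not.2 (h0 z hz)
    exact lt_of_le_of_ne (dotProduct_self_nonneg_real z) (Ne.symm this)
  refine ⟨(y ⬝ᵥ A *ᵥ y) / (z ⬝ᵥ z), div_pos (hpos y (h0 y hy)) hzp, fun x => ?_⟩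
  by_cases hx : x = 0
  · simp [hx]
  have hx' : ‖x‖ ≠ 0 := norm_ne_zero_iff.2 hx
  have hxs : ‖x‖⁻¹ • x ∈ Metric.sphere (0 : n → ℝ) 1 := by simp [norm_smul, hx']
  have h1 := isMinOn_iff.1 hymin _ hxs
  have h2 := isMaxOn_iff.1 hzmax _ hxs
  simp only [mulVec_smul, smul_dotProduct, dotProduct_smul, smul_eq_mul] at h1 h2
  have hp : 0 < ‖x‖⁻¹ := by positivity
  rw [div_mul_eq_mul_div, div_le_iff₀ hzp]
  have hyp := hpos y (h0 y hy)
  have hxx : x ⬝ᵥ x ≤ ‖x‖ * ‖x‖ * (z ⬝ᵥ z) := by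
    have := mul_le_mul_of_nonneg_left h2 (by positivity : 0 ≤ ‖x‖ * ‖x‖)
    calc x ⬝ᵥ x = ‖x‖ * ‖x‖ * (‖x‖⁻¹ * (‖x‖⁻¹ * (x ⬝ᵥ x))) := by field_simp
      _ ≤ _ := this
  have hxA : ‖x‖ * ‖x‖ * (y ⬝ᵥ A *ᵥ y) ≤ x ⬝ᵥ A *ᵥ x := by
    have := mul_le_mul_of_nonneg_left h1 (by positivity : 0 ≤ ‖x‖ * ‖x‖)
    calc _ ≤ _ := this
      _ = _ := by field_simp
  calc (y ⬝ᵥ A *ᵥ y) * (x ⬝ᵥ x) ≤ (y ⬝ᵥ A *ᵥ y) * (‖x‖ * ‖x‖ * (z ⬝ᵥ z)) :=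
        mul_le_mul_of_nonneg_left hxx hyp.le
    _ = (‖x‖ * ‖x‖ * (y ⬝ᵥ A *ᵥ y)) * (z ⬝ᵥ z) := by ring
    _ ≤ _ := mul_le_mul_of_nonneg_right hxA hzp.le

end PosDef

section LimitGram

variable {k₁ k₂ kᵥ : ℕ} {Γ : Matrix (AllIdx k₁ k₂ kᵥ) (AllIdx k₁ k₂ kᵥ) ℝ}
  {SigmaU : Matrix (ObsIdx k₁ k₂) (ObsIdx k₁ k₂) ℝ}

lemma dotProduct_limGram_mulVec (η : ObsIdx k₁ k₂ → Fin kᵥ → ℝ) (w : ObsIdx k₁ k₂ → ℝ) :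
    w ⬝ᵥ limGram Γ SigmaU η *ᵥ w =
      Sum.elim w ((etaTilde η)ᵀ *ᵥ w) ⬝ᵥ Γ *ᵥ Sum.elim w ((etaTilde η)ᵀ *ᵥ w) +
        (weakProj k₁ k₂ *ᵥ w) ⬝ᵥ SigmaU *ᵥ (weakProj k₁ k₂ *ᵥ w) := by
  have h : ∀ {m : Type} [Fintype m] (B : Matrix (ObsIdx k₁ k₂) m ℝ) (C : Matrix m m ℝ),
      w ⬝ᵥ (B * C * Bᵀ) *ᵥ w = (Bᵀ *ᵥ w) ⬝ᵥ C *ᵥ (Bᵀ *ᵥ w) := by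
    intro m _ B C
    rw [← Matrix.mulVec_mulVec, ← Matrix.mulVec_mulVec, Matrix.dotProduct_mulVec,
      Matrix.mulVec_transpose]
  have h2 := h (weakProj k₁ k₂) SigmaU
  rw [weakProj_transpose] at h2
  rw [limGram, Matrix.add_mulVec, dotProduct_add, h, h2, Matrix.transpose_fromCols,
    Matrix.fromRows_mulVec]
  simp

lemma isHermitian_limGram (hΓ : Γ.IsHermitian) (hS : SigmaU.IsHermitian)
    (η : ObsIdx k₁ k₂ → Fin kᵥ → ℝ) : (limGram Γ SigmaU η).IsHermitian := by
  have hΓ' : Γᵀ = Γ := by simpa [Matrix.conjTranspose_eq_transpose_of_trivial] using hΓ.eq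
  have hS' : SigmaUᵀ = SigmaU := by
    simpa [Matrix.conjTranspose_eq_transpose_of_trivial] using hS.eq
  rw [Matrix.IsHermitian, Matrix.conjTranspose_eq_transpose_of_trivial, limGram]
  simp only [Matrix.transpose_add, Matrix.transpose_mul, Matrix.transpose_transpose, hΓ', hS',
    weakProj_transpose, Matrix.mul_assoc]

/-- The vector (w, η̃'w) fed into Γ contains w itself, thanks to the identity block, so the
coercivity constant of Γ serves for every η. This uniformity later bounds the inverse. -/
lemma mul_le_dotProduct_limGram_mulVec (hS : SigmaU.PosSemidef) {c : ℝ} (hc : 0 ≤ c)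
    (hΓ : ∀ x : AllIdx k₁ k₂ kᵥ → ℝ, c * (x ⬝ᵥ x) ≤ x ⬝ᵥ Γ *ᵥ x)
    (η : ObsIdx k₁ k₂ → Fin kᵥ → ℝ) (w : ObsIdx k₁ k₂ → ℝ) :
    c * (w ⬝ᵥ w) ≤ w ⬝ᵥ limGram Γ SigmaU η *ᵥ w := by
  rw [dotProduct_limGram_mulVec]
  have h1 := hΓ (Sum.elim w ((etaTilde η)ᵀ *ᵥ w))
  have h2 := hS.dotProduct_mulVec_nonneg (weakProj k₁ k₂ *ᵥ w)
  rw [sumElim_dotProduct_sumElim] at h1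
  rw [star_trivial] at h2
  have h3 := mul_nonneg hc (dotProduct_self_nonneg_real ((etaTilde η)ᵀ *ᵥ w))
  linarith [mul_add c (w ⬝ᵥ w) (((etaTilde η)ᵀ *ᵥ w) ⬝ᵥ ((etaTilde η)ᵀ *ᵥ w))]

lemma posDef_limGram (hΓ : Γ.PosDef) (hS : SigmaU.PosSemidef)
    (η : ObsIdx k₁ k₂ → Fin kᵥ → ℝ) : (limGram Γ SigmaU η).PosDef := by
  obtain ⟨c, hc, hΓc⟩ := hΓ.exists_pos_mul_le
  refine Matrix.PosDef.of_dotProduct_mulVec_pos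
    (isHermitian_limGram hΓ.isHermitian hS.isHermitian η) fun w hw => ?_
  rw [star_trivial]
  refine lt_of_lt_of_le (mul_pos hc ?_) (mul_le_dotProduct_limGram_mulVec hS hc.le hΓc η w)
  exact lt_of_le_of_ne (dotProduct_self_nonneg_real w) (Ne.symm (dotProduct_self_eq_zero.not.2 hw))

end LimitGram

/-! ### Measurability of the statistics. -/

namespace FactorPanel

section Measurability

variable {k₁ k₂ kᵥ : ℕ} (D : FactorPanel.{u} k₁ k₂ kᵥ) (N T : ℕ)

@[fun_prop]
lemma measurable_r (i : Fin N) (t : Fin T) : Measurable (D.r N T i t) := by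
  unfold r
  simp only [dotProduct, Pi.sub_apply]
  fun_prop

@[fun_prop]
lemma measurable_betaHat_apply (i : Fin N) (j : ObsIdx k₁ k₂) :
    Measurable fun ω => D.betaHat N T i ω j := by
  unfold betaHat
  refine measurable_matrix_inv_mulVec_apply (fun a b => ?_) (fun a => ?_) j
  · simp only [Matrix.sum_apply, vecMulVec_apply]; fun_prop
  · simp only [Finset.sum_apply, Pi.smul_apply, smul_eq_mul]; fun_prop

@[fun_prop]
lemma measurable_betaGram_apply (j l : ObsIdx k₁ k₂) :
    Measurable fun ω => D.betaGram N T ω j l := by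
  simp only [betaGram, Matrix.sum_apply, vecMulVec_apply]; fun_prop

@[fun_prop]
lemma measurable_uErr_apply (i : Fin N) (j : ObsIdx k₁ k₂) :
    Measurable fun ω => D.uErr N T i ω j := by
  simp only [uErr, Pi.smul_apply, Finset.sum_apply, smul_eq_mul, mulVec, dotProduct]; fun_prop

@[fun_prop]
lemma measurable_lamTilde_apply (j : ObsIdx k₁ k₂) :
    Measurable fun ω => D.lamTilde N T ω j := by
  simp only [lamTilde, Pi.add_apply, Pi.smul_apply, Finset.sum_apply, smul_eq_mul, Pi.sub_apply]
  fun_prop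

@[fun_prop]
lemma measurable_etaT_apply (j : ObsIdx k₁ k₂) (l : Fin kᵥ) :
    Measurable fun ω => D.etaT N T ω j l := by
  simp only [etaT, mulVec, dotProduct]; fun_prop

@[fun_prop]
lemma measurable_etaVT_apply (l : Fin kᵥ) : Measurable fun ω => D.etaVT N T ω l := by
  simp only [etaVT, Pi.smul_apply, Finset.sum_apply, smul_eq_mul]; fun_prop

@[fun_prop]
lemma measurable_zetaT_apply (j : ObsIdx k₁ k₂) : Measurable fun ω => D.zetaT N T ω j := by
  simp only [zetaT, Pi.smul_apply, Finset.sum_apply, smul_eq_mul, Pi.sub_apply]; fun_prop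

@[fun_prop]
lemma measurable_lamTP_apply (j : ObsIdx k₁ k₂) : Measurable fun ω => D.lamTP N T ω j := by
  unfold lamTP
  refine measurable_matrix_inv_mulVec_apply (fun a b => by fun_prop) (fun a => ?_) j
  simp only [Finset.sum_apply, Pi.smul_apply, smul_eq_mul, rbar]; fun_prop

@[fun_prop]
lemma measurable_biasA_apply (j : ObsIdx k₁ k₂) : Measurable fun ω => D.biasA N T ω j := by
  unfold biasA
  refine (measurable_matrix_inv_mulVec_apply (fun a b => by fun_prop) (fun a => ?_) j).neg
  simp only [mulVec, dotProduct, Matrix.sum_apply, vecMulVec_apply]; fun_prop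

@[fun_prop]
lemma measurable_biasOV_apply (j : ObsIdx k₁ k₂) : Measurable fun ω => D.biasOV N T ω j := by
  unfold biasOV
  refine measurable_matrix_inv_mulVec_apply (fun a b => by fun_prop) (fun a => ?_) j
  simp only [Finset.sum_apply, Pi.smul_apply, smul_eq_mul, dotProduct, Pi.sub_apply, mulVec,
    Matrix.transpose_apply, Matrix.of_apply]
  fun_prop

lemma measurable_scaleStrong {Ω : Type*} {mΩ : MeasurableSpace Ω} {X : Ω → ObsIdx k₁ k₂ → ℝ}
    (hX : ∀ j, Measurable fun ω => X ω j) : Measurable fun ω => scaleStrong T (X ω) := by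
  refine measurable_pi_lambda _ fun j => ?_
  rcases j with j | j
  · exact (hX _).const_mul _
  · exact hX _

@[fun_prop]
lemma measurable_momVec_apply (i : Fin N) (a : MomentIdx k₁ k₂ kᵥ) :
    Measurable fun ω => D.momVec N T i ω a := by
  rcases a with a | a
  · exact measurable_const
  · exact (measurable_uErr_apply D N T i a).const_mul _

@[fun_prop]
lemma measurable_errBar (i : Fin N) : Measurable (D.errBar N T i) := by
  unfold errBar; fun_prop

@[fun_prop]
lemma measurable_gramF_inv_apply (j l : ObsIdx k₁ k₂) :
    Measurable fun ω => (D.gramF N T ω)⁻¹ j l :=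
  measurable_matrix_inv_apply (fun a b => by simp only [gramF, Matrix.of_apply]; fun_prop) j l

lemma measurable_stateT : Measurable (D.stateT N T) :=
  Measurable.prodMk (measurable_pi_lambda _ fun _ => by fun_prop)
    (Measurable.prodMk
      (measurable_pi_lambda _ fun _ => measurable_pi_lambda _ fun _ => by fun_prop)
      (measurable_pi_lambda _ fun _ => by fun_prop))

lemma measurable_constT : Measurable (D.constT N T) := by
  unfold constT
  refine Measurable.prodMk (measurable_pi_lambda _ fun a => measurable_pi_lambda _ fun b => ?_)
    (Measurable.prodMk (measurable_pi_lambda _ fun a => ?_)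
    (Measurable.prodMk (measurable_pi_lambda _ fun j => measurable_pi_lambda _ fun l => ?_)
      measurable_const))
  · fun_prop
  · fun_prop
  · simp only [Matrix.mul_apply]
    fun_prop

lemma measurable_rep : Measurable (D.rep N T) :=
  (D.measurable_stateT N T).prodMk (D.measurable_constT N T)

end Measurability

instance opensMeasurableSpace_limitSpace_prod_constSpace (k₁ k₂ kᵥ : ℕ) :
    OpensMeasurableSpace (LimitSpace k₁ k₂ kᵥ × ConstSpace k₁ k₂ kᵥ) := by
  have h1 : BorelSpace ((ObsIdx k₁ k₂ → ℝ) × ℝ) := Prod.borelSpace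
  have h2 : BorelSpace ((ObsIdx k₁ k₂ → ObsIdx k₁ k₂ → ℝ) × (ObsIdx k₁ k₂ → ℝ) × ℝ) :=
    Prod.borelSpace
  have h3 : BorelSpace ((MomentIdx k₁ k₂ kᵥ → ℝ) × (ObsIdx k₁ k₂ → ObsIdx k₁ k₂ → ℝ) ×
    (ObsIdx k₁ k₂ → ℝ) × ℝ) := Prod.borelSpace
  have h4 : BorelSpace (ConstSpace k₁ k₂ kᵥ) := Prod.borelSpace
  exact Prod.opensMeasurableSpace

/-! ### Weak limits of the estimator and of its biases. -/

section WeakLimits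

variable {k₁ k₂ kᵥ : ℕ} {D : FactorPanel.{u} k₁ k₂ kᵥ}
    {OmegaF : Matrix (ObsIdx k₁ k₂) (ObsIdx k₁ k₂) ℝ}
    {OmegavF : Matrix (Fin kᵥ × ObsIdx k₁ k₂) (Fin kᵥ × ObsIdx k₁ k₂) ℝ}
    {ν : Measure (LimitSpace k₁ k₂ kᵥ)} [IsProbabilityMeasure ν]
    {Γ : Matrix (AllIdx k₁ k₂ kᵥ) (AllIdx k₁ k₂ kᵥ) ℝ}
    {SigmaSF2 SigmaU : Matrix (ObsIdx k₁ k₂) (ObsIdx k₁ k₂) ℝ}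
    (hm : D.IsPricingModel) (hf : D.Factors OmegaF OmegavF ν)
    (hl : D.Loadings Γ) (he : D.Errors SigmaSF2)
    (hSU : SigmaU = D.SigmaF⁻¹ * SigmaSF2 * D.SigmaF⁻¹)

include hm hf he hSU in
-- Σ_u is the limit in probability of the matrices N⁻¹ ∑ T uᵢuᵢ', and the cone of positive
-- semidefinite matrices is closed.
lemma posSemidef_SigmaU : SigmaU.PosSemidef := by
  subst hSU
  have h : TendsToProb D.PP atTop (fun p ω => (p.1 : ℝ)⁻¹ •
      ∑ i, vecMulVec (√(p.2 : ℝ) • D.uErr p.1 p.2 i ω) (star (√(p.2 : ℝ) • D.uErr p.1 p.2 i ω)))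
      (D.SigmaF⁻¹ * SigmaSF2 * D.SigmaF⁻¹) := by
    refine TendsToProb.pi fun j => TendsToProb.pi fun l => ?_
    refine (tendsToProb_uErr_uErr he hm hf.posDef.isHermitian j l).congr_eventually
      (Eventually.of_forall fun p ω => ?_)
    simp only [Matrix.smul_apply, Matrix.sum_apply, vecMulVec_apply, star_trivial, Pi.smul_apply,
      smul_eq_mul]
  refine h.mem_of_isClosed Matrix.isClosed_posSemidef fun p ω => ?_
  exact (Matrix.posSemidef_sum _ fun i _ => Matrix.posSemidef_vecMulVec_self_star _).smul
    (by positivity)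

include hm hf hl he hSU in
lemma det_limGram_ne_zero (η : ObsIdx k₁ k₂ → Fin kᵥ → ℝ) : (limGram Γ SigmaU η).det ≠ 0 :=
  (posDef_limGram hl.posDef (posSemidef_SigmaU hm hf he hSU) η).det_pos.ne'

include hm hf hl he hSU in
-- Slutsky's theorem for the indicator of a singular Gram matrix. It is locally constant, equal to
-- zero, at all limit points because the limiting determinant is nonzero, so it converges in law,
-- hence in probability, to zero.
lemma tendsto_measure_det_repGram :
    Tendsto (fun p => D.PP p {ω | (repGram (D.rep p.1 p.2 ω)).det = 0}) atTop (𝓝 0) := by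
  have hmeas : Measurable fun y : LimitSpace k₁ k₂ kᵥ × ConstSpace k₁ k₂ kᵥ => (repGram y).det :=
    (Continuous.matrix_det continuous_repGram).measurable
  have hdet := det_limGram_ne_zero hm hf hl he hSU
  have h := hf.clt.slutsky_map (tendsToProb_constT hm hf hl he hSU)
    (f := fun y => if (repGram y).det = 0 then (1 : ℝ) else 0)
    (Y := fun p ω => if (repGram (D.rep p.1 p.2 ω)).det = 0 then (1 : ℝ) else 0)
    (fun x => ?_) (fun p => ?_) ?_ ?_
  · have h0 : ∀ x : LimitSpace k₁ k₂ kᵥ,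
        (if (repGram (id x, limConst Γ SigmaU)).det = 0 then (1 : ℝ) else 0) = 0 := fun x => by
      rw [id, repGram_limConst, if_neg (hdet x.2.1)]
    simp_rw [h0] at h
    refine tendsto_zero_of_le (h.tendsToProb _ (isOpen_ne.mem_nhds (zero_ne_one (α := ℝ))))
      fun p => measure_mono fun ω hω => ?_
    have hω' : (repGram (D.rep p.1 p.2 ω)).det = 0 := hω
    simp [hω']
  · have h1 : (repGram (x, limConst Γ SigmaU)).det ≠ 0 := by
      rw [repGram_limConst]; exact hdet x.2.1
    have h2 : ∀ᶠ y in 𝓝 (x, limConst Γ SigmaU), (repGram y).det ≠ 0 :=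
      (Continuous.matrix_det continuous_repGram).continuousAt.eventually_ne h1
    refine (continuousAt_const (y := (0 : ℝ))).congr ?_
    filter_upwards [h2] with y hy
    rw [if_neg hy]
  · exact (Measurable.ite (hmeas.comp (D.measurable_rep p.1 p.2) (measurableSet_singleton 0))
      measurable_const measurable_const).aemeasurable
  · simp_rw [id, repGram_limConst, if_neg (hdet _)]
    exact aemeasurable_const
  · exact tendsto_const_nhds.congr fun p => by
      refine (measure_mono_null (t := ∅) (fun ω hω => ?_) measure_empty).symm
      exact (show _ ≠ _ from hω) rfl

include hm hf hl he hSU in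
/-- Weak convergence of statistics that are continuous functions of the normalized averages, on
the event where the first-pass and second-pass Gram matrices are invertible. -/
theorem tendstoInDistribution_of_rep {F : Type*} [TopologicalSpace F] [MeasurableSpace F]
    [BorelSpace F] {f : LimitSpace k₁ k₂ kᵥ × ConstSpace k₁ k₂ kᵥ → F}
    (hcont : ∀ x, ContinuousAt f (x, limConst Γ SigmaU)) {Y : ∀ p : ℕ × ℕ, D.Ω p.1 p.2 → F}
    (hY : ∀ p, Measurable (Y p))
    (hYf : ∀ (p : ℕ × ℕ) (ω : D.Ω p.1 p.2), 0 < p.1 → 0 < p.2 →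
      IsUnit (D.gramF p.1 p.2 ω).det → (repGram (D.rep p.1 p.2 ω)).det ≠ 0 →
      Y p ω = f (D.rep p.1 p.2 ω)) :
    TendstoInDistribution Y atTop (fun x => f (x, limConst Γ SigmaU)) D.PP ν := by
  refine hf.clt.slutsky_map (tendsToProb_constT hm hf hl he hSU) hcont
    (fun p => (hY p).aemeasurable) ?_ ?_
  · refine (continuous_iff_continuousAt.2 fun x => ?_).measurable.aemeasurable
    exact (hcont x).comp (f := fun x => (x, limConst Γ SigmaU)) (by fun_prop)
  · have h1 := tendsto_measure_union (tendsto_measure_not_isUnit_gramF hf)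
      (tendsto_measure_det_repGram hm hf hl he hSU)
    have hN : ∀ᶠ p : ℕ × ℕ in atTop, 0 < p.1 ∧ 0 < p.2 := by
      filter_upwards [eventually_ge_atTop ((1, 1) : ℕ × ℕ)] with p hp
      exact ⟨hp.1, hp.2⟩
    refine tendsto_of_tendsto_of_tendsto_of_le_of_le' tendsto_const_nhds h1
      (Eventually.of_forall fun _ => zero_le) ?_
    filter_upwards [hN] with p hp
    refine measure_mono fun ω hω => ?_
    by_contra hcon
    simp only [Set.mem_union, Set.mem_ofPred_eq, not_or, not_not] at hcon
    exact hω (hYf p ω hp.1 hp.2 hcon.1 hcon.2)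

include hm hf hl he hSU in
theorem tendstoInDistribution_biases : TendstoInDistribution
      (fun (p : ℕ × ℕ) (ω : D.Ω p.1 p.2) =>
        (√(p.2 : ℝ) • (D.lamTilde p.1 p.2 ω - D.lam),
          scaleStrong p.2 (D.biasOV p.1 p.2 ω), scaleStrong p.2 (D.biasA p.1 p.2 ω)))
      atTop (fun x => (x.1, limOV Γ SigmaU D.lam x, limA Γ SigmaU D.lam x))
      (fun p => D.P p.1 p.2) ν := by
  have hdet := det_limGram_ne_zero hm hf hl he hSU
  have h := tendstoInDistribution_of_rep hm hf hl he hSU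
    (f := fun y => (y.1.1, repOV D.lam y, repA D.lam y))
    (fun x => (by fun_prop : ContinuousAt _ _).prodMk ((continuousAt_repOV D.lam x (hdet _)).prodMk
      (continuousAt_repA D.lam x (hdet _))))
    (Y := fun p ω => (√(p.2 : ℝ) • (D.lamTilde p.1 p.2 ω - D.lam),
          scaleStrong p.2 (D.biasOV p.1 p.2 ω), scaleStrong p.2 (D.biasA p.1 p.2 ω)))
    (fun p => ?_) (fun p ω hN hT hA hH => ?_)
  · simpa only [repOV_limConst, repA_limConst] using h
  · refine .prodMk (measurable_pi_lambda _ fun j => ?_) (.prodMk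
      (measurable_scaleStrong _ (by fun_prop)) (measurable_scaleStrong _ (by fun_prop)))
    simp only [Pi.smul_apply, Pi.sub_apply]; fun_prop
  · have hSig : IsUnit D.SigmaF.det := isUnit_iff_ne_zero.2 hf.posDef.det_pos.ne'
    rw [scaleStrong_biasOV hT (meanF_eq hf) hSig hA hN,
      scaleStrong_biasA hT (meanF_eq hf) hSig hA hN]
    congr 1
    rw [lamTilde_eq_repLam, repLam, add_sub_cancel_left, smul_smul]
    simp only [rep, stateT, constT]
    rw [mul_inv_cancel₀ (Real.sqrt_pos.2 (by exact_mod_cast hT)).ne', one_smul]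

lemma lamTilde_sub_lam {N T : ℕ} (ω : D.Ω N T) : D.lamTilde N T ω - D.lam =
    (D.rep N T ω).2.2.2.2.2 • (D.rep N T ω).1.1 := by
  rw [lamTilde_eq_repLam, repLam, add_sub_cancel_left]

include hm hf hl he hSU in
-- On the weak components no scaling occurs, and λ̃ - λ = T^{-1/2} ζ_T is added to the limit of λ̂ -
-- λ̃; its coefficient T^{-1/2} has limit zero.
theorem tendstoInDistribution_lamTP_weak : TendstoInDistribution
      (fun (p : ℕ × ℕ) (ω : D.Ω p.1 p.2) (b : Fin k₂) =>
        D.lamTP p.1 p.2 ω (Sum.inr b) - D.lam (Sum.inr b))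
      atTop (fun x b => limA Γ SigmaU D.lam x (Sum.inr b) + limOV Γ SigmaU D.lam x (Sum.inr b))
      (fun p => D.P p.1 p.2) ν := by
  have hdet := det_limGram_ne_zero hm hf hl he hSU
  have h := tendstoInDistribution_of_rep hm hf hl he hSU
    (f := fun y (b : Fin k₂) => repTotal D.lam y (Sum.inr b) + y.2.2.2.2.2 * y.1.1 (Sum.inr b))
    (fun x => continuousAt_pi.2 fun b =>
      (continuousAt_pi.1 (continuousAt_repTotal D.lam x (hdet _)) _).add (by fun_prop))
    (Y := fun p ω b => D.lamTP p.1 p.2 ω (Sum.inr b) - D.lam (Sum.inr b))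
    (fun p => measurable_pi_lambda _ fun b => by fun_prop) (fun p ω hN hT hA hH => ?_)
  · have h0 : (limConst Γ SigmaU).2.2.2.2 = 0 := rfl
    simpa only [repTotal_limConst, h0, zero_mul, add_zero, Pi.add_apply] using h
  · have hSig : IsUnit D.SigmaF.det := isUnit_iff_ne_zero.2 hf.posDef.det_pos.ne'
    ext b
    rw [← scaleStrong_lamTP_sub hT (meanF_eq hf) hSig hA hN hH]
    have h1 := congrFun (lamTilde_sub_lam ω) (Sum.inr b)
    simp only [Pi.smul_apply, Pi.sub_apply, smul_eq_mul] at h1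
    rw [← h1]
    simp [scaleStrong]

include hm hf hl he hSU in
-- The difference is a function of the statistics that vanishes whenever the second component takes
-- its limiting value; so its limit in law is the constant zero, which means convergence in
-- probability.
lemma tendsToProb_lamTP_sub (j : ObsIdx k₁ k₂) : TendsToProb D.PP atTop (fun p ω =>
    scaleStrong p.2 (D.lamTP p.1 p.2 ω - D.lamTilde p.1 p.2 ω) j -
      (scaleStrong p.2 (D.biasA p.1 p.2 ω) j + scaleStrong p.2 (D.biasOV p.1 p.2 ω) j)) 0 := by
  have hdet := det_limGram_ne_zero hm hf hl he hSU
  have h := tendstoInDistribution_of_rep hm hf hl he hSU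
    (f := fun y => repTotal D.lam y j - (repA D.lam y j + repOV D.lam y j))
    (fun x => (continuousAt_pi.1 (continuousAt_repTotal D.lam x (hdet _)) j).sub
      ((continuousAt_pi.1 (continuousAt_repA D.lam x (hdet _)) j).add
      (continuousAt_pi.1 (continuousAt_repOV D.lam x (hdet _)) j)))
    (Y := fun p ω => scaleStrong p.2 (D.lamTP p.1 p.2 ω - D.lamTilde p.1 p.2 ω) j -
      (scaleStrong p.2 (D.biasA p.1 p.2 ω) j + scaleStrong p.2 (D.biasOV p.1 p.2 ω) j))
    (fun p => ?_) (fun p ω hN hT hA hH => ?_)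
  · simp only [repTotal_limConst, repA_limConst, repOV_limConst, Pi.add_apply, sub_self] at h
    exact h.tendsToProb
  · have h0 := fun {X : D.Ω p.1 p.2 → ObsIdx k₁ k₂ → ℝ} (hX : ∀ j, Measurable fun ω => X ω j) =>
      (measurable_pi_apply j).comp (measurable_scaleStrong p.2 hX)
    refine (h0 fun j => ?_).sub ((h0 (by fun_prop)).add (h0 (by fun_prop)))
    simp only [Pi.sub_apply]; fun_prop
  · have hSig : IsUnit D.SigmaF.det := isUnit_iff_ne_zero.2 hf.posDef.det_pos.ne'
    rw [← scaleStrong_lamTP_sub hT (meanF_eq hf) hSig hA hN hH,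
      ← scaleStrong_biasOV hT (meanF_eq hf) hSig hA hN,
      ← scaleStrong_biasA hT (meanF_eq hf) hSig hA hN]

include hm hf hl he hSU in
theorem convInProb_lamTP_strong (a : Fin k₁) : D.ConvInProb (fun N T ω =>
      √(T : ℝ) * (D.lamTP N T ω (Sum.inl a) - D.lam (Sum.inl a))
        - (√(T : ℝ) * (D.lamTilde N T ω (Sum.inl a) - D.lam (Sum.inl a))
          + √(T : ℝ) * D.biasA N T ω (Sum.inl a) + √(T : ℝ) * D.biasOV N T ω (Sum.inl a))) 0 := by
  refine TendsToProb.iff_real.1 ((tendsToProb_lamTP_sub hm hf hl he hSU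
    (Sum.inl a)).congr_eventually (Eventually.of_forall fun p ω => ?_))
  simp only [scaleStrong, Sum.elim_inl, Pi.sub_apply]
  ring

include hm hf hl he hSU in
theorem convInProb_lamTP_weak (b : Fin k₂) : D.ConvInProb (fun N T ω =>
      (D.lamTP N T ω (Sum.inr b) - D.lam (Sum.inr b))
        - (D.biasA N T ω (Sum.inr b) + D.biasOV N T ω (Sum.inr b))) 0 := by
  have h1 : TendsToProb D.PP atTop (fun p ω =>
      D.lamTilde p.1 p.2 ω (Sum.inr b) - D.lam (Sum.inr b)) 0 := by
    have h := tendstoInDistribution_of_rep hm hf hl he hSU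
      (f := fun y => y.2.2.2.2.2 * y.1.1 (Sum.inr b)) (fun x => by fun_prop)
      (Y := fun p ω => D.lamTilde p.1 p.2 ω (Sum.inr b) - D.lam (Sum.inr b))
      (fun p => by fun_prop) (fun p ω _ _ _ _ => congrFun (lamTilde_sub_lam ω) (Sum.inr b))
    simp only [limConst, zero_mul] at h
    exact h.tendsToProb
  have h2 := (tendsToProb_lamTP_sub hm hf hl he hSU (Sum.inr b)).add h1
  rw [add_zero] at h2
  refine TendsToProb.iff_real.1 (h2.congr_eventually (Eventually.of_forall fun p ω => ?_))
  simp only [scaleStrong, Sum.elim_inr, Pi.sub_apply]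
  ring

end WeakLimits

end FactorPanel

/-! ### The standard normal law on ℝ^κ: density and characteristic function. -/

section StdNormal

open Complex

/-- The standard normal law on `ℝ^κ`. -/
noncomputable abbrev stdNormal (κ : Type*) [Fintype κ] : Measure (κ → ℝ) :=
  Measure.pi fun _ => gaussianReal 0 1

variable {κ : Type*} [Fintype κ]

/-- The standard normal density on `ℝ^κ`. -/
noncomputable def stdNormalPDF (x : κ → ℝ) : ℝ :=
  (√(2 * Real.pi))⁻¹ ^ Fintype.card κ * Real.exp (-(x ⬝ᵥ x) / 2)

lemma prod_gaussianPDFReal (x : κ → ℝ) :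
    ∏ i, gaussianPDFReal 0 1 (x i) = stdNormalPDF x := by
  simp only [gaussianPDFReal, stdNormalPDF, NNReal.coe_one, mul_one, sub_zero,
    Finset.prod_mul_distrib, Finset.prod_const, Finset.card_univ, ← Real.exp_sum, dotProduct]
  congr 2
  rw [← Finset.sum_div, Finset.sum_neg_distrib]
  simp [pow_two]

/-- A product measure is determined by its values on boxes, where the integral of the product
density factorizes. -/
lemma stdNormal_eq_withDensity :
    stdNormal κ = volume.withDensity fun x => ENNReal.ofReal (stdNormalPDF x) := by
  refine (Measure.pi_eq fun s hs => ?_)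
  have hprod : ∀ x : κ → ℝ, ENNReal.ofReal (∏ i, (s i).indicator (gaussianPDFReal 0 1) (x i)) =
      (Set.univ.pi s).indicator (fun x => ENNReal.ofReal (stdNormalPDF x)) x := by
    intro x
    by_cases hx : x ∈ Set.univ.pi s
    · rw [Set.indicator_of_mem hx, ← prod_gaussianPDFReal]
      congr 1
      exact Finset.prod_congr rfl fun i _ => Set.indicator_of_mem (hx i trivial) _
    · rw [Set.indicator_of_notMem hx]
      simp only [Set.mem_pi, Set.mem_univ, true_implies, not_forall] at hx
      obtain ⟨i, hi⟩ := hx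
      rw [Finset.prod_eq_zero (Finset.mem_univ i) (Set.indicator_of_notMem hi _),
        ENNReal.ofReal_zero]
  have hint : ∀ i, Integrable ((s i).indicator (gaussianPDFReal 0 1)) :=
    fun i => (integrable_gaussianPDFReal 0 1).indicator (hs i)
  have hnn : ∀ i x, 0 ≤ (s i).indicator (gaussianPDFReal 0 1) x := fun i x =>
    Set.indicator_nonneg (fun _ _ => gaussianPDFReal_nonneg _ _ _) _
  rw [withDensity_apply _ (MeasurableSet.univ_pi hs), ← lintegral_indicator
    (MeasurableSet.univ_pi hs)]
  simp_rw [← hprod]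
  have hI : Integrable fun x : κ → ℝ => ∏ i, (s i).indicator (gaussianPDFReal 0 1) (x i) := by
    rw [volume_pi]; exact Integrable.fintype_prod hint
  rw [← ofReal_integral_eq_lintegral_ofReal hI
    (Eventually.of_forall fun x => Finset.prod_nonneg fun i _ => hnn i _)]
  rw [integral_fintype_prod_volume_eq_prod, ENNReal.ofReal_prod_of_nonneg
    fun i _ => integral_nonneg (hnn i)]
  refine Finset.prod_congr rfl fun i _ => ?_
  rw [integral_indicator (hs i), gaussianReal_apply_eq_integral _ one_ne_zero]

lemma stdNormalPDF_pos (x : κ → ℝ) : 0 < stdNormalPDF x := by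
  unfold stdNormalPDF; positivity

lemma continuous_stdNormalPDF : Continuous (stdNormalPDF (κ := κ)) := by
  unfold stdNormalPDF dotProduct; fun_prop

lemma integral_stdNormal {E : Type*} [NormedAddCommGroup E] [NormedSpace ℝ E] (f : (κ → ℝ) → E) :
    ∫ x, f x ∂(stdNormal κ) = ∫ x, stdNormalPDF x • f x := by
  rw [stdNormal_eq_withDensity, integral_withDensity_eq_integral_toReal_smul
    continuous_stdNormalPDF.measurable.ennreal_ofReal (by simp)]
  simp_rw [ENNReal.toReal_ofReal (stdNormalPDF_pos _).le]

lemma integral_cexp_stdNormal (w : κ → ℝ) :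
    ∫ x, cexp (I * (w ⬝ᵥ x : ℝ)) ∂(stdNormal κ) = cexp (-(w ⬝ᵥ w : ℝ) / 2) := by
  have h : ∀ x : κ → ℝ, cexp (I * (w ⬝ᵥ x : ℝ)) = ∏ i, cexp (w i * x i * I) := by
    intro x
    rw [← Complex.exp_sum, dotProduct, Complex.ofReal_sum, Finset.mul_sum]
    congr 1
    exact Finset.sum_congr rfl fun i _ => by push_cast; ring
  simp_rw [h]
  rw [integral_fintype_prod_eq_prod (f := fun i (y : ℝ) => cexp (w i * y * I))]
  have h1 : ∀ i, ∫ y, cexp (w i * y * I) ∂(gaussianReal 0 1) = cexp (-(w i * w i : ℝ) / 2) := by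
    intro i
    have := charFun_gaussianReal (μ := 0) (v := 1) (w i)
    rw [charFun_apply_real] at this
    rw [this]
    congr 1
    push_cast
    ring
  simp_rw [h1, ← Complex.exp_sum]
  congr 1
  rw [dotProduct, Complex.ofReal_sum, ← Finset.sum_div, Finset.sum_neg_distrib]

instance isOpenPosMeasure_gaussianReal : (gaussianReal 0 1).IsOpenPosMeasure :=
  (gaussianReal_absolutelyContinuous' 0 one_ne_zero).isOpenPosMeasure

end StdNormal

/-! ### Centered normal laws through their characteristic functions. -/

section CenteredNormal

open Complex

variable {ι : Type*} [Fintype ι] {m : Measure (ι → ℝ)} {S : Matrix ι ι ℝ}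

lemma measurable_dotProduct_left (w : ι → ℝ) : Measurable fun x : ι → ℝ => w ⬝ᵥ x := by
  unfold dotProduct; fun_prop

lemma IsCenteredNormal.isProbabilityMeasure (h : IsCenteredNormal m S) :
    IsProbabilityMeasure m := by
  have h1 := h.2 0
  refine ⟨?_⟩
  rw [← Set.preimage_univ (f := fun x : ι → ℝ => (0 : ι → ℝ) ⬝ᵥ x),
    ← Measure.map_apply (measurable_dotProduct_left _) MeasurableSet.univ, h1, measure_univ]

lemma IsCenteredNormal.integral_cexp (h : IsCenteredNormal m S) (w : ι → ℝ) :
    ∫ x, cexp (I * (w ⬝ᵥ x : ℝ)) ∂m = cexp (-(w ⬝ᵥ S *ᵥ w : ℝ) / 2) := by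
  have h1 : ∫ y, cexp (I * (y : ℝ)) ∂(m.map fun x => w ⬝ᵥ x) =
      ∫ x, cexp (I * (w ⬝ᵥ x : ℝ)) ∂m :=
    integral_map (measurable_dotProduct_left w).aemeasurable
      (by fun_prop : Continuous fun y : ℝ => cexp (I * (y : ℝ))).aestronglyMeasurable
  have h2 := charFun_gaussianReal (μ := 0) (v := (w ⬝ᵥ S *ᵥ w).toNNReal) 1
  have hnn : 0 ≤ w ⬝ᵥ S *ᵥ w := by simpa using h.1.dotProduct_mulVec_nonneg w
  rw [charFun_apply_real] at h2
  rw [← h1, h.2 w]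
  have h3 : ∀ y : ℝ, cexp (I * (y : ℝ)) = cexp ((1 : ℝ) * y * I) := fun y => by
    push_cast; ring_nf
  simp_rw [h3, h2, Real.coe_toNNReal _ hnn]
  congr 1
  push_cast
  ring

/-- The formula at the multiples t • w gives the whole characteristic function of the projection
along w. -/
lemma isCenteredNormal_of_integral_cexp [IsFiniteMeasure m] (hS : S.PosSemidef)
    (h : ∀ w : ι → ℝ, ∫ x, cexp (I * (w ⬝ᵥ x : ℝ)) ∂m = cexp (-(w ⬝ᵥ S *ᵥ w : ℝ) / 2)) :
    IsCenteredNormal m S := by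
  refine ⟨hS, fun w => ?_⟩
  have hnn : 0 ≤ w ⬝ᵥ S *ᵥ w := by simpa using hS.dotProduct_mulVec_nonneg w
  refine Measure.ext_of_charFun (funext fun t => ?_)
  rw [charFun_apply_real, charFun_gaussianReal, integral_map
    (measurable_dotProduct_left w).aemeasurable (by fun_prop)]
  have h1 := h (t • w)
  have h3 : ∀ x, cexp (I * ((t • w) ⬝ᵥ x : ℝ)) = cexp (t * (w ⬝ᵥ x : ℝ) * I) := fun x => by
    rw [smul_dotProduct, smul_eq_mul]; push_cast; ring_nf
  simp_rw [h3] at h1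
  rw [h1, Real.coe_toNNReal _ hnn, mulVec_smul, dotProduct_smul, smul_dotProduct]
  congr 1
  simp only [smul_eq_mul]
  push_cast
  ring

lemma IsCenteredNormal.ext {m' : Measure (ι → ℝ)} (h : IsCenteredNormal m S)
    (h' : IsCenteredNormal m' S) : m = m' := by
  classical
  have := h.isProbabilityMeasure
  have := h'.isProbabilityMeasure
  refine Measure.ext_of_charFunDual (funext fun L => ?_)
  have hL : ∀ x, L x = (fun i => L (Pi.single i 1)) ⬝ᵥ x := by
    intro x
    conv_lhs => rw [pi_eq_sum_univ' x]
    simp [dotProduct, mul_comm]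
  rw [charFunDual_apply, charFunDual_apply]
  have h3 : ∀ x, cexp (L x * I) = cexp (I * ((fun i => L (Pi.single i 1)) ⬝ᵥ x : ℝ)) := fun x => by
    rw [← hL, mul_comm]
  simp_rw [h3, h.integral_cexp, h'.integral_cexp]

lemma IsCenteredNormal.isGaussian (h : IsCenteredNormal m S) : IsGaussian m := by
  classical
  refine isGaussian_of_map_eq_gaussianReal fun L => ?_
  set w : ι → ℝ := fun i => L (Pi.single i 1) with hw
  refine ⟨0, (w ⬝ᵥ S *ᵥ w).toNNReal, ?_⟩
  have hL : ⇑L = fun x => w ⬝ᵥ x := by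
    ext x
    conv_lhs => rw [pi_eq_sum_univ' x]
    simp [hw, dotProduct, mul_comm]
  rw [hL]
  exact h.2 _

lemma isCenteredNormal_stdNormal [DecidableEq ι] : IsCenteredNormal (stdNormal ι) 1 :=
  isCenteredNormal_of_integral_cexp Matrix.PosSemidef.one fun w => by
    rw [integral_cexp_stdNormal, Matrix.one_mulVec]

lemma IsCenteredNormal.map_mulVec {κ : Type*} [Fintype κ] (h : IsCenteredNormal m S)
    (A : Matrix κ ι ℝ) : IsCenteredNormal (m.map fun x => A *ᵥ x) (A * S * Aᵀ) := by
  have := h.isProbabilityMeasure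
  have hA : Continuous fun x : ι → ℝ => A *ᵥ x :=
    Continuous.matrix_mulVec continuous_const continuous_id
  refine isCenteredNormal_of_integral_cexp ?_ fun w => ?_
  · have := h.1.mul_mul_conjTranspose_same A
    rwa [Matrix.conjTranspose_eq_transpose_of_trivial] at this
  · rw [integral_map hA.measurable.aemeasurable (Continuous.aestronglyMeasurable
      (by unfold dotProduct; fun_prop))]
    have hw : ∀ x : ι → ℝ, w ⬝ᵥ A *ᵥ x = (w ᵥ* A) ⬝ᵥ x := fun x => Matrix.dotProduct_mulVec _ _ _
    simp_rw [hw]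
    rw [h.integral_cexp]
    congr 3
    rw [← Matrix.mulVec_mulVec, ← Matrix.mulVec_mulVec, Matrix.mulVec_transpose, hw]

lemma IsCenteredNormal.integrable_one_add_norm_pow (h : IsCenteredNormal m S) (n : ℕ) :
    Integrable (fun x => (1 + ‖x‖) ^ n) m := by
  have := h.isGaussian
  have h0 : MemLp (fun x : ι → ℝ => ‖x‖) n m := (IsGaussian.memLp_id m n (by simp)).norm
  have h1 : MemLp (fun x : ι → ℝ => 1 + ‖x‖) n m := (memLp_const (1 : ℝ)).add h0
  rcases Nat.eq_zero_or_pos n with rfl | hn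
  · simp
  refine (h1.integrable_norm_pow hn.ne').congr (Eventually.of_forall fun x => ?_)
  simp only [Real.norm_of_nonneg (by positivity : 0 ≤ 1 + ‖x‖)]

end CenteredNormal

/-! ### Polynomial decay of characteristic functions of conditionally normal products. -/

section CharFunAsymptotics

open Complex

variable {κ : Type*} [Fintype κ]

lemma integral_cexp_mul_exp_neg (m : κ → ℝ) :
    ∫ y : κ → ℝ, cexp (I * (y ⬝ᵥ m : ℝ) - (y ⬝ᵥ y : ℝ) / 2) =
      ((√(2 * Real.pi)) ^ Fintype.card κ * Real.exp (-(m ⬝ᵥ m) / 2) : ℝ) := by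
  have h := integral_cexp_stdNormal m
  rw [integral_stdNormal] at h
  have h0 : (√(2 * Real.pi)) ^ Fintype.card κ ≠ 0 :=
    pow_ne_zero _ (Real.sqrt_pos.2 (by positivity)).ne'
  have h1 : ∀ y : κ → ℝ, cexp (I * (y ⬝ᵥ m : ℝ) - (y ⬝ᵥ y : ℝ) / 2) =
      ((√(2 * Real.pi)) ^ Fintype.card κ : ℝ) * (stdNormalPDF y • cexp (I * (m ⬝ᵥ y : ℝ))) := by
    intro y
    rw [stdNormalPDF, Complex.real_smul, ← mul_assoc, ← Complex.ofReal_mul, ← mul_assoc, inv_pow,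
      mul_inv_cancel₀ h0, one_mul, sub_eq_add_neg, Complex.exp_add, mul_comm, dotProduct_comm m]
    push_cast
    ring_nf
  simp_rw [h1]
  rw [integral_const_mul, h]
  push_cast
  ring_nf

lemma integral_cexp_mulVec [DecidableEq κ] {M : Matrix κ κ ℝ} (hM : M.det ≠ 0) (m : κ → ℝ) :
    ∫ h : κ → ℝ, cexp (I * ((M *ᵥ h) ⬝ᵥ m : ℝ) - ((M *ᵥ h) ⬝ᵥ (M *ᵥ h) : ℝ) / 2) =
      (|M.det⁻¹| * ((√(2 * Real.pi)) ^ Fintype.card κ * Real.exp (-(m ⬝ᵥ m) / 2)) : ℝ) := by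
  have h1 := Real.map_matrix_volume_pi_eq_smul_volume_pi hM
  have hc : Continuous fun y : κ → ℝ => cexp (I * (y ⬝ᵥ m : ℝ) - (y ⬝ᵥ y : ℝ) / 2) := by
    unfold dotProduct; fun_prop
  have h2 : ∫ y, cexp (I * (y ⬝ᵥ m : ℝ) - (y ⬝ᵥ y : ℝ) / 2)
      ∂((volume : Measure (κ → ℝ)).map (Matrix.toLin' M)) =
      ∫ h : κ → ℝ, cexp (I * ((M *ᵥ h) ⬝ᵥ m : ℝ) - ((M *ᵥ h) ⬝ᵥ (M *ᵥ h) : ℝ) / 2) := by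
    rw [integral_map (by
      exact (LinearMap.continuous_of_finiteDimensional _).aemeasurable) hc.aestronglyMeasurable]
    simp only [Matrix.toLin'_apply]
  rw [← h2, h1, integral_smul_measure, integral_cexp_mul_exp_neg, ENNReal.toReal_ofReal
    (abs_nonneg _), Complex.real_smul, ← Complex.ofReal_mul]

variable {X : Type*}

/-- The integrand of a characteristic function of a product that is conditionally normal. -/
noncomputable def condNormalIntegrand (p : X × (κ → ℝ) → ℝ) (R : X × (κ → ℝ) → Matrix κ κ ℝ)
    (m : X × (κ → ℝ) → κ → ℝ) (z : X × (κ → ℝ)) (h : κ → ℝ) : ℂ :=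
  p z * cexp (I * ((R z *ᵥ h) ⬝ᵥ m z : ℝ) - ((R z *ᵥ h) ⬝ᵥ (R z *ᵥ h) : ℝ) / 2)

variable {p : X × (κ → ℝ) → ℝ} {R : X × (κ → ℝ) → Matrix κ κ ℝ} {m : X × (κ → ℝ) → κ → ℝ}

lemma norm_condNormalIntegrand {z : X × (κ → ℝ)} (hp0 : 0 ≤ p z) (h : κ → ℝ) :
    ‖condNormalIntegrand p R m z h‖ =
      p z * Real.exp (-((R z *ᵥ h) ⬝ᵥ (R z *ᵥ h)) / 2) := by
  rw [condNormalIntegrand, norm_mul, Complex.norm_exp, Complex.norm_real, Real.norm_of_nonneg hp0]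
  congr 2
  have h1 : ((((R z *ᵥ h) ⬝ᵥ (R z *ᵥ h) : ℝ) : ℂ) / 2) =
    (((R z *ᵥ h) ⬝ᵥ (R z *ᵥ h) / 2 : ℝ) : ℂ) := by push_cast; rfl
  rw [h1, Complex.sub_re, Complex.ofReal_re, Complex.mul_re]
  simp
  ring

variable [TopologicalSpace X] (hp : Continuous p) (hR : Continuous R) (hm : Continuous m)

include hp hR hm in
lemma continuous_condNormalIntegrand : Continuous fun y : (X × (κ → ℝ)) × (κ → ℝ) =>
    condNormalIntegrand p R m y.1 y.2 := by
  have h1 : Continuous fun y : (X × (κ → ℝ)) × (κ → ℝ) => R y.1 *ᵥ y.2 :=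
    (hR.comp continuous_fst).matrix_mulVec continuous_snd
  have h2 := (h1.dotProduct (hm.comp continuous_fst))
  have h3 := h1.dotProduct h1
  unfold condNormalIntegrand
  simp only [Function.comp_def] at h2
  fun_prop

variable [MeasurableSpace X] [OpensMeasurableSpace X] {ρ : Measure X} (hp0 : ∀ z, 0 < p z) {G : X → ℝ} (hG : Integrable G ρ)
  (hbound : ∀ z h, p z * Real.exp (-((R z *ᵥ h) ⬝ᵥ (R z *ᵥ h)) / 2) ≤
    G z.1 * (1 + ‖h‖) ^ (-((Fintype.card κ : ℝ) + 1)))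

include hp hR hm hp0 hG hbound in
lemma integrable_condNormalIntegrand {f : X × (κ → ℝ) → X × (κ → ℝ)} (hf : Continuous f)
    (hf1 : ∀ y, (f y).1 = y.1) :
    Integrable (fun y : X × (κ → ℝ) => condNormalIntegrand p R m (f y) y.2)
      (ρ.prod volume) := by
  have hI : Integrable (fun y : X × (κ → ℝ) =>
      G y.1 * (1 + ‖y.2‖) ^ (-((Fintype.card κ : ℝ) + 1))) (ρ.prod volume) :=
    hG.mul_prod (integrable_one_add_norm (by simp))
  refine hI.mono' ((continuous_condNormalIntegrand hp hR hm).comp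
    (hf.prodMk continuous_snd)).aestronglyMeasurable (Eventually.of_forall fun y => ?_)
  rw [norm_condNormalIntegrand (hp0 _).le, ← hf1 y]
  exact hbound _ _

include hp hR hm hp0 hG hbound in
-- The substitution h = s • u absorbs the factor s^k and evaluates the coefficients at h/s, which
-- tends to 0; the bound `hbound`, uniform in the point, allows dominated convergence.
lemma tendsto_integral_condNormalIntegrand [SFinite ρ] :
    Tendsto (fun s : ℝ => ((s ^ Fintype.card κ : ℝ) : ℂ) *
        ∫ x, (∫ u, condNormalIntegrand p R m (x, u) (s • u)) ∂ρ) atTop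
      (𝓝 (∫ x, (∫ h, condNormalIntegrand p R m (x, 0) h) ∂ρ)) := by
  have hI : Integrable (fun y : X × (κ → ℝ) =>
      G y.1 * (1 + ‖y.2‖) ^ (-((Fintype.card κ : ℝ) + 1))) (ρ.prod volume) :=
    hG.mul_prod (integrable_one_add_norm (by simp))
  have hc := continuous_condNormalIntegrand hp hR hm
  have h1 : Tendsto (fun s : ℝ => ∫ y : X × (κ → ℝ),
      condNormalIntegrand p R m (y.1, s⁻¹ • y.2) y.2 ∂(ρ.prod volume)) atTop
      (𝓝 (∫ y : X × (κ → ℝ), condNormalIntegrand p R m (y.1, 0) y.2 ∂(ρ.prod volume))) := by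
    refine tendsto_integral_filter_of_dominated_convergence _
      (Eventually.of_forall fun s => Continuous.aestronglyMeasurable (by fun_prop))
      (Eventually.of_forall fun s => Eventually.of_forall fun y => ?_) hI
      (Eventually.of_forall fun y => ?_)
    · rw [norm_condNormalIntegrand (hp0 _).le]
      exact hbound _ _
    · have h2 : Tendsto (fun s : ℝ => ((y.1, s⁻¹ • y.2), y.2)) atTop (𝓝 ((y.1, 0), y.2)) := by
        refine (tendsto_const_nhds.prodMk_nhds ?_).prodMk_nhds tendsto_const_nhds
        have h4 := (tendsto_inv_atTop_zero (𝕜 := ℝ)).smul_const y.2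
        rwa [zero_smul] at h4
      exact (hc.tendsto _).comp h2
  rw [integral_prod _ (integrable_condNormalIntegrand hp hR hm hp0 hG hbound
    (f := fun y => (y.1, 0)) (by fun_prop) fun _ => rfl)] at h1
  refine h1.congr' ?_
  filter_upwards [eventually_gt_atTop 0] with s hs
  rw [integral_prod _ (integrable_condNormalIntegrand hp hR hm hp0 hG hbound
    (f := fun y => (y.1, s⁻¹ • y.2)) (by fun_prop) fun _ => rfl), ← integral_const_mul]
  congr 1
  ext x
  have h3 := Measure.integral_comp_smul (volume : Measure (κ → ℝ))
    (fun h => condNormalIntegrand p R m (x, s⁻¹ • h) h) s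
  simp only [smul_smul, inv_mul_cancel₀ hs.ne', one_smul] at h3
  have hsk : (s ^ Fintype.card κ) ≠ 0 := pow_ne_zero _ hs.ne'
  rw [h3, Module.finrank_fintype_fun_eq_card, abs_of_nonneg (by positivity), Complex.real_smul,
    ← mul_assoc, ← Complex.ofReal_mul, mul_inv_cancel₀ hsk, Complex.ofReal_one, one_mul]

include hp hR hm hp0 hG hbound in
-- At u = 0 the inner integral is the Fourier transform of a Gaussian, hence real and positive,
-- despite the oscillating factor; so the limit is not zero.
lemma exists_integral_condNormalIntegrand_eq [NeZero ρ] [DecidableEq κ] (hR0 : ∀ x, (R (x, 0)).det ≠ 0) :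
    ∃ c : ℝ, 0 < c ∧ ∫ x, (∫ h, condNormalIntegrand p R m (x, 0) h) ∂ρ = c := by
  set g : X → ℝ := fun x => p (x, 0) * (|(R (x, 0)).det⁻¹| *
    ((√(2 * Real.pi)) ^ Fintype.card κ * Real.exp (-(m (x, 0) ⬝ᵥ m (x, 0)) / 2))) with hg
  have hg0 : ∀ x, 0 < g x := fun x => by
    have := hp0 (x, 0)
    have h2 : 0 < |(R (x, 0)).det⁻¹| := abs_pos.2 (inv_ne_zero (hR0 x))
    positivity
  have h1 : ∀ x, ∫ h, condNormalIntegrand p R m (x, 0) h = (g x : ℂ) := by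
    intro x
    simp only [condNormalIntegrand]
    rw [integral_const_mul, integral_cexp_mulVec (hR0 x), ← Complex.ofReal_mul]
  have h2 := (integrable_condNormalIntegrand hp hR hm hp0 hG hbound
    (f := fun y => (y.1, 0)) (by fun_prop) fun _ => rfl).integral_prod_left
  simp only [h1] at h2
  have h3 : Integrable g ρ := by simpa using h2.re
  refine ⟨∫ x, g x ∂ρ, ?_, ?_⟩
  · rw [integral_pos_iff_support_of_nonneg (fun x => (hg0 x).le) h3]
    have : Function.support g = Set.univ := by
      ext x; simp [(hg0 x).ne']
    simp [this, NeZero.ne ρ]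
  · simp_rw [h1]
    exact integral_ofReal

/-- A law on the line whose characteristic function decays polynomially is not normal. -/
lemma not_isGaussian_of_tendsto {μ : Measure ℝ} {k : ℕ} (hk : k ≠ 0) {c : ℂ} (hc : c ≠ 0)
    (h : Tendsto (fun s : ℝ => ((s ^ k : ℝ) : ℂ) * charFun μ s) atTop (𝓝 c)) :
    ¬ IsGaussian μ := by
  intro hμ
  have h1 := h.norm
  rw [hμ.eq_gaussianReal] at h1
  set v := (Var[id; μ]).toNNReal
  have h2 : ∀ s : ℝ, 0 < s → ‖((s ^ k : ℝ) : ℂ) * charFun (gaussianReal (μ[id]) v) s‖ =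
      s ^ k * Real.exp (-(v / 2 * s ^ 2)) := by
    intro s hs
    rw [norm_mul, Complex.norm_real, Real.norm_of_nonneg (by positivity), charFun_gaussianReal,
      Complex.norm_exp]
    congr 2
    have h3 : ((v : ℝ) : ℂ) * (s : ℂ) ^ 2 / 2 = ((v / 2 * s ^ 2 : ℝ) : ℂ) := by push_cast; ring
    have h4 : (s : ℂ) * ((μ[id] : ℝ) : ℂ) * I = ((s * μ[id] : ℝ) : ℂ) * I := by push_cast; ring
    rw [Complex.sub_re, h3, h4, Complex.ofReal_re, Complex.re_ofReal_mul]
    simp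
  have h3 : Tendsto (fun s : ℝ => s ^ k * Real.exp (-(v / 2 * s ^ 2))) atTop (𝓝 ‖c‖) := by
    refine h1.congr' ?_
    filter_upwards [eventually_gt_atTop 0] with s hs using h2 s hs
  -- A point mass has a characteristic function of modulus one, so s^k times it diverges; for
  -- positive variance the Gaussian factor sends the product to zero. Neither agrees with the
  -- nonzero limit c.
  rcases eq_or_ne v 0 with hv | hv
  · simp only [hv, NNReal.coe_zero, zero_div, zero_mul, neg_zero, Real.exp_zero, mul_one] at h3
    exact not_tendsto_nhds_of_tendsto_atTop (tendsto_pow_atTop hk) _ h3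
  · have hv' : (0 : ℝ) < v / 2 := by positivity
    have h4 : Tendsto (fun s : ℝ => s ^ k * Real.exp (-(v / 2 * s ^ 2))) atTop (𝓝 0) := by
      have := (rpow_mul_exp_neg_mul_sq_isLittleO_exp_neg hv' (k : ℝ)).trans_tendsto
        (Real.tendsto_exp_atBot.comp (tendsto_id.const_mul_atTop_of_neg (by norm_num : (-(1/2) : ℝ) < 0)))
      simpa using this
    exact hc (norm_eq_zero.1 (tendsto_nhds_unique h3 h4))

end CharFunAsymptotics

/-! ### Non-normality of a conditionally normal product. -/

section ConditionallyNormalProduct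

open Complex

variable {ι κ : Type*} [Fintype ι] [Fintype κ]

lemma norm_sq_le_dotProduct (g : κ → ℝ) : ‖g‖ ^ 2 ≤ g ⬝ᵥ g := by
  have h0 : 0 ≤ g ⬝ᵥ g := dotProduct_self_nonneg_real g
  have h1 : ‖g‖ ≤ √(g ⬝ᵥ g) := by
    refine (pi_norm_le_iff_of_nonneg (Real.sqrt_nonneg _)).2 fun i => ?_
    rw [Real.norm_eq_abs]
    refine Real.abs_le_sqrt ?_
    rw [dotProduct, pow_two]
    exact Finset.single_le_sum (f := fun i => g i * g i) (fun j _ => mul_self_nonneg _)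
      (Finset.mem_univ i)
  calc ‖g‖ ^ 2 ≤ √(g ⬝ᵥ g) ^ 2 := by gcongr
    _ = _ := Real.sq_sqrt h0

lemma exists_norm_mulVec_le {m n : Type*} [Fintype m] [Fintype n] (M : Matrix m n ℝ) :
    ∃ C : ℝ, 0 ≤ C ∧ ∀ v : n → ℝ, ‖M *ᵥ v‖ ≤ C * ‖v‖ := by
  classical
  refine ⟨‖(Matrix.toLin' M).toContinuousLinearMap‖, norm_nonneg _, fun v => ?_⟩
  exact (Matrix.toLin' M).toContinuousLinearMap.le_opNorm v

lemma exists_one_add_pow_mul_exp_le (n : ℕ) :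
    ∃ C : ℝ, 0 < C ∧ ∀ r : ℝ, 0 ≤ r → (1 + r) ^ n * Real.exp (-r ^ 2 / 2) ≤ C := by
  -- From (1 + r)^n ≤ n! e^{1+r} and 1 + r - r²/2 ≤ 3/2.
  refine ⟨n.factorial * Real.exp (3 / 2), by positivity, fun r hr => ?_⟩
  have h1 := Real.pow_div_factorial_le_exp (1 + r) (by positivity) n
  rw [div_le_iff₀ (by positivity)] at h1
  calc (1 + r) ^ n * Real.exp (-r ^ 2 / 2)
      ≤ (Real.exp (1 + r) * n.factorial) * Real.exp (-r ^ 2 / 2) := by gcongr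
    _ = n.factorial * Real.exp (1 + r - r ^ 2 / 2) := by
        rw [mul_right_comm, ← Real.exp_add]; ring_nf
    _ ≤ _ := by
        gcongr
        nlinarith [sq_nonneg (r - 1)]

lemma integral_stdNormal_comp_affine [DecidableEq κ] {A : Matrix κ κ ℝ} (hA : A.det ≠ 0)
    (a : κ → ℝ) {f : (κ → ℝ) → ℂ} (hf : Continuous f) :
    ∫ g, f g ∂(stdNormal κ) = ∫ u, ((|A.det|⁻¹ * stdNormalPDF (A⁻¹ *ᵥ (u - a)) : ℝ) : ℂ) *
      f (A⁻¹ *ᵥ (u - a)) := by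
  have hB : (A⁻¹).det ≠ 0 := by
    rw [Matrix.det_nonsing_inv, Ring.inverse_eq_inv']; exact inv_ne_zero hA
  have h1 := Real.map_matrix_volume_pi_eq_smul_volume_pi hB
  have hc : Continuous fun g : κ → ℝ => (stdNormalPDF g : ℂ) * f g :=
    (Complex.continuous_ofReal.comp continuous_stdNormalPDF).mul hf
  have h2 : ∫ g, (stdNormalPDF g : ℂ) * f g ∂((volume : Measure (κ → ℝ)).map (Matrix.toLin' A⁻¹)) =
      ∫ u : κ → ℝ, (stdNormalPDF (A⁻¹ *ᵥ u) : ℂ) * f (A⁻¹ *ᵥ u) := by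
    rw [integral_map (by
      exact (LinearMap.continuous_of_finiteDimensional _).aemeasurable) hc.aestronglyMeasurable]
    simp only [Matrix.toLin'_apply]
  rw [h1, integral_smul_measure, ENNReal.toReal_ofReal (abs_nonneg _), Matrix.det_nonsing_inv,
    Ring.inverse_eq_inv', inv_inv] at h2
  have hA' : |A.det| ≠ 0 := abs_ne_zero.2 hA
  simp_rw [Complex.ofReal_mul, mul_assoc, integral_const_mul]
  rw [integral_stdNormal, integral_sub_right_eq_self
    (fun u => (stdNormalPDF (A⁻¹ *ᵥ u) : ℂ) * f (A⁻¹ *ᵥ u)) a, ← h2, Complex.real_smul, ← mul_assoc,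
    ← Complex.ofReal_mul, inv_mul_cancel₀ hA', Complex.ofReal_one, one_mul]
  simp only [Complex.real_smul]

variable {a : (ι → ℝ) → κ → ℝ} {Q : (ι → ℝ) × (κ → ℝ) → Matrix κ κ ℝ}
  {m : (ι → ℝ) × (κ → ℝ) → κ → ℝ} {A L : Matrix κ κ ℝ}

/-- A product `Q⁻¹(a + A g₂) ⬝ (m + L g₃)`, with `a`, `Q`, `m` functions of normal vectors `g₁`,
`g₂` independent of `g₃`, is not normal: conditionally on `(g₁, g₂)` it is normal, with a variance
that comes close to zero with a probability that decays only polynomially. -/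
theorem not_isGaussian_map_dotProduct [DecidableEq κ] [Nonempty κ] (ha : Continuous a)
    (hQ : Continuous Q) (hQdet : ∀ z, (Q z).det ≠ 0)
    (hQbound : ∃ C : ℝ, 0 ≤ C ∧ ∀ x g v,
      ‖Q (x, g) *ᵥ v‖ ≤ C * (1 + ‖x‖) ^ 2 * (1 + ‖g‖) ^ 2 * ‖v‖)
    (hm : Continuous m) (hA : A.det ≠ 0) (hL : L.det ≠ 0) :
    ¬ IsGaussian (((stdNormal ι).prod ((stdNormal κ).prod (stdNormal κ))).map fun z =>
      ((Q (z.1, z.2.1))⁻¹ *ᵥ (a z.1 + A *ᵥ z.2.1)) ⬝ᵥ (m (z.1, z.2.1) + L *ᵥ z.2.2)) := by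
  set k := Fintype.card κ with hk
  have hAu : IsUnit A.det := isUnit_iff_ne_zero.2 hA
  have hLu : IsUnit L.det := isUnit_iff_ne_zero.2 hL
  have hLTu : IsUnit (Lᵀ).det := by rwa [Matrix.det_transpose]
  have hQinv : Continuous fun z => (Q z)⁻¹ := continuous_iff_continuousAt.2 fun z =>
    hQ.continuousAt.nonsing_inv (hQdet z)
  have hcov : Continuous fun y : (ι → ℝ) × (κ → ℝ) => (y.1, A⁻¹ *ᵥ (y.2 - a y.1)) := by
    refine continuous_fst.prodMk (continuous_const.matrix_mulVec ?_)
    fun_prop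
  -- Change variables from g₂ to u = a(x) + A g₂, so that the conditional variance vanishes at u =
  -- 0. Then p is the density of u given x. R and m' are chosen so that the characteristic function
  -- at s, conditional on (x, u), times p, is the integrand at h = s • u: R h is s Lᵀ Q⁻¹ u, and L⁻¹
  -- in m' undoes the factor Lᵀ.
  set p : (ι → ℝ) × (κ → ℝ) → ℝ := fun y => |A.det|⁻¹ * stdNormalPDF (A⁻¹ *ᵥ (y.2 - a y.1)) with hp
  set R : (ι → ℝ) × (κ → ℝ) → Matrix κ κ ℝ := fun y =>
    Lᵀ * (Q (y.1, A⁻¹ *ᵥ (y.2 - a y.1)))⁻¹ with hR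
  set m' : (ι → ℝ) × (κ → ℝ) → κ → ℝ := fun y => L⁻¹ *ᵥ m (y.1, A⁻¹ *ᵥ (y.2 - a y.1)) with hm'
  have hpc : Continuous p :=
    continuous_const.mul (continuous_stdNormalPDF.comp (continuous_snd.comp hcov))
  have hp0 : ∀ y, 0 < p y := fun y =>
    mul_pos (inv_pos.2 (abs_pos.2 hA)) (stdNormalPDF_pos _)
  have hRc : Continuous R := continuous_const.matrix_mul (hQinv.comp hcov)
  have hm'c : Continuous m' := continuous_const.matrix_mulVec (hm.comp hcov)
  have hR0 : ∀ x, (R (x, 0)).det ≠ 0 := fun x => by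
    rw [hR, Matrix.det_mul, Matrix.det_transpose, Matrix.det_nonsing_inv, Ring.inverse_eq_inv']
    exact mul_ne_zero hL (inv_ne_zero (hQdet _))
  obtain ⟨CQ, hCQ0, hCQ⟩ := hQbound
  obtain ⟨CL, hCL0, hCL⟩ := exists_norm_mulVec_le (Lᵀ)⁻¹
  obtain ⟨Cg, hCg0, hCg⟩ := exists_one_add_pow_mul_exp_le (2 * (k + 1))
  obtain ⟨Ct, hCt0, hCt⟩ := exists_one_add_pow_mul_exp_le (k + 1)
  set c0 : ℝ := |A.det|⁻¹ * (√(2 * Real.pi))⁻¹ ^ k with hc0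
  have hc0pos : 0 ≤ c0 := by positivity
  set G : (ι → ℝ) → ℝ := fun x =>
    c0 * (1 + CQ * CL) ^ (k + 1) * Cg * Ct * (1 + ‖x‖) ^ (2 * (k + 1)) with hG
  have hGint : Integrable G (stdNormal ι) := by
    classical
    exact (isCenteredNormal_stdNormal.integrable_one_add_norm_pow _).const_mul _
  have hbound : ∀ z h, p z * Real.exp (-((R z *ᵥ h) ⬝ᵥ (R z *ᵥ h)) / 2) ≤
      G z.1 * (1 + ‖h‖) ^ (-((k : ℝ) + 1)) := by
    intro z h
    set g := A⁻¹ *ᵥ (z.2 - a z.1) with hg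
    set t := R z *ᵥ h with ht
    -- Recovering h from t = R h costs a factor of polynomial size in x and g. Hence a power of 1 +
    -- |h| is bounded by powers of 1 + |x|, 1 + |g| and 1 + |t|; the Gaussian factors in g and t
    -- absorb the last two, and the first goes into G, which is integrable against the normal law of
    -- x.
    have hht : h = Q (z.1, g) *ᵥ ((Lᵀ)⁻¹ *ᵥ t) := by
      have hRz : R z = Lᵀ * (Q (z.1, g))⁻¹ := rfl
      rw [ht, hRz, Matrix.mulVec_mulVec, Matrix.mulVec_mulVec]
      have : (Lᵀ)⁻¹ * (Lᵀ * (Q (z.1, g))⁻¹) = (Q (z.1, g))⁻¹ := by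
        rw [← Matrix.mul_assoc, Matrix.nonsing_inv_mul _ hLTu, Matrix.one_mul]
      rw [Matrix.mul_assoc, this, Matrix.mul_nonsing_inv _ (isUnit_iff_ne_zero.2 (hQdet _)),
        Matrix.one_mulVec]
    have h1 : 1 + ‖h‖ ≤ (1 + CQ * CL) * (1 + ‖z.1‖) ^ 2 * (1 + ‖g‖) ^ 2 * (1 + ‖t‖) := by
      have h2 : ‖h‖ ≤ CQ * (1 + ‖z.1‖) ^ 2 * (1 + ‖g‖) ^ 2 * (CL * ‖t‖) := by
        conv_lhs => rw [hht]
        exact (hCQ _ _ _).trans (by gcongr; exact hCL t)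
      have h3 : 1 ≤ (1 + ‖z.1‖) ^ 2 * (1 + ‖g‖) ^ 2 :=
        one_le_mul_of_one_le_of_one_le (one_le_pow₀ (by simp)) (one_le_pow₀ (by simp))
      have h4 : 0 ≤ CQ * CL := by positivity
      have h5 := norm_nonneg t
      set w := (1 + ‖z.1‖) ^ 2 * (1 + ‖g‖) ^ 2
      have h6 : ‖h‖ ≤ CQ * CL * (w * ‖t‖) := h2.trans (le_of_eq (by ring))
      have h7 : (1 + CQ * CL) * (1 + ‖z.1‖) ^ 2 * (1 + ‖g‖) ^ 2 * (1 + ‖t‖) =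
        w + CQ * CL * w + w * ‖t‖ + CQ * CL * (w * ‖t‖) := by ring
      rw [h7]
      have h8 : 0 ≤ CQ * CL * w := by positivity
      have h9 : 0 ≤ w * ‖t‖ := by positivity
      linarith
    have h2 : p z = c0 * Real.exp (-(g ⬝ᵥ g) / 2) := by
      have h20 : p z = |A.det|⁻¹ * stdNormalPDF g := rfl
      rw [h20, hc0, stdNormalPDF, ← mul_assoc]
    have h3 : Real.exp (-(g ⬝ᵥ g) / 2) ≤ Real.exp (-‖g‖ ^ 2 / 2) :=
      Real.exp_le_exp.2 (by linarith [norm_sq_le_dotProduct g])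
    have h4 : Real.exp (-(t ⬝ᵥ t) / 2) ≤ Real.exp (-‖t‖ ^ 2 / 2) :=
      Real.exp_le_exp.2 (by linarith [norm_sq_le_dotProduct t])
    have h5 : (1 + ‖h‖) ^ (-((k : ℝ) + 1)) = ((1 + ‖h‖) ^ (k + 1))⁻¹ := by
      rw [Real.rpow_neg (by positivity), ← Real.rpow_natCast]
      push_cast; rfl
    have h6 : 0 < (1 + ‖h‖) ^ (k + 1) := by positivity
    rw [h5, ← div_eq_mul_inv, le_div_iff₀ h6, h2]
    calc c0 * Real.exp (-(g ⬝ᵥ g) / 2) * Real.exp (-(t ⬝ᵥ t) / 2) * (1 + ‖h‖) ^ (k + 1)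
        ≤ c0 * Real.exp (-‖g‖ ^ 2 / 2) * Real.exp (-‖t‖ ^ 2 / 2) *
          ((1 + CQ * CL) * (1 + ‖z.1‖) ^ 2 * (1 + ‖g‖) ^ 2 * (1 + ‖t‖)) ^ (k + 1) := by gcongr
      _ = c0 * (1 + CQ * CL) ^ (k + 1) * ((1 + ‖g‖) ^ (2 * (k + 1)) * Real.exp (-‖g‖ ^ 2 / 2)) *
          ((1 + ‖t‖) ^ (k + 1) * Real.exp (-‖t‖ ^ 2 / 2)) * (1 + ‖z.1‖) ^ (2 * (k + 1)) := by
          rw [mul_pow, mul_pow, mul_pow, ← pow_mul, ← pow_mul]; ring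
      _ ≤ c0 * (1 + CQ * CL) ^ (k + 1) * Cg * Ct * (1 + ‖z.1‖) ^ (2 * (k + 1)) := by
          gcongr
          · exact hCg _ (norm_nonneg _)
          · exact hCt _ (norm_nonneg _)
  obtain ⟨c, hc, hlim⟩ := exists_integral_condNormalIntegrand_eq hpc hRc hm'c hp0 hGint hbound hR0
  have htend := tendsto_integral_condNormalIntegrand hpc hRc hm'c hp0 hGint hbound
  rw [hlim] at htend
  refine not_isGaussian_of_tendsto (k := k) Fintype.card_ne_zero
    (Complex.ofReal_ne_zero.2 hc.ne') (htend.congr fun s => ?_)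
  congr 1
  set b : (ι → ℝ) × (κ → ℝ) → κ → ℝ := fun y => (Q y)⁻¹ *ᵥ (a y.1 + A *ᵥ y.2) with hb
  have hbc : Continuous b := hQinv.matrix_mulVec
    ((ha.comp continuous_fst).add (continuous_const.matrix_mulVec continuous_snd))
  have hYc : Continuous fun z : (ι → ℝ) × (κ → ℝ) × (κ → ℝ) =>
      b (z.1, z.2.1) ⬝ᵥ (m (z.1, z.2.1) + L *ᵥ z.2.2) := by
    refine Continuous.dotProduct (hbc.comp (by fun_prop)) (Continuous.add (hm.comp (by fun_prop)) ?_)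
    exact continuous_const.matrix_mulVec (by fun_prop)
  have hbdd : ∀ (f : (ι → ℝ) × (κ → ℝ) × (κ → ℝ) → ℝ), Continuous f →
      Integrable (fun z => cexp (s * f z * I))
        ((stdNormal ι).prod ((stdNormal κ).prod (stdNormal κ))) := by
    intro f hf
    refine (integrable_const (1 : ℝ)).mono' (Continuous.aestronglyMeasurable (by fun_prop))
      (Eventually.of_forall fun z => le_of_eq ?_)
    have : (s : ℂ) * (f z : ℂ) * I = ((s * f z : ℝ) : ℂ) * I := by push_cast; ring
    rw [this, Complex.norm_exp_ofReal_mul_I]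
  have hY := hbdd _ hYc
  rw [charFun_apply_real, integral_map hYc.measurable.aemeasurable
    (Continuous.aestronglyMeasurable (by fun_prop)), integral_prod _ hY]
  have hin := hY.prod_right_ae
  refine integral_congr_ae ?_
  filter_upwards [hin] with x hx
  rw [integral_prod _ hx]
  -- Integrating out g₃ with the other two blocks fixed gives a normal characteristic function.
  have hg3 : ∀ g : κ → ℝ, ∫ g3, cexp (s * ((b (x, g) ⬝ᵥ (m (x, g) + L *ᵥ g3) : ℝ) : ℂ) * I)
      ∂(stdNormal κ) = cexp (I * (s * (b (x, g) ⬝ᵥ m (x, g)) : ℝ) -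
        ((s • (Lᵀ *ᵥ b (x, g))) ⬝ᵥ (s • (Lᵀ *ᵥ b (x, g))) : ℝ) / 2) := by
    intro g
    have h1 : ∀ g3, cexp (s * ((b (x, g) ⬝ᵥ (m (x, g) + L *ᵥ g3) : ℝ) : ℂ) * I) =
        cexp (I * (s * (b (x, g) ⬝ᵥ m (x, g)) : ℝ)) *
          cexp (I * ((s • (Lᵀ *ᵥ b (x, g))) ⬝ᵥ g3 : ℝ)) := by
      intro g3
      rw [← Complex.exp_add, dotProduct_add, Matrix.dotProduct_mulVec, ← Matrix.mulVec_transpose,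
        smul_dotProduct, smul_eq_mul]
      congr 1
      push_cast
      ring
    simp_rw [h1]
    rw [integral_const_mul, integral_cexp_stdNormal, ← Complex.exp_add]
    congr 1
    ring
  simp only
  simp_rw [hg3]
  have hFc : Continuous fun g : κ → ℝ => cexp (I * (s * (b (x, g) ⬝ᵥ m (x, g)) : ℝ) -
        ((s • (Lᵀ *ᵥ b (x, g))) ⬝ᵥ (s • (Lᵀ *ᵥ b (x, g))) : ℝ) / 2) := by
    have h0 : Continuous fun g : κ → ℝ => (x, g) := by fun_prop
    have h1 : Continuous fun g => b (x, g) := hbc.comp h0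
    have h2 := h1.dotProduct (hm.comp h0)
    have h3 : Continuous fun g => s • (Lᵀ *ᵥ b (x, g)) :=
      (continuous_const.matrix_mulVec h1).const_smul s
    have h4 := h3.dotProduct h3
    simp only [Function.comp_def] at h2
    fun_prop
  rw [integral_stdNormal_comp_affine hA (a x) hFc]
  refine integral_congr_ae (Eventually.of_forall fun u => ?_)
  simp only [condNormalIntegrand, hp, hR, hm']
  set g := A⁻¹ *ᵥ (u - a x) with hg
  have hbu : b (x, g) = (Q (x, g))⁻¹ *ᵥ u := by
    simp only [hb, hg, Matrix.mulVec_mulVec, Matrix.mul_nonsing_inv _ hAu, Matrix.one_mulVec,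
      add_sub_cancel]
  have h1 : (Lᵀ * (Q (x, g))⁻¹) *ᵥ (s • u) = s • (Lᵀ *ᵥ b (x, g)) := by
    rw [hbu, Matrix.mulVec_smul, Matrix.mulVec_mulVec]
  have h2 : (s • (Lᵀ *ᵥ b (x, g))) ⬝ᵥ (L⁻¹ *ᵥ m (x, g)) = s * (b (x, g) ⬝ᵥ m (x, g)) := by
    rw [smul_dotProduct, smul_eq_mul, Matrix.mulVec_transpose, ← Matrix.dotProduct_mulVec,
      Matrix.mulVec_mulVec, Matrix.mul_nonsing_inv _ hLu, Matrix.one_mulVec]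
  rw [h1, h2]

end ConditionallyNormalProduct

/-! ### Block Cholesky factorization. -/

section Factorization

variable {m n : Type*} [Fintype m] [Fintype n] [DecidableEq m] [DecidableEq n]

lemma Matrix.PosDef.exists_eq_mul_transpose {V : Matrix n n ℝ} (hV : V.PosDef) :
    ∃ T : Matrix n n ℝ, V = T * Tᵀ ∧ T.det ≠ 0 := by
  have hH := hV.isHermitian
  set U : Matrix n n ℝ := hH.eigenvectorUnitary.1 with hU
  set d : n → ℝ := fun i => √(hH.eigenvalues i) with hd
  have hspec : V = U * Matrix.diagonal hH.eigenvalues * Uᵀ := by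
    have := hH.spectral_theorem
    rw [Unitary.conjStarAlgAut_apply] at this
    simpa [Matrix.star_eq_conjTranspose, Matrix.conjTranspose_eq_transpose_of_trivial,
      Function.comp_def] using this
  have hT : V = (U * Matrix.diagonal d) * (U * Matrix.diagonal d)ᵀ := by
    have hdd : Matrix.diagonal d * Matrix.diagonal d = Matrix.diagonal hH.eigenvalues := by
      rw [Matrix.diagonal_mul_diagonal]
      congr 1
      ext i
      exact Real.mul_self_sqrt (hV.eigenvalues_pos i).le
    rw [Matrix.transpose_mul, Matrix.diagonal_transpose, Matrix.mul_assoc, ← Matrix.mul_assoc _ _ Uᵀ,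
      hdd, ← Matrix.mul_assoc]
    exact hspec
  refine ⟨_, hT, fun h0 => hV.det_pos.ne' ?_⟩
  rw [hT, Matrix.det_mul, h0, zero_mul]

/-- A factorization of a positive definite block matrix with a lower triangular factor whose first
diagonal block is prescribed. -/
lemma Matrix.PosDef.exists_fromBlocks_mul_transpose {V : Matrix (m ⊕ n) (m ⊕ n) ℝ} (hV : V.PosDef)
    {T₁ : Matrix m m ℝ} (hT₁ : V.toBlocks₁₁ = T₁ * T₁ᵀ) (hT₁d : T₁.det ≠ 0) :
    ∃ (B : Matrix n m ℝ) (T₂ : Matrix n n ℝ), T₂.det ≠ 0 ∧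
      V = Matrix.fromBlocks T₁ 0 B T₂ * (Matrix.fromBlocks T₁ 0 B T₂)ᵀ := by
  have h11 : V.toBlocks₁₁.PosDef := hV.submatrix Sum.inl_injective
  have hVT : Vᵀ = V := by
    simpa [Matrix.conjTranspose_eq_transpose_of_trivial] using hV.isHermitian.eq
  have h21 : V.toBlocks₂₁ = V.toBlocks₁₂ᵀ := by
    ext i j; exact (congrFun (congrFun hVT (Sum.inr i)) (Sum.inl j)).symm
  have hT₁u : IsUnit T₁.det := isUnit_iff_ne_zero.2 hT₁d
  have hT₁u' : IsUnit (T₁ᵀ).det := by rwa [Matrix.det_transpose]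
  have := h11.isUnit.invertible
  have hVb : V = Matrix.fromBlocks V.toBlocks₁₁ V.toBlocks₁₂ V.toBlocks₁₂ᵀ V.toBlocks₂₂ := by
    rw [← h21, Matrix.fromBlocks_toBlocks]
  -- The Schur complement of the first block: it is positive definite, its factor is T₂, and B = V₂₁
  -- (T₁ᵀ)⁻¹ is forced by the off-diagonal block.
  set S := V.toBlocks₂₂ - V.toBlocks₁₂ᵀ * V.toBlocks₁₁⁻¹ * V.toBlocks₁₂ with hS
  have hSpsd : S.PosSemidef := by
    have h := (Matrix.PosDef.fromBlocks₁₁ V.toBlocks₁₂ V.toBlocks₂₂ h11).1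
    rw [Matrix.conjTranspose_eq_transpose_of_trivial] at h
    exact h (hVb ▸ hV.posSemidef)
  have hSdet : S.det ≠ 0 := by
    have h := Matrix.det_fromBlocks₁₁ V.toBlocks₁₁ V.toBlocks₁₂ V.toBlocks₁₂ᵀ V.toBlocks₂₂
    rw [← hVb, Matrix.invOf_eq_nonsing_inv] at h
    intro h0
    rw [← hS, h0, mul_zero] at h
    exact hV.det_pos.ne' h
  obtain ⟨T₂, hT₂, hT₂d⟩ := (hSpsd.posDef_iff_det_ne_zero.2 hSdet).exists_eq_mul_transpose
  refine ⟨V.toBlocks₂₁ * (T₁ᵀ)⁻¹, T₂, hT₂d, ?_⟩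
  rw [Matrix.fromBlocks_transpose, Matrix.fromBlocks_multiply]
  simp only [Matrix.transpose_zero, Matrix.mul_zero, Matrix.zero_mul, add_zero, ← hT₁, ← hT₂]
  have hB1 : T₁ * (V.toBlocks₂₁ * (T₁ᵀ)⁻¹)ᵀ = V.toBlocks₁₂ := by
    rw [Matrix.transpose_mul, h21, Matrix.transpose_transpose, Matrix.transpose_nonsing_inv,
      Matrix.transpose_transpose, ← Matrix.mul_assoc, Matrix.mul_nonsing_inv _ hT₁u, Matrix.one_mul]
  have hB2 : V.toBlocks₂₁ * (T₁ᵀ)⁻¹ * T₁ᵀ = V.toBlocks₂₁ := by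
    rw [Matrix.mul_assoc, Matrix.nonsing_inv_mul _ hT₁u', Matrix.mul_one]
  have hB3 : V.toBlocks₂₁ * (T₁ᵀ)⁻¹ * (V.toBlocks₂₁ * (T₁ᵀ)⁻¹)ᵀ =
      V.toBlocks₁₂ᵀ * V.toBlocks₁₁⁻¹ * V.toBlocks₁₂ := by
    rw [hT₁, Matrix.mul_inv_rev, Matrix.transpose_mul, h21, Matrix.transpose_transpose,
      Matrix.transpose_nonsing_inv, Matrix.transpose_transpose]
    simp only [Matrix.mul_assoc]
  rw [hB1, hB2, hB3, hS, add_sub_cancel, Matrix.fromBlocks_toBlocks]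

end Factorization

/-! ### Triangular representation and full support of nondegenerate normal laws. -/

section Representation

variable {ι κ : Type*} [Fintype ι] [Fintype κ] [DecidableEq ι] [DecidableEq κ]

/-- A nondegenerate centered normal law on a product of three blocks is the law of a triangular
linear function of independent standard normal vectors. -/
lemma IsCenteredNormal.exists_triangular {κ' : Type*} [Fintype κ'] [DecidableEq κ']
    {μ : Measure ((ι ⊕ κ) ⊕ κ' → ℝ)}
    {V : Matrix ((ι ⊕ κ) ⊕ κ') ((ι ⊕ κ) ⊕ κ') ℝ} (hμ : IsCenteredNormal μ V) (hV : V.PosDef) :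
    ∃ (T₁ : Matrix ι ι ℝ) (B : Matrix κ ι ℝ) (T₂ : Matrix κ κ ℝ) (B' : Matrix κ' (ι ⊕ κ) ℝ)
      (T₃ : Matrix κ' κ' ℝ), T₂.det ≠ 0 ∧ T₃.det ≠ 0 ∧
      μ = ((stdNormal ι).prod ((stdNormal κ).prod (stdNormal κ'))).map fun z =>
        Sum.elim (Sum.elim (T₁ *ᵥ z.1) (B *ᵥ z.1 + T₂ *ᵥ z.2.1))
          (B' *ᵥ Sum.elim z.1 z.2.1 + T₃ *ᵥ z.2.2) := by
  -- The factorization is built block by block. The factor of the first two blocks is reused as the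
  -- prescribed corner of the full one, so each block depends only on its own normal vector and the
  -- earlier ones.
  have h1 : V.toBlocks₁₁.PosDef := hV.submatrix Sum.inl_injective
  have h2 : V.toBlocks₁₁.toBlocks₁₁.PosDef := h1.submatrix Sum.inl_injective
  obtain ⟨T₁, hT₁, hT₁d⟩ := h2.exists_eq_mul_transpose
  obtain ⟨B, T₂, hT₂d, hBT₂⟩ := h1.exists_fromBlocks_mul_transpose hT₁ hT₁d
  have hd : (Matrix.fromBlocks T₁ 0 B T₂).det ≠ 0 := by
    rw [Matrix.det_fromBlocks_zero₁₂]; exact mul_ne_zero hT₁d hT₂d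
  obtain ⟨B', T₃, hT₃d, hBT₃⟩ := hV.exists_fromBlocks_mul_transpose hBT₂ hd
  refine ⟨T₁, B, T₂, B', T₃, hT₂d, hT₃d, ?_⟩
  set A := Matrix.fromBlocks (Matrix.fromBlocks T₁ 0 B T₂) 0 B' T₃ with hA
  have hstd : IsCenteredNormal (((stdNormal ι).prod ((stdNormal κ).prod (stdNormal κ'))).map
      fun z => (Sum.elim (Sum.elim z.1 z.2.1) z.2.2 : (ι ⊕ κ) ⊕ κ' → ℝ)) 1 := by
    have hc : Continuous fun z : (ι → ℝ) × (κ → ℝ) × (κ' → ℝ) =>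
        (Sum.elim (Sum.elim z.1 z.2.1) z.2.2 : (ι ⊕ κ) ⊕ κ' → ℝ) :=
      continuous_sumElim_pi (continuous_sumElim_pi (by fun_prop) (by fun_prop)) (by fun_prop)
    have := Measure.isProbabilityMeasure_map (μ := (stdNormal ι).prod ((stdNormal κ).prod
      (stdNormal κ'))) hc.measurable.aemeasurable
    refine isCenteredNormal_of_integral_cexp Matrix.PosSemidef.one fun w => ?_
    rw [integral_map hc.measurable.aemeasurable (Continuous.aestronglyMeasurable
      (by unfold dotProduct; fun_prop))]
    have hw : w = Sum.elim (Sum.elim (w ∘ Sum.inl ∘ Sum.inl) (w ∘ Sum.inl ∘ Sum.inr))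
        (w ∘ Sum.inr) := by
      ext i; rcases i with (i | i) | i <;> rfl
    generalize w ∘ Sum.inl ∘ Sum.inl = w1 at hw
    generalize w ∘ Sum.inl ∘ Sum.inr = w2 at hw
    generalize w ∘ Sum.inr = w3 at hw
    subst hw
    have h3 : ∀ z : (ι → ℝ) × (κ → ℝ) × (κ' → ℝ), Complex.exp (Complex.I *
        ((Sum.elim (Sum.elim w1 w2) w3 ⬝ᵥ Sum.elim (Sum.elim z.1 z.2.1) z.2.2 : ℝ) : ℂ)) =
        Complex.exp (Complex.I * (w1 ⬝ᵥ z.1 : ℝ)) * (Complex.exp (Complex.I * (w2 ⬝ᵥ z.2.1 : ℝ)) *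
          Complex.exp (Complex.I * (w3 ⬝ᵥ z.2.2 : ℝ))) := by
      intro z
      rw [← Complex.exp_add, ← Complex.exp_add, sumElim_dotProduct_sumElim,
        sumElim_dotProduct_sumElim]
      congr 1
      push_cast
      ring
    simp_rw [h3]
    rw [integral_prod_mul (fun x : ι → ℝ => Complex.exp (Complex.I * (w1 ⬝ᵥ x : ℝ)))
      (fun y : (κ → ℝ) × (κ' → ℝ) => Complex.exp (Complex.I * (w2 ⬝ᵥ y.1 : ℝ)) *
        Complex.exp (Complex.I * (w3 ⬝ᵥ y.2 : ℝ))),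
      integral_prod_mul (fun x : κ → ℝ => Complex.exp (Complex.I * (w2 ⬝ᵥ x : ℝ)))
        (fun x : κ' → ℝ => Complex.exp (Complex.I * (w3 ⬝ᵥ x : ℝ))),
      integral_cexp_stdNormal, integral_cexp_stdNormal, integral_cexp_stdNormal,
      ← Complex.exp_add, ← Complex.exp_add, Matrix.one_mulVec, sumElim_dotProduct_sumElim,
      sumElim_dotProduct_sumElim]
    congr 1
    push_cast
    ring
  have h4 := hstd.map_mulVec A
  rw [Matrix.mul_one, ← hBT₃] at h4
  rw [hμ.ext h4, Measure.map_map]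
  · congr 1
    ext1 z
    simp only [Function.comp_apply, hA, Matrix.fromBlocks_mulVec]
    simp
  · exact (Continuous.matrix_mulVec continuous_const continuous_id).measurable
  · exact (continuous_sumElim_pi (continuous_sumElim_pi (by fun_prop) (by fun_prop))
      (by fun_prop)).measurable

/-- Image of the standard normal law under an invertible, hence surjective, linear map. -/
lemma IsCenteredNormal.isOpenPosMeasure {μ : Measure (ι → ℝ)} {V : Matrix ι ι ℝ}
    (hμ : IsCenteredNormal μ V) (hV : V.PosDef) : μ.IsOpenPosMeasure := by
  obtain ⟨T, hT, hTd⟩ := hV.exists_eq_mul_transpose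
  have h := (isCenteredNormal_stdNormal (ι := ι)).map_mulVec T
  rw [Matrix.mul_one, ← hT] at h
  rw [hμ.ext h]
  refine Continuous.isOpenPosMeasure_map
    (Continuous.matrix_mulVec continuous_const continuous_id) fun y => ⟨T⁻¹ *ᵥ y, ?_⟩
  rw [Matrix.mulVec_mulVec, Matrix.mul_nonsing_inv _ (isUnit_iff_ne_zero.2 hTd), Matrix.one_mulVec]

omit [DecidableEq κ] in
lemma IsCenteredNormal.map_reindex {μ : Measure (ι → ℝ)} {V : Matrix ι ι ℝ}
    (hμ : IsCenteredNormal μ V) (e : κ ≃ ι) :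
    IsCenteredNormal (μ.map fun x => x ∘ e) (V.submatrix e e) := by
  have h := hμ.map_mulVec ((1 : Matrix ι ι ℝ).submatrix e id)
  have h1 : (1 : Matrix ι ι ℝ).submatrix e id * V * ((1 : Matrix ι ι ℝ).submatrix e id)ᵀ =
      V.submatrix e e := by
    ext a b
    simp [Matrix.mul_apply, Matrix.submatrix_apply, Matrix.one_apply]
  have h2 : (fun x : ι → ℝ => x ∘ e) = fun x => (1 : Matrix ι ι ℝ).submatrix e id *ᵥ x := by
    ext x a
    simp [mulVec, dotProduct, Matrix.one_apply]
  rw [h1] at h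
  rwa [h2]

end Representation

/-! ### Algebra of the limits: separating the missing factors from the non-random part. -/

section LimitAlgebra

variable {k₁ k₂ kᵥ : ℕ} (Γ : Matrix (AllIdx k₁ k₂ kᵥ) (AllIdx k₁ k₂ kᵥ) ℝ)
  (SigmaU : Matrix (ObsIdx k₁ k₂) (ObsIdx k₁ k₂) ℝ)

/-- The coefficients of the loadings on the missing factors in the limit of the first-pass
estimates, after projection of the loadings on the observed factors. -/
noncomputable def missingCoef (η : ObsIdx k₁ k₂ → Fin kᵥ → ℝ) : Matrix (ObsIdx k₁ k₂) (Fin kᵥ) ℝ :=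
  etaTilde η + Γ.toBlocks₁₂ * Γ.toBlocks₂₂⁻¹

/-- The part of the limiting Gram matrix that does not come from the missing factors. -/
noncomputable def residualGram : Matrix (ObsIdx k₁ k₂) (ObsIdx k₁ k₂) ℝ :=
  Γ.toBlocks₁₁ - Γ.toBlocks₁₂ * Γ.toBlocks₂₂⁻¹ * Γ.toBlocks₁₂ᵀ +
    weakProj k₁ k₂ * SigmaU * weakProj k₁ k₂

variable {Γ SigmaU}

lemma posDef_toBlocks₂₂ (hΓ : Γ.PosDef) : Γ.toBlocks₂₂.PosDef := hΓ.submatrix Sum.inr_injective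

lemma toBlocks₂₁_eq (hΓ : Γ.PosDef) : Γ.toBlocks₂₁ = Γ.toBlocks₁₂ᵀ := by
  have h : Γᵀ = Γ := by
    simpa [Matrix.conjTranspose_eq_transpose_of_trivial] using hΓ.isHermitian.eq
  ext i j
  exact (congrFun (congrFun h (Sum.inr i)) (Sum.inl j)).symm

lemma posSemidef_weakProj_mul (hS : SigmaU.PosSemidef) :
    (weakProj k₁ k₂ * SigmaU * weakProj k₁ k₂).PosSemidef := by
  have h := hS.mul_mul_conjTranspose_same (weakProj k₁ k₂)
  rwa [Matrix.conjTranspose_eq_transpose_of_trivial, weakProj_transpose] at h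

/-- Its first part is the Schur complement of the missing-loadings block in Γ, which inherits
positive definiteness. -/
lemma posDef_residualGram (hΓ : Γ.PosDef) (hS : SigmaU.PosSemidef) :
    (residualGram Γ SigmaU).PosDef := by
  refine Matrix.PosDef.add_posSemidef ?_ (posSemidef_weakProj_mul hS)
  have h22 := posDef_toBlocks₂₂ hΓ
  have := h22.isUnit.invertible
  have hΓb : Γ = Matrix.fromBlocks Γ.toBlocks₁₁ Γ.toBlocks₁₂ Γ.toBlocks₁₂ᵀ Γ.toBlocks₂₂ := by
    rw [← toBlocks₂₁_eq hΓ, Matrix.fromBlocks_toBlocks]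
  have h1 : (Γ.toBlocks₁₁ - Γ.toBlocks₁₂ * Γ.toBlocks₂₂⁻¹ * Γ.toBlocks₁₂ᵀ).PosSemidef := by
    have h := (Matrix.PosDef.fromBlocks₂₂ Γ.toBlocks₁₁ Γ.toBlocks₁₂ h22).1
    rw [Matrix.conjTranspose_eq_transpose_of_trivial] at h
    exact h (hΓb ▸ hΓ.posSemidef)
  refine h1.posDef_iff_det_ne_zero.2 fun h0 => hΓ.det_pos.ne' ?_
  rw [hΓb, Matrix.det_fromBlocks₂₂, Matrix.invOf_eq_nonsing_inv, h0, mul_zero]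

/-- Completing the square in η̃. The randomness is confined to the first summand, which has rank at
most kᵥ. -/
lemma limGram_eq (hΓ : Γ.PosDef) (η : ObsIdx k₁ k₂ → Fin kᵥ → ℝ) : limGram Γ SigmaU η =
    missingCoef Γ η * Γ.toBlocks₂₂ * (missingCoef Γ η)ᵀ + residualGram Γ SigmaU := by
  have h22 := posDef_toBlocks₂₂ hΓ
  have hu : IsUnit Γ.toBlocks₂₂.det := isUnit_iff_ne_zero.2 h22.det_pos.ne'
  have hsym : Γ.toBlocks₂₂ᵀ = Γ.toBlocks₂₂ := by
    simpa [Matrix.conjTranspose_eq_transpose_of_trivial] using h22.isHermitian.eq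
  rw [limGram, residualGram, missingCoef]
  conv_lhs => rw [← Matrix.fromBlocks_toBlocks Γ, toBlocks₂₁_eq hΓ]
  rw [Matrix.transpose_fromCols, Matrix.fromCols_mul_fromBlocks, Matrix.fromCols_mul_fromRows,
    Matrix.transpose_add, Matrix.transpose_mul, Matrix.transpose_nonsing_inv, hsym]
  simp only [Matrix.add_mul, Matrix.mul_add, Matrix.one_mul, Matrix.transpose_one, Matrix.mul_one,
    Matrix.mul_assoc, Matrix.mul_nonsing_inv_cancel_left _ _ hu]
  rw [Matrix.nonsing_inv_mul_cancel_left (A := Γ.toBlocks₂₂) _ hu]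
  abel

lemma toBlocks₁₂_add_eq (hΓ : Γ.PosDef) (η : ObsIdx k₁ k₂ → Fin kᵥ → ℝ) :
    Γ.toBlocks₁₂ + etaTilde η * Γ.toBlocks₂₂ = missingCoef Γ η * Γ.toBlocks₂₂ := by
  have hu : IsUnit Γ.toBlocks₂₂.det := isUnit_iff_ne_zero.2 (posDef_toBlocks₂₂ hΓ).det_pos.ne'
  rw [missingCoef, Matrix.add_mul, Matrix.nonsing_inv_mul_cancel_right _ _ hu, add_comm]

variable (Γ SigmaU) in
/-- The inverse conditional second moment matrix of the missing loadings in the limit of the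
second pass. -/
noncomputable def missingGram (η : ObsIdx k₁ k₂ → Fin kᵥ → ℝ) : Matrix (Fin kᵥ) (Fin kᵥ) ℝ :=
  Γ.toBlocks₂₂⁻¹ + (missingCoef Γ η)ᵀ * (residualGram Γ SigmaU)⁻¹ * missingCoef Γ η

lemma posDef_missingGram (hΓ : Γ.PosDef) (hS : SigmaU.PosSemidef)
    (η : ObsIdx k₁ k₂ → Fin kᵥ → ℝ) : (missingGram Γ SigmaU η).PosDef := by
  refine (posDef_toBlocks₂₂ hΓ).inv.add_posSemidef ?_
  have h := (posDef_residualGram hΓ hS).inv.posSemidef.conjTranspose_mul_mul_same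
    (missingCoef Γ η)
  rwa [Matrix.conjTranspose_eq_transpose_of_trivial] at h

/-- The push-through identity (ZΘZ' + D)⁻¹ZΘ = D⁻¹Z(Θ⁻¹ + Z'D⁻¹Z)⁻¹. It replaces the random inverse
of M by a kᵥ × kᵥ one and leaves D⁻¹, which is non-random, on the outside. -/
lemma limGram_inv_mul_missingCoef (hΓ : Γ.PosDef) (hS : SigmaU.PosSemidef)
    (η : ObsIdx k₁ k₂ → Fin kᵥ → ℝ) :
    (limGram Γ SigmaU η)⁻¹ * (missingCoef Γ η * Γ.toBlocks₂₂) =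
      (residualGram Γ SigmaU)⁻¹ * missingCoef Γ η * (missingGram Γ SigmaU η)⁻¹ := by
  have hM : IsUnit (limGram Γ SigmaU η).det :=
    isUnit_iff_ne_zero.2 (posDef_limGram hΓ hS η).det_pos.ne'
  have hD : IsUnit (residualGram Γ SigmaU).det :=
    isUnit_iff_ne_zero.2 (posDef_residualGram hΓ hS).det_pos.ne'
  have hQ : IsUnit (missingGram Γ SigmaU η).det :=
    isUnit_iff_ne_zero.2 (posDef_missingGram hΓ hS η).det_pos.ne'
  have hΘ : IsUnit Γ.toBlocks₂₂.det := isUnit_iff_ne_zero.2 (posDef_toBlocks₂₂ hΓ).det_pos.ne'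
  have key : limGram Γ SigmaU η * ((residualGram Γ SigmaU)⁻¹ * missingCoef Γ η) =
      missingCoef Γ η * Γ.toBlocks₂₂ * missingGram Γ SigmaU η := by
    rw [limGram_eq hΓ, missingGram, Matrix.add_mul, Matrix.mul_add,
      Matrix.mul_nonsing_inv_cancel_left _ _ hD, Matrix.mul_nonsing_inv_cancel_right _ _ hΘ, add_comm]
    simp only [Matrix.mul_assoc]
  calc (limGram Γ SigmaU η)⁻¹ * (missingCoef Γ η * Γ.toBlocks₂₂)
      = (limGram Γ SigmaU η)⁻¹ * (missingCoef Γ η * Γ.toBlocks₂₂ * missingGram Γ SigmaU η) *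
        (missingGram Γ SigmaU η)⁻¹ := by
        rw [Matrix.mul_assoc, Matrix.mul_nonsing_inv_cancel_right _ _ hQ]
    _ = _ := by rw [← key, Matrix.nonsing_inv_mul_cancel_left _ _ hM]

variable (Γ SigmaU) in
/-- The limit of the estimation error, as a function of the noise due to the missing factors. -/
noncomputable def limError (lam d : ObsIdx k₁ k₂ → ℝ) (η : ObsIdx k₁ k₂ → Fin kᵥ → ℝ)
    (ηv : Fin kᵥ → ℝ) : ObsIdx k₁ k₂ → ℝ :=
  (limGram Γ SigmaU η)⁻¹ *ᵥ ((missingCoef Γ η * Γ.toBlocks₂₂) *ᵥ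
    (ηv - (Matrix.of η)ᵀ *ᵥ lam + (missingCoef Γ η)ᵀ *ᵥ d))

variable (lam : ObsIdx k₁ k₂ → ℝ)

lemma limOV_eq_limError (hΓ : Γ.PosDef) (x : LimitSpace k₁ k₂ kᵥ) :
    limOV Γ SigmaU lam x = limError Γ SigmaU lam 0 x.2.1 x.2.2 := by
  rw [limOV, limError, toBlocks₁₂_add_eq hΓ, Matrix.mulVec_zero, add_zero]

/-- With c = 𝓘 Σ_u λ and d = D⁻¹c one has c = M d - ZΘZ'd, hence -M⁻¹c = -d + M⁻¹ZΘ(Z'd). Up to the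
constant d, the attenuation bias only modifies the noise in the omitted variable bias, so one
argument covers X^OV and X^A + X^OV. -/
lemma limA_add_limOV_eq_limError (hΓ : Γ.PosDef) (hS : SigmaU.PosSemidef)
    (x : LimitSpace k₁ k₂ kᵥ) :
    limA Γ SigmaU lam x + limOV Γ SigmaU lam x =
      limError Γ SigmaU lam ((residualGram Γ SigmaU)⁻¹ *ᵥ ((weakProj k₁ k₂ * SigmaU) *ᵥ lam))
        x.2.1 x.2.2 - (residualGram Γ SigmaU)⁻¹ *ᵥ ((weakProj k₁ k₂ * SigmaU) *ᵥ lam) := by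
  have hM : IsUnit (limGram Γ SigmaU x.2.1).det :=
    isUnit_iff_ne_zero.2 (posDef_limGram hΓ hS _).det_pos.ne'
  have hD : IsUnit (residualGram Γ SigmaU).det :=
    isUnit_iff_ne_zero.2 (posDef_residualGram hΓ hS).det_pos.ne'
  set c := (weakProj k₁ k₂ * SigmaU) *ᵥ lam
  set d := (residualGram Γ SigmaU)⁻¹ *ᵥ c with hd
  have h1 : c = limGram Γ SigmaU x.2.1 *ᵥ d -
      (missingCoef Γ x.2.1 * Γ.toBlocks₂₂) *ᵥ ((missingCoef Γ x.2.1)ᵀ *ᵥ d) := by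
    have h0 : residualGram Γ SigmaU *ᵥ d = c := by
      rw [hd, Matrix.mulVec_mulVec, Matrix.mul_nonsing_inv _ hD, Matrix.one_mulVec]
    rw [limGram_eq hΓ, Matrix.add_mulVec, h0, ← Matrix.mulVec_mulVec d, add_sub_cancel_left]
  have h2 : (limGram Γ SigmaU x.2.1)⁻¹ *ᵥ c = d - (limGram Γ SigmaU x.2.1)⁻¹ *ᵥ
      ((missingCoef Γ x.2.1 * Γ.toBlocks₂₂) *ᵥ ((missingCoef Γ x.2.1)ᵀ *ᵥ d)) := by
    conv_lhs => rw [h1]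
    rw [Matrix.mulVec_sub, Matrix.mulVec_mulVec, Matrix.nonsing_inv_mul _ hM, Matrix.one_mulVec]
  rw [limA, limOV, limError, toBlocks₁₂_add_eq hΓ, h2, Matrix.mulVec_add, Matrix.mulVec_add]
  abel

/-- A coordinate is an inner product in ℝ^{kᵥ}: the first vector depends on η alone, and η_v enters
the second additively. This is the shape required by `not_isGaussian_map_dotProduct`. -/
lemma limError_apply (hΓ : Γ.PosDef) (hS : SigmaU.PosSemidef) (d : ObsIdx k₁ k₂ → ℝ)
    (η : ObsIdx k₁ k₂ → Fin kᵥ → ℝ) (ηv : Fin kᵥ → ℝ) (j : ObsIdx k₁ k₂) :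
    limError Γ SigmaU lam d η ηv j =
      ((missingGram Γ SigmaU η)⁻¹ *ᵥ
        ((missingCoef Γ η)ᵀ *ᵥ (residualGram Γ SigmaU)⁻¹.col j)) ⬝ᵥ
      (ηv - (Matrix.of η)ᵀ *ᵥ lam + (missingCoef Γ η)ᵀ *ᵥ d) := by
  have hQ : ((missingGram Γ SigmaU η)⁻¹)ᵀ = (missingGram Γ SigmaU η)⁻¹ := by
    simpa [Matrix.conjTranspose_eq_transpose_of_trivial] using
      (posDef_missingGram hΓ hS η).inv.isHermitian.eq
  have hD : ((residualGram Γ SigmaU)⁻¹)ᵀ = (residualGram Γ SigmaU)⁻¹ := by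
    simpa [Matrix.conjTranspose_eq_transpose_of_trivial] using
      (posDef_residualGram hΓ hS).inv.isHermitian.eq
  rw [limError, Matrix.mulVec_mulVec, limGram_inv_mul_missingCoef hΓ hS]
  set y := ηv - (Matrix.of η)ᵀ *ᵥ lam + (missingCoef Γ η)ᵀ *ᵥ d
  have h1 : (residualGram Γ SigmaU)⁻¹.col j = (residualGram Γ SigmaU)⁻¹ *ᵥ Pi.single j 1 := by
    simp
  have h2 : (missingGram Γ SigmaU η)⁻¹ *ᵥ
        ((missingCoef Γ η)ᵀ *ᵥ (residualGram Γ SigmaU)⁻¹.col j) =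
      ((residualGram Γ SigmaU)⁻¹ * missingCoef Γ η * (missingGram Γ SigmaU η)⁻¹)ᵀ *ᵥ
        Pi.single j 1 := by
    rw [h1, Matrix.mulVec_mulVec, Matrix.mulVec_mulVec, Matrix.transpose_mul, Matrix.transpose_mul,
      hQ, hD, Matrix.mul_assoc]
  rw [h2, Matrix.mulVec_transpose, ← Matrix.dotProduct_mulVec]
  simp

end LimitAlgebra

/-! ### Non-normality of the limits on the weak factors. -/

section WeakComponents

lemma norm_mulVec_le_of_forall_abs_le {m n : Type*} [Fintype m] [Fintype n] {M : Matrix m n ℝ}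
    {K : ℝ} (hK : 0 ≤ K) (h : ∀ i j, |M i j| ≤ K) (v : n → ℝ) :
    ‖M *ᵥ v‖ ≤ Fintype.card n * K * ‖v‖ := by
  refine (pi_norm_le_iff_of_nonneg (by positivity)).2 fun i => ?_
  calc ‖(M *ᵥ v) i‖ ≤ ∑ l, |M i l * v l| := Finset.abs_sum_le_sum_abs _ _
    _ ≤ ∑ _l : n, K * ‖v‖ := Finset.sum_le_sum fun l _ => by
        rw [abs_mul]
        exact mul_le_mul (h i l) (norm_le_pi_norm v l) (abs_nonneg _) hK
    _ = Fintype.card n * K * ‖v‖ := by simp; ring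

variable {k₁ k₂ kᵥ : ℕ} {Γ : Matrix (AllIdx k₁ k₂ kᵥ) (AllIdx k₁ k₂ kᵥ) ℝ}
  {SigmaU : Matrix (ObsIdx k₁ k₂) (ObsIdx k₁ k₂) ℝ} {ν : Measure (LimitSpace k₁ k₂ kᵥ)}

lemma etaTilde_apply (η : ObsIdx k₁ k₂ → Fin kᵥ → ℝ) (r : ObsIdx k₁ k₂) (l : Fin kᵥ) :
    etaTilde η r l = Sum.elim (fun _ => 0) (fun _ => 1) r * η r l := by
  simp [etaTilde, weakProj, Matrix.diagonal_mul]

lemma abs_etaTilde_le (η : ObsIdx k₁ k₂ → Fin kᵥ → ℝ) (r : ObsIdx k₁ k₂) (l : Fin kᵥ) :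
    |etaTilde η r l| ≤ |η r l| := by
  rw [etaTilde_apply]
  rcases r with a | b <;> simp

lemma continuous_etaTilde : Continuous (etaTilde : (ObsIdx k₁ k₂ → Fin kᵥ → ℝ) → _) := by
  refine continuous_matrix fun r l => ?_
  simp_rw [etaTilde_apply]
  fun_prop

lemma Continuous.limGram {X : Type*} [TopologicalSpace X]
    {G : X → Matrix (AllIdx k₁ k₂ kᵥ) (AllIdx k₁ k₂ kᵥ) ℝ} {η : X → ObsIdx k₁ k₂ → Fin kᵥ → ℝ}
    (hG : Continuous G) (hη : Continuous η) :
    Continuous fun x => limGram (G x) SigmaU (η x) := by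
  have h : Continuous fun x =>
      Matrix.fromCols (1 : Matrix (ObsIdx k₁ k₂) (ObsIdx k₁ k₂) ℝ) (etaTilde (η x)) :=
    continuous_matrix fun i j => by
      rcases j with j | l
      · exact continuous_const
      · exact (continuous_etaTilde.comp hη).matrix_elem i l
  exact ((h.matrix_mul hG).matrix_mul h.matrix_transpose).add continuous_const

lemma continuous_limGram_inv (hΓ : Γ.PosDef) (hS : SigmaU.PosSemidef) :
    Continuous fun η => (limGram Γ SigmaU η)⁻¹ :=
  continuous_iff_continuousAt.2 fun η => ContinuousAt.nonsing_inv
    (continuous_const.limGram continuous_id).continuousAt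
    (posDef_limGram hΓ hS η).det_pos.ne'

lemma continuous_missingCoef : Continuous (missingCoef Γ) :=
  continuous_etaTilde.add continuous_const

lemma continuous_missingGram : Continuous (missingGram Γ SigmaU) :=
  continuous_const.add ((continuous_missingCoef.matrix_transpose.matrix_mul
    continuous_const).matrix_mul continuous_missingCoef)

lemma continuous_limError (hΓ : Γ.PosDef) (hS : SigmaU.PosSemidef) (lam d : ObsIdx k₁ k₂ → ℝ) :
    Continuous fun p : (ObsIdx k₁ k₂ → Fin kᵥ → ℝ) × (Fin kᵥ → ℝ) =>
      limError Γ SigmaU lam d p.1 p.2 := by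
  have hZ : Continuous fun p : (ObsIdx k₁ k₂ → Fin kᵥ → ℝ) × (Fin kᵥ → ℝ) =>
      missingCoef Γ p.1 := continuous_missingCoef.comp continuous_fst
  refine ((continuous_limGram_inv hΓ hS).comp continuous_fst).matrix_mulVec
    ((hZ.matrix_mul continuous_const).matrix_mulVec
      ((continuous_snd.sub ?_).add (hZ.matrix_transpose.matrix_mulVec continuous_const)))
  exact Continuous.matrix_mulVec (Continuous.matrix_transpose continuous_fst) continuous_const

/-- Splits the row `j` off the index set of `vec η`. -/
def rowSplit (j : ObsIdx k₁ k₂) :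
    (Fin kᵥ × {r : ObsIdx k₁ k₂ // r ≠ j}) ⊕ Fin kᵥ ≃ Fin kᵥ × ObsIdx k₁ k₂ where
  toFun := Sum.elim (fun p => (p.1, p.2.1)) (fun l => (l, j))
  invFun p := if h : p.2 = j then Sum.inr p.1 else Sum.inl (p.1, ⟨p.2, h⟩)
  left_inv := by
    rintro (⟨l, r, hr⟩ | l) <;> simp [*]
  right_inv := by
    rintro ⟨l, r⟩
    by_cases h : r = j <;> simp [h]

/-- The matrix whose row `j` is given by the second block of `y`, and the other rows by the first
one. -/
def ofRowSplit (j : ObsIdx k₁ k₂) (y : (Fin kᵥ × {r : ObsIdx k₁ k₂ // r ≠ j}) ⊕ Fin kᵥ → ℝ) :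
    ObsIdx k₁ k₂ → Fin kᵥ → ℝ := fun r l => y ((rowSplit j).symm (l, r))

lemma continuous_ofRowSplit (j : ObsIdx k₁ k₂) :
    Continuous (ofRowSplit (kᵥ := kᵥ) j) := by
  unfold ofRowSplit; fun_prop

/-- Because the row belongs to a weak factor, it enters η̃ unchanged; an increment of it moves the
linear combination with weights δ by δ_b times the increment. -/
lemma missingCoef_transpose_mulVec_ofRowSplit (b : Fin k₂) (δ : ObsIdx k₁ k₂ → ℝ)
    (y₁ : Fin kᵥ × {r : ObsIdx k₁ k₂ // r ≠ Sum.inr b} → ℝ) (y₂ y₃ : Fin kᵥ → ℝ) :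
    (missingCoef Γ (ofRowSplit (Sum.inr b) (Sum.elim y₁ (y₂ + y₃))))ᵀ *ᵥ δ =
      (missingCoef Γ (ofRowSplit (Sum.inr b) (Sum.elim y₁ y₂)))ᵀ *ᵥ δ + δ (Sum.inr b) • y₃ := by
  have h : missingCoef Γ (ofRowSplit (Sum.inr b) (Sum.elim y₁ (y₂ + y₃))) =
      missingCoef Γ (ofRowSplit (Sum.inr b) (Sum.elim y₁ y₂)) +
        vecMulVec (Pi.single (Sum.inr b) 1) y₃ := by
    ext r l
    simp only [missingCoef, Matrix.add_apply, etaTilde_apply, ofRowSplit, rowSplit,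
      Equiv.coe_fn_symm_mk, vecMulVec_apply]
    by_cases hr : r = Sum.inr b
    · subst hr; simp; ring
    · simp [hr]
  rw [h, Matrix.transpose_add, Matrix.add_mulVec, Matrix.transpose_vecMulVec,
    Matrix.vecMulVec_mulVec]
  congr 1
  ext l
  simp [mul_comm]

/-- `missingGram` is quadratic in η, and η is linear in the normal vectors x and g. -/
lemma exists_norm_missingGram_mulVec_le {ι : Type*} [Fintype ι]
    (j : ObsIdx k₁ k₂) (T₁ : Matrix (Fin kᵥ × {r : ObsIdx k₁ k₂ // r ≠ j}) ι ℝ)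
    (B : Matrix (Fin kᵥ) ι ℝ) (T₂ : Matrix (Fin kᵥ) (Fin kᵥ) ℝ) :
    ∃ C, 0 ≤ C ∧ ∀ x g v, ‖missingGram Γ SigmaU
      (ofRowSplit j (Sum.elim (T₁ *ᵥ x) (B *ᵥ x + T₂ *ᵥ g))) *ᵥ v‖ ≤
        C * (1 + ‖x‖) ^ 2 * (1 + ‖g‖) ^ 2 * ‖v‖ := by
  obtain ⟨c₁, hc₁, h₁⟩ := exists_norm_mulVec_le T₁
  obtain ⟨c₂, hc₂, h₂⟩ := exists_norm_mulVec_le B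
  obtain ⟨c₃, hc₃, h₃⟩ := exists_norm_mulVec_le T₂
  obtain ⟨c₄, hc₄, h₄⟩ := exists_norm_mulVec_le (Γ.toBlocks₂₂⁻¹)
  obtain ⟨c₅, hc₅, h₅⟩ := exists_norm_mulVec_le ((residualGram Γ SigmaU)⁻¹)
  set c₀ := ∑ r, ∑ l, |(Γ.toBlocks₁₂ * Γ.toBlocks₂₂⁻¹) r l|
  have hc₀ : 0 ≤ c₀ := by positivity
  set K := c₁ + c₂ + c₃ + c₀
  have hK : 0 ≤ K := by positivity
  refine ⟨c₄ + Fintype.card (ObsIdx k₁ k₂) * K * (c₅ * (Fintype.card (Fin kᵥ) * K)),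
    by positivity, fun x g v => ?_⟩
  set s := (1 + ‖x‖) * (1 + ‖g‖) with hs
  have hs1 : 1 ≤ s := by nlinarith [norm_nonneg x, norm_nonneg g, mul_nonneg (norm_nonneg x) (norm_nonneg g)]
  have hxs : ‖x‖ ≤ s := by nlinarith [norm_nonneg x, norm_nonneg g, mul_nonneg (norm_nonneg x) (norm_nonneg g)]
  have hgs : ‖g‖ ≤ s := by nlinarith [norm_nonneg x, norm_nonneg g, mul_nonneg (norm_nonneg x) (norm_nonneg g)]
  set η := ofRowSplit j (Sum.elim (T₁ *ᵥ x) (B *ᵥ x + T₂ *ᵥ g)) with hη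
  have hηb : ∀ r l, |η r l| ≤ (c₁ + c₂ + c₃) * s := by
    intro r l
    simp only [hη, ofRowSplit]
    rcases (rowSplit j).symm (l, r) with p | l'
    · simp only [Sum.elim_inl]
      calc |(T₁ *ᵥ x) p| ≤ ‖T₁ *ᵥ x‖ := norm_le_pi_norm (T₁ *ᵥ x) p
        _ ≤ c₁ * s := (h₁ x).trans (by gcongr)
        _ ≤ _ := by gcongr; linarith
    · simp only [Sum.elim_inr]
      calc |(B *ᵥ x + T₂ *ᵥ g) l'| ≤ ‖B *ᵥ x + T₂ *ᵥ g‖ :=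
          norm_le_pi_norm (B *ᵥ x + T₂ *ᵥ g) l'
        _ ≤ c₂ * s + c₃ * s := (norm_add_le _ _).trans
          (add_le_add ((h₂ x).trans (by gcongr)) ((h₃ g).trans (by gcongr)))
        _ ≤ _ := by nlinarith
  have hZ : ∀ r l, |missingCoef Γ η r l| ≤ K * s := by
    intro r l
    have h0 : |(Γ.toBlocks₁₂ * Γ.toBlocks₂₂⁻¹) r l| ≤ c₀ :=
      (Finset.single_le_sum (f := fun l => |(Γ.toBlocks₁₂ * Γ.toBlocks₂₂⁻¹) r l|)
        (fun _ _ => abs_nonneg _) (Finset.mem_univ l)).trans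
      (Finset.single_le_sum (f := fun r => ∑ l, |(Γ.toBlocks₁₂ * Γ.toBlocks₂₂⁻¹) r l|)
        (fun _ _ => by positivity) (Finset.mem_univ r))
    calc |missingCoef Γ η r l| ≤ |etaTilde η r l| + |(Γ.toBlocks₁₂ * Γ.toBlocks₂₂⁻¹) r l| :=
          abs_add_le _ _
      _ ≤ (c₁ + c₂ + c₃) * s + c₀ := add_le_add ((abs_etaTilde_le _ _ _).trans (hηb r l)) h0
      _ ≤ K * s := by nlinarith
  have e1 : missingGram Γ SigmaU η *ᵥ v = Γ.toBlocks₂₂⁻¹ *ᵥ v + (missingCoef Γ η)ᵀ *ᵥ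
      ((residualGram Γ SigmaU)⁻¹ *ᵥ (missingCoef Γ η *ᵥ v)) := by
    rw [missingGram, Matrix.add_mulVec, Matrix.mulVec_mulVec, Matrix.mulVec_mulVec,
      Matrix.mul_assoc]
  have hKs : 0 ≤ K * s := by positivity
  have e2 := norm_mulVec_le_of_forall_abs_le hKs hZ v
  have e3 := norm_mulVec_le_of_forall_abs_le hKs
    (fun l r => hZ r l : ∀ l r, |(missingCoef Γ η)ᵀ l r| ≤ K * s)
    ((residualGram Γ SigmaU)⁻¹ *ᵥ (missingCoef Γ η *ᵥ v))
  rw [e1]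
  calc _ ≤ c₄ * ‖v‖ + Fintype.card (ObsIdx k₁ k₂) * (K * s) *
        (c₅ * (Fintype.card (Fin kᵥ) * (K * s) * ‖v‖)) := by
        refine (norm_add_le _ _).trans (add_le_add (h₄ v) (e3.trans ?_))
        gcongr
        exact (h₅ _).trans (by gcongr)
    _ ≤ c₄ * s ^ 2 * ‖v‖ + Fintype.card (ObsIdx k₁ k₂) * (K * s) *
        (c₅ * (Fintype.card (Fin kᵥ) * (K * s) * ‖v‖)) := by
        gcongr
        exact le_mul_of_one_le_right hc₄ (one_le_pow₀ hs1)
    _ = _ := by rw [hs]; ring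

/-- The limit of the estimation error of a weak factor is not normal. -/
lemma not_isGaussian_map_limError (hkᵥ : 1 ≤ kᵥ) (hν : NonsingularNormal ν) (hΓ : Γ.PosDef)
    (hS : SigmaU.PosSemidef) (lam d : ObsIdx k₁ k₂ → ℝ) (b : Fin k₂) :
    ¬ IsGaussian (ν.map fun x => limError Γ SigmaU lam d x.2.1 x.2.2 (Sum.inr b)) := by
  have : Nonempty (Fin kᵥ) := ⟨⟨0, hkᵥ⟩⟩
  obtain ⟨V, hV, hνV⟩ := hν
  set j : ObsIdx k₁ k₂ := Sum.inr b with hj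
  -- Order the coordinates as: other rows of η, row j of η, η_v. In the triangular representation
  -- the second block contributes g₂ through T₂, and η_v contributes the independent g₃ through T₃.
  set e := (rowSplit (kᵥ := kᵥ) j).sumCongr (Equiv.refl (Fin kᵥ)) with he
  obtain ⟨T₁, B, T₂, B', T₃, hT₂, hT₃, hμ⟩ :=
    (hνV.map_reindex e).exists_triangular (hV.submatrix e.injective)
  set δ := (residualGram Γ SigmaU)⁻¹.col j with hδ
  -- A diagonal entry of a positive definite inverse; it makes the matrix A = δ_j T₂ invertible.
  have hδj : 0 < δ j := (posDef_residualGram hΓ hS).inv.diag_pos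
  set H : (((Fin kᵥ × {r : ObsIdx k₁ k₂ // r ≠ j}) ⊕ Fin kᵥ) ⊕ Fin kᵥ → ℝ) → ℝ := fun y =>
    limError Γ SigmaU lam d (ofRowSplit j (y ∘ Sum.inl)) (y ∘ Sum.inr) j with hH
  set η : (Fin kᵥ × {r : ObsIdx k₁ k₂ // r ≠ j} → ℝ) × (Fin kᵥ → ℝ) →
      ObsIdx k₁ k₂ → Fin kᵥ → ℝ := fun p =>
    ofRowSplit j (Sum.elim (T₁ *ᵥ p.1) (B *ᵥ p.1 + T₂ *ᵥ p.2)) with hη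
  have hηc : Continuous η := (continuous_ofRowSplit j).comp
    (continuous_sumElim_pi (Continuous.matrix_mulVec continuous_const continuous_fst)
      ((Continuous.matrix_mulVec continuous_const continuous_fst).add
        (Continuous.matrix_mulVec continuous_const continuous_snd)))
  have hZc : Continuous fun p => missingCoef Γ (η p) := continuous_missingCoef.comp hηc
  have key := not_isGaussian_map_dotProduct (ι := Fin kᵥ × {r : ObsIdx k₁ k₂ // r ≠ j})
    (κ := Fin kᵥ) (a := fun x => (missingCoef Γ (η (x, 0)))ᵀ *ᵥ δ)
    (Q := fun p => missingGram Γ SigmaU (η p))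
    (m := fun p => B' *ᵥ Sum.elim p.1 p.2 - (Matrix.of (η p))ᵀ *ᵥ lam +
      (missingCoef Γ (η p))ᵀ *ᵥ d) (A := δ j • T₂) (L := T₃)
    (Continuous.matrix_mulVec (hZc.comp (by fun_prop)).matrix_transpose continuous_const)
    (continuous_missingGram.comp hηc) (fun z => (posDef_missingGram hΓ hS _).det_pos.ne')
    (exists_norm_missingGram_mulVec_le j T₁ B T₂)
    (((Continuous.matrix_mulVec continuous_const
        (continuous_sumElim_pi continuous_fst continuous_snd)).sub
      (Continuous.matrix_mulVec (Continuous.matrix_transpose hηc) continuous_const)).add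
      (Continuous.matrix_mulVec hZc.matrix_transpose continuous_const))
    (by rw [Matrix.det_smul]; exact mul_ne_zero (pow_ne_zero _ hδj.ne') hT₂) hT₃
  have h1 : Continuous fun y : ((Fin kᵥ × {r : ObsIdx k₁ k₂ // r ≠ j}) ⊕ Fin kᵥ) ⊕ Fin kᵥ → ℝ =>
      (ofRowSplit j (y ∘ Sum.inl), y ∘ Sum.inr) := by
    refine ((continuous_ofRowSplit j).comp ?_).prodMk ?_ <;>
    exact continuous_pi fun i => continuous_apply _
  have hHc : Continuous H := continuous_pi_iff.1 ((continuous_limError hΓ hS lam d).comp h1) j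
  have hstack : Measurable fun x : LimitSpace k₁ k₂ kᵥ =>
      (Sum.elim (vec (Matrix.of x.2.1)) x.2.2 : (Fin kᵥ × ObsIdx k₁ k₂) ⊕ Fin kᵥ → ℝ) :=
    (continuous_sumElim_pi (by unfold vec; simp only [Matrix.of_apply]; fun_prop)
      (by fun_prop)).measurable
  have hcomp : Measurable fun x : (Fin kᵥ × ObsIdx k₁ k₂) ⊕ Fin kᵥ → ℝ => x ∘ e := by
    unfold Function.comp; fun_prop
  have hl : ν.map (fun x => limError Γ SigmaU lam d x.2.1 x.2.2 j) =
      ((ν.map fun x => (Sum.elim (vec (Matrix.of x.2.1)) x.2.2 :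
        (Fin kᵥ × ObsIdx k₁ k₂) ⊕ Fin kᵥ → ℝ)).map fun x => x ∘ e).map H := by
    rw [Measure.map_map hHc.measurable hcomp,
      Measure.map_map (hHc.measurable.comp hcomp) hstack]
    congr 1
    ext1 x
    simp only [hH, Function.comp_apply]
    congr 1
    ext r l
    simp only [ofRowSplit, he, Function.comp_apply, Equiv.sumCongr_apply, Sum.map_inl,
      Equiv.apply_symm_apply, Sum.elim_inl]
    rfl
  have htri : Measurable fun z : (Fin kᵥ × {r : ObsIdx k₁ k₂ // r ≠ j} → ℝ) × (Fin kᵥ → ℝ) ×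
      (Fin kᵥ → ℝ) => (Sum.elim (Sum.elim (T₁ *ᵥ z.1) (B *ᵥ z.1 + T₂ *ᵥ z.2.1))
          (B' *ᵥ Sum.elim z.1 z.2.1 + T₃ *ᵥ z.2.2) :
        ((Fin kᵥ × {r : ObsIdx k₁ k₂ // r ≠ j}) ⊕ Fin kᵥ) ⊕ Fin kᵥ → ℝ) :=
    (continuous_sumElim_pi (continuous_sumElim_pi
      (continuous_const.matrix_mulVec continuous_fst)
      ((continuous_const.matrix_mulVec continuous_fst).add
        (continuous_const.matrix_mulVec (by fun_prop))))
      ((continuous_const.matrix_mulVec (continuous_sumElim_pi (by fun_prop) (by fun_prop))).add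
        (continuous_const.matrix_mulVec (by fun_prop)))).measurable
  rw [hl, hμ, Measure.map_map hHc.measurable htri]
  convert key using 3
  ext1 z
  have e1 : (missingCoef Γ (η (z.1, z.2.1)))ᵀ *ᵥ δ =
      (missingCoef Γ (η (z.1, 0)))ᵀ *ᵥ δ + (δ j • T₂) *ᵥ z.2.1 := by
    simp only [hη, Matrix.mulVec_zero, add_zero]
    rw [missingCoef_transpose_mulVec_ofRowSplit, Matrix.smul_mulVec]
  rw [← e1]
  simp only [hH, Function.comp_apply]
  rw [limError_apply lam hΓ hS]
  congr 1
  change B' *ᵥ Sum.elim z.1 z.2.1 + T₃ *ᵥ z.2.2 - (Matrix.of (η (z.1, z.2.1)))ᵀ *ᵥ lam +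
    (missingCoef Γ (η (z.1, z.2.1)))ᵀ *ᵥ d = _
  abel

lemma continuous_limOV (hΓ : Γ.PosDef) (hS : SigmaU.PosSemidef) (lam : ObsIdx k₁ k₂ → ℝ) :
    Continuous (limOV Γ SigmaU lam) := by
  have h : limOV Γ SigmaU lam = fun x => limError Γ SigmaU lam 0 x.2.1 x.2.2 :=
    funext fun x => limOV_eq_limError lam hΓ x
  rw [h]
  exact (continuous_limError hΓ hS lam 0).comp continuous_snd

lemma continuous_limA (hΓ : Γ.PosDef) (hS : SigmaU.PosSemidef) (lam : ObsIdx k₁ k₂ → ℝ) :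
    Continuous (limA Γ SigmaU lam) :=
  (((continuous_limGram_inv hΓ hS).comp (continuous_fst.comp continuous_snd)).matrix_mulVec
    continuous_const).neg

lemma isGaussian_map_apply {ι Ω : Type*} [Fintype ι] [MeasurableSpace Ω] {μ : Measure Ω}
    {f : Ω → ι → ℝ} (hf : Measurable f) (h : IsGaussian (μ.map f)) (i : ι) :
    IsGaussian (μ.map fun x => f x i) := by
  have h1 : μ.map (fun x => f x i) =
      (μ.map f).map (ContinuousLinearMap.proj (R := ℝ) (φ := fun _ : ι => ℝ) i) := by
    rw [Measure.map_map (by fun_prop) hf]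
    rfl
  rw [h1]
  infer_instance

/-- The limit of the omitted variable bias is not normal. -/
lemma not_isGaussian_map_limOV (hk₂ : 1 ≤ k₂) (hkᵥ : 1 ≤ kᵥ) (hν : NonsingularNormal ν)
    (hΓ : Γ.PosDef) (hS : SigmaU.PosSemidef) (lam : ObsIdx k₁ k₂ → ℝ) :
    ¬ IsGaussian (ν.map (limOV Γ SigmaU lam)) := by
  intro h
  have h1 := isGaussian_map_apply (continuous_limOV hΓ hS lam).measurable h
    (Sum.inr ⟨0, hk₂⟩)
  simp_rw [limOV_eq_limError lam hΓ] at h1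
  exact not_isGaussian_map_limError hkᵥ hν hΓ hS lam 0 _ h1

/-- The limit of the two-pass estimation error on the weak factors is not normal. -/
lemma not_isGaussian_map_limA_add_limOV (hk₂ : 1 ≤ k₂) (hkᵥ : 1 ≤ kᵥ)
    (hν : NonsingularNormal ν) (hΓ : Γ.PosDef) (hS : SigmaU.PosSemidef)
    (lam : ObsIdx k₁ k₂ → ℝ) :
    ¬ IsGaussian (ν.map fun x (b : Fin k₂) =>
      limA Γ SigmaU lam x (Sum.inr b) + limOV Γ SigmaU lam x (Sum.inr b)) := by
  intro h
  set d := (residualGram Γ SigmaU)⁻¹ *ᵥ ((weakProj k₁ k₂ * SigmaU) *ᵥ lam)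
  have hm : Measurable fun x (b : Fin k₂) =>
      limA Γ SigmaU lam x (Sum.inr b) + limOV Γ SigmaU lam x (Sum.inr b) :=
    (continuous_pi fun b => (continuous_pi_iff.1 (continuous_limA hΓ hS lam) _).add
      (continuous_pi_iff.1 (continuous_limOV hΓ hS lam) _)).measurable
  have h1 := isGaussian_map_apply hm h ⟨0, hk₂⟩
  -- Normality of X^A + X^OV would pass to its translate by the constant d, which is `limError`.
  have h2 : (fun x => limError Γ SigmaU lam d x.2.1 x.2.2 (Sum.inr ⟨0, hk₂⟩)) =
      (fun y => y + d (Sum.inr ⟨0, hk₂⟩)) ∘ fun x : LimitSpace k₁ k₂ kᵥ =>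
        limA Γ SigmaU lam x (Sum.inr ⟨0, hk₂⟩) + limOV Γ SigmaU lam x (Sum.inr ⟨0, hk₂⟩) := by
    ext x
    have h3 := congrFun (limA_add_limOV_eq_limError lam hΓ hS x) (Sum.inr ⟨0, hk₂⟩)
    simp only [Pi.add_apply, Pi.sub_apply] at h3
    simp only [Function.comp_apply, h3]
    ring
  refine not_isGaussian_map_limError hkᵥ hν hΓ hS lam d ⟨0, hk₂⟩ ?_
  have hm' : Measurable fun x =>
      limA Γ SigmaU lam x (Sum.inr ⟨0, hk₂⟩) + limOV Γ SigmaU lam x (Sum.inr ⟨0, hk₂⟩) :=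
    measurable_pi_iff.1 hm ⟨0, hk₂⟩
  rw [h2, ← Measure.map_map (by fun_prop) hm']
  infer_instance

end WeakComponents

/-! ### Integrability of the limits, and non-normality of the attenuation limit. -/

section Moments

variable {k₁ k₂ kᵥ : ℕ} {Γ : Matrix (AllIdx k₁ k₂ kᵥ) (AllIdx k₁ k₂ kᵥ) ℝ}
  {SigmaU : Matrix (ObsIdx k₁ k₂) (ObsIdx k₁ k₂) ℝ} {ν : Measure (LimitSpace k₁ k₂ kᵥ)}

lemma continuous_stack : Continuous fun x : LimitSpace k₁ k₂ kᵥ =>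
    (Sum.elim (vec (Matrix.of x.2.1)) x.2.2 : (Fin kᵥ × ObsIdx k₁ k₂) ⊕ Fin kᵥ → ℝ) :=
  continuous_sumElim_pi (by unfold vec; simp only [Matrix.of_apply]; fun_prop) (by fun_prop)

lemma norm_snd_le_norm_stack (x : LimitSpace k₁ k₂ kᵥ) :
    ‖x.2‖ ≤ ‖(Sum.elim (vec (Matrix.of x.2.1)) x.2.2 :
      (Fin kᵥ × ObsIdx k₁ k₂) ⊕ Fin kᵥ → ℝ)‖ := by
  set y := (Sum.elim (vec (Matrix.of x.2.1)) x.2.2 : (Fin kᵥ × ObsIdx k₁ k₂) ⊕ Fin kᵥ → ℝ)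
  refine max_le ?_ ?_
  · exact (pi_norm_le_iff_of_nonneg (norm_nonneg _)).2 fun r =>
      (pi_norm_le_iff_of_nonneg (norm_nonneg _)).2 fun l => norm_le_pi_norm y (Sum.inl (l, r))
  · exact (pi_norm_le_iff_of_nonneg (norm_nonneg _)).2 fun l => norm_le_pi_norm y (Sum.inr l)

lemma NonsingularNormal.integrable_one_add_norm_pow (hν : NonsingularNormal ν) (n : ℕ) :
    Integrable (fun x => (1 + ‖x.2‖) ^ n) ν := by
  obtain ⟨V, -, h⟩ := hν
  have h1 := (integrable_map_measure (Continuous.aestronglyMeasurable (by fun_prop))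
    continuous_stack.measurable.aemeasurable).1 (h.integrable_one_add_norm_pow n)
  refine h1.mono (Continuous.aestronglyMeasurable (by fun_prop)) (Eventually.of_forall fun x => ?_)
  have := norm_snd_le_norm_stack x
  simp only [Function.comp_apply]
  rw [Real.norm_of_nonneg (by positivity), Real.norm_of_nonneg (by positivity)]
  gcongr

lemma NonsingularNormal.isOpenPosMeasure (hν : NonsingularNormal ν) :
    (ν.map fun x => x.2).IsOpenPosMeasure := by
  obtain ⟨V, hV, h⟩ := hν
  have := h.isOpenPosMeasure hV
  set f : ((Fin kᵥ × ObsIdx k₁ k₂) ⊕ Fin kᵥ → ℝ) →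
      (ObsIdx k₁ k₂ → Fin kᵥ → ℝ) × (Fin kᵥ → ℝ) :=
    fun y => (fun r l => y (Sum.inl (l, r)), fun l => y (Sum.inr l)) with hf
  have hfc : Continuous f := by fun_prop
  have h1 : ν.map (fun x => x.2) = (ν.map fun x =>
      (Sum.elim (vec (Matrix.of x.2.1)) x.2.2 : (Fin kᵥ × ObsIdx k₁ k₂) ⊕ Fin kᵥ → ℝ)).map f := by
    rw [Measure.map_map hfc.measurable continuous_stack.measurable]
    rfl
  rw [h1]
  exact hfc.isOpenPosMeasure_map fun p => ⟨Sum.elim (fun q => p.1 q.2 q.1) p.2, rfl⟩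

/-- The law of (η, η_v) charges every nonempty open set, so almost sure identities between
continuous functions hold at every point, in particular at conveniently chosen ones. -/
lemma NonsingularNormal.eq_of_ae_eq (hν : NonsingularNormal ν)
    {f g : (ObsIdx k₁ k₂ → Fin kᵥ → ℝ) × (Fin kᵥ → ℝ) → ℝ} (hf : Continuous f) (hg : Continuous g)
    (h : ∀ᵐ x ∂ν, f x.2 = g x.2) : f = g := by
  have := hν.isOpenPosMeasure
  refine (Continuous.ae_eq_iff_eq (ν.map fun x => x.2) hf hg).1 ?_
  exact (ae_map_iff (by fun_prop) (measurableSet_eq_fun hf.measurable hg.measurable)).2 h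

lemma abs_dotProduct_le {n : Type*} [Fintype n] (v w : n → ℝ) :
    |v ⬝ᵥ w| ≤ Fintype.card n * ‖v‖ * ‖w‖ := by
  calc |v ⬝ᵥ w| ≤ ∑ i, |v i * w i| := Finset.abs_sum_le_sum_abs _ _
    _ ≤ ∑ _i : n, ‖v‖ * ‖w‖ := Finset.sum_le_sum fun i _ => by
        rw [abs_mul]
        exact mul_le_mul (norm_le_pi_norm v i) (norm_le_pi_norm w i) (abs_nonneg _) (norm_nonneg _)
    _ = _ := by simp; ring

/-- Coercivity of M with a constant independent of η. Therefore X^A is bounded, and the inverse does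
not spoil the moments of X^OV. -/
lemma exists_norm_limGram_inv_mulVec_le (hΓ : Γ.PosDef) (hS : SigmaU.PosSemidef) :
    ∃ C, 0 ≤ C ∧ ∀ η y, ‖(limGram Γ SigmaU η)⁻¹ *ᵥ y‖ ≤ C * ‖y‖ := by
  obtain ⟨c, hc, h⟩ := hΓ.exists_pos_mul_le
  refine ⟨Fintype.card (ObsIdx k₁ k₂) / c, by positivity, fun η y => ?_⟩
  set w := (limGram Γ SigmaU η)⁻¹ *ᵥ y with hw
  have h1 : limGram Γ SigmaU η *ᵥ w = y := by
    rw [hw, Matrix.mulVec_mulVec, Matrix.mul_nonsing_inv _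
      (isUnit_iff_ne_zero.2 (posDef_limGram hΓ hS η).det_pos.ne'), Matrix.one_mulVec]
  have h2 := mul_le_dotProduct_limGram_mulVec hS hc.le h η w
  rw [h1] at h2
  have h3 := (le_abs_self _).trans (abs_dotProduct_le w y)
  have h4 := norm_sq_le_dotProduct w
  rcases (norm_nonneg w).eq_or_lt with h0 | h0
  · rw [← h0]; positivity
  · rw [div_mul_eq_mul_div, le_div_iff₀ hc]
    refine le_of_mul_le_mul_left ?_ h0
    nlinarith

/-- A bound on the deviation of the second-pass scores, uniform over the noise. -/
lemma exists_norm_scores_mulVec_le (Γ : Matrix (AllIdx k₁ k₂ kᵥ) (AllIdx k₁ k₂ kᵥ) ℝ) :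
    ∃ C, 0 ≤ C ∧ ∀ (η : ObsIdx k₁ k₂ → Fin kᵥ → ℝ) y,
      ‖(Γ.toBlocks₁₂ + etaTilde η * Γ.toBlocks₂₂) *ᵥ y‖ ≤ C * (1 + ‖η‖) * ‖y‖ := by
  obtain ⟨c₁, hc₁, h₁⟩ := exists_norm_mulVec_le Γ.toBlocks₁₂
  obtain ⟨c₂, hc₂, h₂⟩ := exists_norm_mulVec_le Γ.toBlocks₂₂
  refine ⟨c₁ + Fintype.card (Fin kᵥ) * c₂, by positivity, fun η y => ?_⟩
  rw [Matrix.add_mulVec, ← Matrix.mulVec_mulVec]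
  have h3 := norm_mulVec_le_of_forall_abs_le (M := etaTilde η) (norm_nonneg η) (fun r l =>
    (abs_etaTilde_le η r l).trans ((norm_le_pi_norm (η r) l).trans (norm_le_pi_norm η r)))
    (Γ.toBlocks₂₂ *ᵥ y)
  calc _ ≤ c₁ * ‖y‖ + Fintype.card (Fin kᵥ) * ‖η‖ * (c₂ * ‖y‖) :=
        (norm_add_le _ _).trans (add_le_add (h₁ y) (h3.trans (by gcongr; exact h₂ y)))
    _ ≤ _ := by
        have : 0 ≤ c₁ * ‖η‖ * ‖y‖ := by positivity
        have : 0 ≤ Fintype.card (Fin kᵥ) * c₂ * ‖y‖ := by positivity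
        nlinarith

lemma norm_of_transpose_mulVec_le (η : ObsIdx k₁ k₂ → Fin kᵥ → ℝ) (y : ObsIdx k₁ k₂ → ℝ) :
    ‖(Matrix.of η)ᵀ *ᵥ y‖ ≤ Fintype.card (ObsIdx k₁ k₂) * ‖η‖ * ‖y‖ :=
  norm_mulVec_le_of_forall_abs_le (norm_nonneg η) (fun l r =>
    (norm_le_pi_norm (η r) l).trans (norm_le_pi_norm η r)) y

/-- The inverse is bounded, while scores and noise grow at most linearly in (η, η_v); hence
quadratic growth. -/
lemma integrable_limOV (hν : NonsingularNormal ν) (hΓ : Γ.PosDef) (hS : SigmaU.PosSemidef)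
    (lam : ObsIdx k₁ k₂ → ℝ) : Integrable (limOV Γ SigmaU lam) ν := by
  obtain ⟨C₁, hC₁, h₁⟩ := exists_norm_limGram_inv_mulVec_le hΓ hS
  obtain ⟨C₂, hC₂, h₂⟩ := exists_norm_scores_mulVec_le Γ
  set c := Fintype.card (ObsIdx k₁ k₂) * ‖lam‖
  refine ((hν.integrable_one_add_norm_pow 2).const_mul (C₁ * C₂ * (1 + c))).mono'
    (continuous_limOV hΓ hS lam).aestronglyMeasurable (Eventually.of_forall fun x => ?_)
  have hη : ‖x.2.1‖ ≤ ‖x.2‖ := norm_fst_le _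
  have hv : ‖x.2.2‖ ≤ ‖x.2‖ := norm_snd_le _
  have h3 : ‖x.2.2 - (Matrix.of x.2.1)ᵀ *ᵥ lam‖ ≤ (1 + c) * (1 + ‖x.2‖) := by
    have hc : 0 ≤ c := by positivity
    calc _ ≤ ‖x.2‖ + Fintype.card (ObsIdx k₁ k₂) * ‖x.2‖ * ‖lam‖ := (norm_sub_le _ _).trans
          (add_le_add hv ((norm_of_transpose_mulVec_le _ _).trans (by gcongr)))
      _ = (1 + c) * ‖x.2‖ := by ring
      _ ≤ _ := by gcongr; linarith
  calc ‖limOV Γ SigmaU lam x‖ ≤ C₁ * (C₂ * (1 + ‖x.2.1‖) * ‖x.2.2 - (Matrix.of x.2.1)ᵀ *ᵥ lam‖) :=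
        (h₁ _ _).trans (by gcongr; exact h₂ _ _)
    _ ≤ C₁ * (C₂ * (1 + ‖x.2‖) * ((1 + c) * (1 + ‖x.2‖))) := by gcongr
    _ = _ := by ring

lemma integrable_limA [IsProbabilityMeasure ν] (hΓ : Γ.PosDef) (hS : SigmaU.PosSemidef)
    (lam : ObsIdx k₁ k₂ → ℝ) : Integrable (limA Γ SigmaU lam) ν := by
  obtain ⟨C₁, hC₁, h₁⟩ := exists_norm_limGram_inv_mulVec_le hΓ hS
  refine Integrable.of_bound (continuous_limA hΓ hS lam).aestronglyMeasurable
    (C₁ * ‖(weakProj k₁ k₂ * SigmaU) *ᵥ lam‖) (Eventually.of_forall fun x => ?_)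
  rw [limA, norm_neg]
  exact h₁ _ _

/-- With c = 𝓘 Σ_u λ this is -c'M⁻¹c. The sign is behind both the nonzero mean and the non-normality
of X^A. -/
lemma dotProduct_limA_neg (hΓ : Γ.PosDef) (hS : SigmaU.PosSemidef) {lam : ObsIdx k₁ k₂ → ℝ}
    (hc : (weakProj k₁ k₂ * SigmaU) *ᵥ lam ≠ 0) (x : LimitSpace k₁ k₂ kᵥ) :
    ((weakProj k₁ k₂ * SigmaU) *ᵥ lam) ⬝ᵥ limA Γ SigmaU lam x < 0 := by
  have h := (posDef_limGram hΓ hS x.2.1).inv.dotProduct_mulVec_pos hc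
  rw [star_trivial] at h
  rw [limA, dotProduct_neg]
  linarith

lemma integral_limA_ne_zero [IsProbabilityMeasure ν] (hΓ : Γ.PosDef) (hS : SigmaU.PosSemidef)
    {lam : ObsIdx k₁ k₂ → ℝ} (hc : (weakProj k₁ k₂ * SigmaU) *ᵥ lam ≠ 0) :
    ∫ x, limA Γ SigmaU lam x ∂ν ≠ 0 := by
  set c := (weakProj k₁ k₂ * SigmaU) *ᵥ lam
  intro h0
  have hI := integrable_limA (ν := ν) hΓ hS lam
  have hIi : ∀ i, Integrable (fun x => limA Γ SigmaU lam x i) ν := fun i => hI.eval i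
  have h1 : ∫ x, c ⬝ᵥ limA Γ SigmaU lam x ∂ν = 0 := by
    simp only [dotProduct]
    rw [integral_finsetSum _ fun i _ => (hIi i).const_mul _]
    refine Finset.sum_eq_zero fun i _ => ?_
    rw [integral_const_mul, ← eval_integral hIi, h0, Pi.zero_apply, mul_zero]
  have h2 : Integrable (fun x => -(c ⬝ᵥ limA Γ SigmaU lam x)) ν := by
    simp only [dotProduct]
    exact (integrable_finsetSum _ fun i _ => (hIi i).const_mul _).neg
  have h3 : 0 < ∫ x, -(c ⬝ᵥ limA Γ SigmaU lam x) ∂ν := by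
    rw [integral_pos_iff_support_of_nonneg
      (fun x => (neg_pos.2 (dotProduct_limA_neg hΓ hS hc x)).le) h2]
    have : Function.support (fun x => -(c ⬝ᵥ limA Γ SigmaU lam x)) = Set.univ :=
      Set.eq_univ_of_forall fun x => (neg_pos.2 (dotProduct_limA_neg hΓ hS hc x)).ne'
    rw [this, measure_univ]
    exact one_pos
  rw [integral_neg, h1, neg_zero] at h3
  exact h3.false

/-- A normal law on the line which gives no mass to a half-line is a point mass. -/
lemma IsGaussian.eq_dirac_of_measure_Ioi {μ : Measure ℝ} (h : IsGaussian μ)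
    (h0 : μ (Set.Ioi 0) = 0) : ∃ a, μ = Measure.dirac a := by
  rw [h.eq_gaussianReal] at h0 ⊢
  by_cases hv : (Var[id; μ]).toNNReal = 0
  · exact ⟨_, by rw [hv, gaussianReal_zero_var]⟩
  -- With positive variance, Lebesgue measure is absolutely continuous with respect to the law, and
  -- the half-line is not Lebesgue null.
  · have := gaussianReal_absolutelyContinuous' (∫ x, id x ∂μ) hv h0
    simp at this

/-- The limit of the attenuation bias is not normal. -/
lemma not_isGaussian_map_limA (hkᵥ : 1 ≤ kᵥ) (hν : NonsingularNormal ν) (hΓ : Γ.PosDef)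
    (hS : SigmaU.PosSemidef) {lam : ObsIdx k₁ k₂ → ℝ}
    (hc : (weakProj k₁ k₂ * SigmaU) *ᵥ lam ≠ 0) : ¬ IsGaussian (ν.map (limA Γ SigmaU lam)) := by
  intro hG
  set c := (weakProj k₁ k₂ * SigmaU) *ᵥ lam with hcdef
  have hA := (continuous_limA hΓ hS lam).measurable
  have hdot : Measurable fun y : ObsIdx k₁ k₂ → ℝ => c ⬝ᵥ y := measurable_dotProduct_left c
  have h1 : IsGaussian (ν.map fun x => c ⬝ᵥ limA Γ SigmaU lam x) := by
    have : ν.map (fun x => c ⬝ᵥ limA Γ SigmaU lam x) = (ν.map (limA Γ SigmaU lam)).map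
        (LinearMap.toContinuousLinearMap (dotProductBilin ℝ ℝ c)) := by
      rw [Measure.map_map (by fun_prop) hA]
      rfl
    rw [this]
    infer_instance
  obtain ⟨a, ha⟩ := IsGaussian.eq_dirac_of_measure_Ioi h1 (by
    have hm : Measurable fun x => c ⬝ᵥ limA Γ SigmaU lam x := hdot.comp hA
    rw [Measure.map_apply hm measurableSet_Ioi]
    convert measure_empty (μ := ν)
    ext x
    simpa using (dotProduct_limA_neg hΓ hS hc x).le)
  have h2 : ∀ᵐ x ∂ν, c ⬝ᵥ limA Γ SigmaU lam x = a := by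
    have h3 : ∀ᵐ y ∂(ν.map fun x => c ⬝ᵥ limA Γ SigmaU lam x), y = a := by
      rw [ha, ae_dirac_eq]; rfl
    exact ae_of_ae_map (hdot.comp hA).aemeasurable h3
  -- Full support turns almost sure constancy into constancy for every η, which the rest of the
  -- proof contradicts.
  have h4 := hν.eq_of_ae_eq (f := fun p => c ⬝ᵥ -((limGram Γ SigmaU p.1)⁻¹ *ᵥ c))
    (g := fun _ => a) (continuous_const.dotProduct
      (((continuous_limGram_inv hΓ hS).comp continuous_fst).matrix_mulVec continuous_const).neg)
    continuous_const h2
  set l₀ : Fin kᵥ := ⟨0, hkᵥ⟩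
  have ha0 : a < 0 := by
    have h5 := dotProduct_limA_neg hΓ hS hc (0 : LimitSpace k₁ k₂ kᵥ)
    have h6 := congrFun h4 (0 : LimitSpace k₁ k₂ kᵥ).2
    rw [← h6]; exact h5
  obtain ⟨θ, hθ, hΘ⟩ := (posDef_toBlocks₂₂ hΓ).exists_pos_mul_le
  obtain ⟨C, hC, hinv⟩ := exists_norm_limGram_inv_mulVec_le hΓ hS
  set C0 := Γ.toBlocks₁₂ * Γ.toBlocks₂₂⁻¹ with hC0
  obtain ⟨K, hK, hKb⟩ := exists_norm_mulVec_le C0ᵀ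
  have hwc : weakProj k₁ k₂ *ᵥ c = c := by
    rw [hcdef, Matrix.mulVec_mulVec, ← Matrix.mul_assoc]
    congr 2
    ext i j
    rw [weakProj, Matrix.diagonal_mul_diagonal, Matrix.diagonal_apply, Matrix.diagonal_apply]
    rcases i with i | i <;> simp
  -- Take η = s c e' with e a unit vector, and w = M⁻¹c, so c'w = -a. One coordinate of Z'w is s(-a)
  -- plus a remainder r bounded uniformly in s, since w is bounded; but θ|Z'w|² ≤ w'Mw = -a.
  have key : ∀ s : ℝ, ∃ r, |r| ≤ K * (C * ‖c‖) ∧ θ * (s * -a + r) ^ 2 ≤ -a := by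
    intro s
    set η : ObsIdx k₁ k₂ → Fin kᵥ → ℝ := fun i l => (s • vecMulVec c (Pi.single l₀ 1)) i l with hη
    set w := (limGram Γ SigmaU η)⁻¹ *ᵥ c with hw
    have hcw : c ⬝ᵥ w = -a := by
      have := congrFun h4 (η, 0)
      simp only [dotProduct_neg] at this
      rw [← this, neg_neg]
    have hMw : limGram Γ SigmaU η *ᵥ w = c := by
      rw [hw, Matrix.mulVec_mulVec, Matrix.mul_nonsing_inv _
        (isUnit_iff_ne_zero.2 (posDef_limGram hΓ hS η).det_pos.ne'), Matrix.one_mulVec]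
    have hZ : missingCoef Γ η = s • vecMulVec c (Pi.single l₀ 1) + C0 := by
      rw [missingCoef, etaTilde, show Matrix.of η = s • vecMulVec c (Pi.single l₀ 1) from rfl,
        Matrix.mul_smul, Matrix.mul_vecMulVec, hwc]
    have hZw : ((missingCoef Γ η)ᵀ *ᵥ w) l₀ = s * -a + (C0ᵀ *ᵥ w) l₀ := by
      rw [hZ, Matrix.transpose_add, Matrix.add_mulVec, Matrix.transpose_smul,
        Matrix.transpose_vecMulVec, Matrix.smul_mulVec, Matrix.vecMulVec_mulVec, hcw]
      simp
    refine ⟨(C0ᵀ *ᵥ w) l₀, (norm_le_pi_norm (C0ᵀ *ᵥ w) l₀).trans ((hKb w).trans ?_), ?_⟩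
    · gcongr; exact hinv _ _
    · have h7 : w ⬝ᵥ limGram Γ SigmaU η *ᵥ w =
          ((missingCoef Γ η)ᵀ *ᵥ w) ⬝ᵥ Γ.toBlocks₂₂ *ᵥ ((missingCoef Γ η)ᵀ *ᵥ w) +
            w ⬝ᵥ residualGram Γ SigmaU *ᵥ w := by
        rw [limGram_eq hΓ, Matrix.add_mulVec, dotProduct_add, ← Matrix.mulVec_mulVec,
          ← Matrix.mulVec_mulVec, Matrix.dotProduct_mulVec, ← Matrix.mulVec_transpose]
      have h8 : 0 ≤ w ⬝ᵥ residualGram Γ SigmaU *ᵥ w := by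
        simpa using (posDef_residualGram hΓ hS).posSemidef.dotProduct_mulVec_nonneg w
      have h9 : ((missingCoef Γ η)ᵀ *ᵥ w) l₀ ^ 2 ≤
          ((missingCoef Γ η)ᵀ *ᵥ w) ⬝ᵥ ((missingCoef Γ η)ᵀ *ᵥ w) := by
        rw [pow_two]
        exact Finset.single_le_sum (f := fun l => ((missingCoef Γ η)ᵀ *ᵥ w) l *
          ((missingCoef Γ η)ᵀ *ᵥ w) l) (fun l _ => mul_self_nonneg _) (Finset.mem_univ l₀)
      rw [hMw, dotProduct_comm, hcw] at h7
      rw [← hZw, h7]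
      nlinarith [hΘ ((missingCoef Γ η)ᵀ *ᵥ w)]
  set R := K * (C * ‖c‖)
  -- With R the bound on |r|, this s makes the coordinate at least 1 + q for q = -a/θ > 0, whereas
  -- its square is at most q.
  obtain ⟨r, hr, h5⟩ := key ((R + 1 - a / θ) / -a)
  rw [div_mul_cancel₀ _ (neg_pos.2 ha0).ne'] at h5
  have h6 : 0 < -a / θ := div_pos (neg_pos.2 ha0) hθ
  have h7 : 1 + -a / θ ≤ R + 1 - a / θ + r := by
    have := neg_abs_le r
    rw [neg_div]
    linarith
  have h8 : -a = θ * (-a / θ) := by field_simp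
  have h9 : (1 + -a / θ) ^ 2 ≤ (R + 1 - a / θ + r) ^ 2 := pow_le_pow_left₀ (by linarith) h7 2
  have h10 : (1 + -a / θ) ^ 2 ≤ -a / θ := by
    refine le_of_mul_le_mul_left ?_ hθ
    rw [← h8]
    exact (mul_le_mul_of_nonneg_left h9 hθ.le).trans h5
  nlinarith [sq_nonneg (-a / θ)]

end Moments

/-! ### Analyticity of means of resolvents. -/

section Resolvent

/-- An integral depending holomorphically on a parameter, under a uniform integrable bound. -/
lemma differentiableOn_integral_of_bound {α : Type*} [MeasurableSpace α] {μ : Measure α}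
    {f : ℂ → α → ℂ} {U : Set ℂ} (hU : IsOpen U) (hm : ∀ z ∈ U, AEStronglyMeasurable (f z) μ)
    (hd : ∀ a, DifferentiableOn ℂ (fun z => f z a) U) {g : α → ℝ} (hg : Integrable g μ)
    (hb : ∀ z ∈ U, ∀ a, ‖f z a‖ ≤ g a) : DifferentiableOn ℂ (fun z => ∫ a, f z a ∂μ) U := by
  intro z₀ hz₀
  obtain ⟨ε, hε, hεU⟩ := Metric.isOpen_iff.1 hU z₀ hz₀
  -- Room for discs of radius ε/4, on which Cauchy's estimate bounds the derivative by g/(ε/4).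
  have hsub : ∀ z ∈ Metric.ball z₀ (ε / 2), Metric.closedBall z (ε / 4) ⊆ U := fun z hz w hw => by
    refine hεU ?_
    rw [Metric.mem_ball] at hz ⊢
    rw [Metric.mem_closedBall] at hw
    linarith [dist_triangle w z z₀]
  have hzU : ∀ z ∈ Metric.ball z₀ (ε / 2), z ∈ U := fun z hz =>
    hsub z hz (Metric.mem_closedBall_self (by positivity))
  have hder : ∀ a, ∀ z ∈ U, HasDerivAt (fun z => f z a) (deriv (fun z => f z a) z) z :=
    fun a z hz => ((hd a z hz).differentiableAt (hU.mem_nhds hz)).hasDerivAt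
  refine ((hasDerivAt_integral_of_dominated_loc_of_deriv_le (μ := μ) (F := f)
    (F' := fun z a => deriv (fun z => f z a) z) (bound := fun a => g a / (ε / 4))
    (Metric.ball_mem_nhds z₀ (half_pos hε)) ?_ ?_ ?_ ?_ (hg.div_const _)
    ?_).2.differentiableAt).differentiableWithinAt
  · filter_upwards [hU.mem_nhds hz₀] with z hz using hm z hz
  · exact hg.mono' (hm z₀ hz₀) (Eventually.of_forall (hb z₀ hz₀))
  -- The derivative at z₀ is measurable as a limit of difference quotients along a real null
  -- sequence.
  · obtain ⟨u, -, hu, hu0⟩ := exists_seq_strictAnti_tendsto' (half_pos hε)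
    have hz : ∀ k, z₀ + (u k : ℂ) ∈ U := fun k => by
      refine hzU _ ?_
      rw [Metric.mem_ball, dist_eq_norm, add_sub_cancel_left, Complex.norm_real, Real.norm_eq_abs,
        abs_of_pos (hu k).1]
      exact (hu k).2
    refine aestronglyMeasurable_of_tendsto_ae atTop
      (f := fun k a => (u k : ℂ)⁻¹ • (f (z₀ + (u k : ℂ)) a - f z₀ a))
      (fun k => ((hm _ (hz k)).sub (hm _ hz₀)).const_smul ((u k : ℂ)⁻¹)) (Eventually.of_forall fun a => ?_)
    have h1 := (hasDerivAt_iff_tendsto_slope_zero.1 (hder a z₀ hz₀))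
    refine h1.comp (tendsto_nhdsWithin_iff.2 ⟨?_, Eventually.of_forall fun k => ?_⟩)
    · rw [← Complex.ofReal_zero]
      exact (Complex.continuous_ofReal.tendsto 0).comp hu0
    · simpa using (hu k).1.ne'
  · refine Eventually.of_forall fun a z hz => ?_
    refine Complex.norm_deriv_le_of_forall_mem_sphere_norm_le (by positivity) ?_ fun w hw =>
      hb w (hsub z hz (Metric.sphere_subset_closedBall hw)) a
    exact ((hd a).mono (hsub z hz)).diffContOnCl_ball subset_rfl
  · exact Eventually.of_forall fun a z hz => hder a z (hzU z hz)

/-- A holomorphic function that does not vanish identically vanishes almost nowhere on the real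
line. -/
lemma ae_ne_zero_of_differentiableOn {f : ℂ → ℂ} {c : ℝ}
    (hf : DifferentiableOn ℂ f {z | -c < z.re}) {t₀ : ℝ} (ht₀ : -c < t₀) (h0 : f t₀ ≠ 0) :
    ∀ᵐ t : ℝ, -c < t → f t ≠ 0 := by
  have hU : IsOpen {z : ℂ | -c < z.re} := isOpen_lt continuous_const Complex.continuous_re
  -- On the real half-line f is real analytic. Since the half-line is connected, its zeros there
  -- form a discrete, hence null, set.
  have h1 : AnalyticOnNhd ℝ (fun t : ℝ => f t) (Set.Ioi (-c)) := by
    intro t ht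
    have h2 : AnalyticAt ℂ f (t : ℂ) := hf.analyticAt (hU.mem_nhds (by simpa using ht))
    exact (h2.restrictScalars (𝕜 := ℝ)).comp_of_eq (Complex.ofRealCLM.analyticAt t) rfl
  have h3 := h1.preimage_zero_mem_codiscreteWithin (x := t₀) h0 ht₀
    (isConnected_Ioi)
  have h4 := ae_restrict_le_codiscreteWithin (μ := volume) measurableSet_Ioi h3
  filter_upwards [(ae_restrict_iff' measurableSet_Ioi).1 h4] with t ht h5
  exact ht h5

variable {n : Type*} [Fintype n] [DecidableEq n]

lemma differentiable_matrix_det {B : ℂ → Matrix n n ℂ}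
    (hB : ∀ i j, Differentiable ℂ fun z => B z i j) : Differentiable ℂ fun z => (B z).det := by
  simp_rw [Matrix.det_apply']
  fun_prop

lemma differentiableOn_matrix_inv_mulVec {B : ℂ → Matrix n n ℂ}
    (hB : ∀ i j, Differentiable ℂ fun z => B z i j) {U : Set ℂ} (hU : ∀ z ∈ U, (B z).det ≠ 0)
    (y : n → ℂ) (i : n) : DifferentiableOn ℂ (fun z => ((B z)⁻¹ *ᵥ y) i) U := by
  simp_rw [Matrix.mulVec, dotProduct, Matrix.inv_def, Ring.inverse_eq_inv', Matrix.smul_apply,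
    Matrix.adjugate_apply]
  refine DifferentiableOn.fun_sum fun j _ => DifferentiableOn.mul_const (DifferentiableOn.fun_smul
    ((differentiable_matrix_det hB).differentiableOn.fun_inv hU)
    (differentiable_matrix_det fun k l => ?_).differentiableOn) _
  by_cases h : k = j
  · subst h; simp
  · simpa [Matrix.updateRow_ne h] using hB k l

/-- The matrix `A + z I` over the complex numbers. -/
noncomputable def complexShift (A : Matrix n n ℝ) (z : ℂ) : Matrix n n ℂ :=
  A.map Complex.ofReal + z • (1 : Matrix n n ℂ)

omit [Fintype n] in
lemma complexShift_apply (A : Matrix n n ℝ) (z : ℂ) (i j : n) :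
    complexShift A z i j = A i j + z * (1 : Matrix n n ℂ) i j := by
  simp [complexShift]

lemma complexShift_mulVec (A : Matrix n n ℝ) (z : ℂ) (w : n → ℂ) :
    complexShift A z *ᵥ w = A.map Complex.ofReal *ᵥ w + z • w := by
  rw [complexShift, Matrix.add_mulVec, Matrix.smul_mulVec, Matrix.one_mulVec]

omit [DecidableEq n] in
lemma re_star_dotProduct_mulVec (A : Matrix n n ℝ) (w : n → ℂ) :
    (star w ⬝ᵥ A.map Complex.ofReal *ᵥ w).re =
      (fun i => (w i).re) ⬝ᵥ A *ᵥ (fun i => (w i).re) +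
        (fun i => (w i).im) ⬝ᵥ A *ᵥ (fun i => (w i).im) := by
  simp [dotProduct, Matrix.mulVec, ← Finset.sum_add_distrib, Complex.mul_re]

variable {A : Matrix n n ℝ} {c : ℝ} (hA : ∀ x : n → ℝ, c * (x ⬝ᵥ x) ≤ x ⬝ᵥ A *ᵥ x)
include hA

/-- The real part of w*(A + z)w is at least (c + Re z) times the Euclidean norm squared, as the real
and imaginary parts of w separate for a real matrix. The dimension appears because norms are sup
norms. -/
lemma mul_norm_le_norm_complexShift_mulVec {z : ℂ} (hz : -c < z.re) (w : n → ℂ) :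
    (c + z.re) * ‖w‖ ≤ Fintype.card n * ‖complexShift A z *ᵥ w‖ := by
  set v := complexShift A z *ᵥ w with hv
  have h1 : (star w ⬝ᵥ v).re = (fun i => (w i).re) ⬝ᵥ A *ᵥ (fun i => (w i).re) +
      (fun i => (w i).im) ⬝ᵥ A *ᵥ (fun i => (w i).im) + z.re * ∑ i, ‖w i‖ ^ 2 := by
    rw [hv, complexShift_mulVec, dotProduct_add, Complex.add_re, re_star_dotProduct_mulVec,
      dotProduct_smul, smul_eq_mul]
    congr 1
    have : star w ⬝ᵥ w = ((∑ i, ‖w i‖ ^ 2 : ℝ) : ℂ) := by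
      push_cast
      exact Finset.sum_congr rfl fun i _ => by
        simp [← Complex.conj_mul']
    rw [this, Complex.re_mul_ofReal]
  have h2 : ∑ i, ‖w i‖ ^ 2 = (fun i => (w i).re) ⬝ᵥ (fun i => (w i).re) +
      (fun i => (w i).im) ⬝ᵥ (fun i => (w i).im) := by
    simp only [dotProduct, ← Finset.sum_add_distrib, Complex.sq_norm, Complex.normSq_apply]
  have h3 : (c + z.re) * ∑ i, ‖w i‖ ^ 2 ≤ (star w ⬝ᵥ v).re := by
    rw [h1, add_mul]
    refine add_le_add_left ?_ _
    rw [h2, mul_add]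
    exact add_le_add (hA _) (hA _)
  have h4 : ‖star w ⬝ᵥ v‖ ≤ Fintype.card n * ‖w‖ * ‖v‖ := by
    calc ‖star w ⬝ᵥ v‖ ≤ ∑ i, ‖star w i * v i‖ := norm_sum_le _ _
      _ ≤ ∑ _i : n, ‖w‖ * ‖v‖ := Finset.sum_le_sum fun i _ => by
        rw [norm_mul, Pi.star_apply, norm_star]
        exact mul_le_mul (norm_le_pi_norm w i) (norm_le_pi_norm v i) (norm_nonneg _)
          (norm_nonneg _)
      _ = _ := by simp; ring
  have h5 : ‖w‖ ^ 2 ≤ ∑ i, ‖w i‖ ^ 2 := by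
    have h0 : 0 ≤ ∑ i, ‖w i‖ ^ 2 := by positivity
    refine (Real.le_sqrt (norm_nonneg _) h0).1 ?_
    refine (pi_norm_le_iff_of_nonneg (Real.sqrt_nonneg _)).2 fun i => ?_
    exact Real.le_sqrt_of_sq_le
      (Finset.single_le_sum (f := fun i => ‖w i‖ ^ 2) (fun _ _ => by positivity) (Finset.mem_univ i))
  have h6 := (Complex.re_le_norm _).trans h4
  rcases (norm_nonneg w).eq_or_lt with h0 | h0
  · rw [← h0]; simp; positivity
  · refine le_of_mul_le_mul_left ?_ h0
    have : 0 < c + z.re := by linarith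
    nlinarith [mul_le_mul_of_nonneg_left h5 this.le]

lemma det_complexShift_ne_zero {z : ℂ} (hz : -c < z.re) : (complexShift A z).det ≠ 0 := by
  intro h
  obtain ⟨w, hw0, hw⟩ := Matrix.exists_mulVec_eq_zero_iff.2 h
  have h1 := mul_norm_le_norm_complexShift_mulVec hA hz w
  rw [hw, norm_zero, mul_zero] at h1
  have h2 : 0 < ‖w‖ := norm_pos_iff.2 hw0
  nlinarith

lemma norm_complexShift_inv_mulVec_le {z : ℂ} (hz : -c < z.re) (v : n → ℂ) :
    ‖(complexShift A z)⁻¹ *ᵥ v‖ ≤ Fintype.card n / (c + z.re) * ‖v‖ := by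
  have h1 := mul_norm_le_norm_complexShift_mulVec hA hz ((complexShift A z)⁻¹ *ᵥ v)
  rw [Matrix.mulVec_mulVec, Matrix.mul_nonsing_inv _
    (isUnit_iff_ne_zero.2 (det_complexShift_ne_zero hA hz)), Matrix.one_mulVec] at h1
  rw [div_mul_eq_mul_div, le_div_iff₀ (by linarith), mul_comm]
  exact h1

lemma complexShift_inv_mulVec_ofReal {t : ℝ} (ht : -c < t) (y : n → ℝ) (hd : (A + t • 1).det ≠ 0)
    (i : n) : ((complexShift A t)⁻¹ *ᵥ fun j => (y j : ℂ)) i = (((A + t • 1)⁻¹ *ᵥ y) i : ℝ) := by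
  set w := (A + t • 1)⁻¹ *ᵥ y with hw
  have h1 : (A + t • 1) *ᵥ w = y := by
    rw [hw, Matrix.mulVec_mulVec, Matrix.mul_nonsing_inv _ (isUnit_iff_ne_zero.2 hd),
      Matrix.one_mulVec]
  have h2 : complexShift A t *ᵥ (fun j => (w j : ℂ)) = fun j => (y j : ℂ) := by
    ext j
    rw [complexShift_mulVec, ← h1, Matrix.add_mulVec, Matrix.smul_mulVec, Matrix.one_mulVec]
    simp [Matrix.mulVec, dotProduct]
  rw [← h2, Matrix.mulVec_mulVec, Matrix.nonsing_inv_mul _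
    (isUnit_iff_ne_zero.2 (det_complexShift_ne_zero hA (by simpa using ht))), Matrix.one_mulVec]

/-- t(A + t)⁻¹v = v - (A + t)⁻¹Av, and the resolvent is O(1/t). -/
lemma tendsto_smul_complexShift_inv_mulVec (v : n → ℂ) :
    Tendsto (fun t : ℝ => (t : ℂ) • ((complexShift A t)⁻¹ *ᵥ v)) atTop (𝓝 v) := by
  have h1 : ∀ t : ℝ, -c < t → v - (complexShift A t)⁻¹ *ᵥ (A.map Complex.ofReal *ᵥ v) =
      (t : ℂ) • ((complexShift A t)⁻¹ *ᵥ v) := by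
    intro t ht
    have h2 : A.map Complex.ofReal *ᵥ v = complexShift A t *ᵥ v - (t : ℂ) • v := by
      rw [complexShift_mulVec, add_sub_cancel_right]
    rw [h2, Matrix.mulVec_sub, Matrix.mulVec_mulVec, Matrix.nonsing_inv_mul _
      (isUnit_iff_ne_zero.2 (det_complexShift_ne_zero hA (by simpa using ht))), Matrix.one_mulVec,
      sub_sub_cancel, Matrix.mulVec_smul]
  have h3 : Tendsto (fun t : ℝ => (complexShift A t)⁻¹ *ᵥ (A.map Complex.ofReal *ᵥ v))
      atTop (𝓝 0) := by
    refine squeeze_zero_norm' (a := fun t : ℝ => Fintype.card n / (c + t) *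
      ‖A.map Complex.ofReal *ᵥ v‖) ?_ ?_
    · filter_upwards [eventually_gt_atTop (-c)] with t ht
      simpa using norm_complexShift_inv_mulVec_le hA (z := t) (by simpa using ht)
        (A.map Complex.ofReal *ᵥ v)
    · rw [← zero_mul ‖A.map Complex.ofReal *ᵥ v‖]
      exact (tendsto_const_nhds.div_atTop (tendsto_atTop_add_const_left _ c tendsto_id)).mul_const _
  have h4 := (tendsto_const_nhds (x := v)).sub h3
  rw [sub_zero] at h4
  refine h4.congr' ?_
  filter_upwards [eventually_gt_atTop (-c)] with t ht using h1 t ht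

omit hA

/-- The mean of `(A + t I)⁻¹ y` is nonzero for almost all `t ≥ 0` if that of `y` is nonzero. -/
lemma ae_integral_shift_inv_mulVec_ne_zero {α : Type*} [MeasurableSpace α] {μ : Measure α}
    {A : α → Matrix n n ℝ} {y : α → n → ℝ} (hAm : ∀ i j, Measurable fun a => A a i j)
    (hym : ∀ i, Measurable fun a => y a i) {c : ℝ} (hc : 0 < c)
    (hA : ∀ a (x : n → ℝ), c * (x ⬝ᵥ x) ≤ x ⬝ᵥ A a *ᵥ x) (hy : Integrable y μ) {j : n}
    (hj : ∫ a, y a j ∂μ ≠ 0) :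
    ∀ᵐ t : ℝ, 0 ≤ t → ∫ a, ((A a + t • 1)⁻¹ *ᵥ y a) j ∂μ ≠ 0 := by
  set F : ℂ → α → ℂ := fun z a => ((complexShift (A a) z)⁻¹ *ᵥ fun i => (y a i : ℂ)) j with hF
  have hny : ∀ a, ‖fun i => (y a i : ℂ)‖ = ‖y a‖ := fun a => by
    simp only [Pi.norm_def, Complex.nnnorm_real]
  have hFm : ∀ z, AEStronglyMeasurable (F z) μ := fun z => by
    refine (measurable_matrix_inv_mulVec_apply (fun i k => ?_) (fun i => ?_) j).aestronglyMeasurable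
    · simp_rw [complexShift_apply]
      exact (Complex.measurable_ofReal.comp (hAm i k)).add_const _
    · exact Complex.measurable_ofReal.comp (hym i)
  have hFb : ∀ z : ℂ, -c < z.re → ∀ a, ‖F z a‖ ≤ Fintype.card n / (c + z.re) * ‖y a‖ := by
    intro z hz a
    rw [← hny]
    exact (norm_le_pi_norm _ j).trans (norm_complexShift_inv_mulVec_le (hA a) hz _)
  have hhalf : ∀ z : ℂ, -(c / 2) < z.re → -c < z.re := fun z hz => by linarith
  -- On Re z > -c/2, rather than -c, the resolvent bound is uniform, so a multiple of |y| dominates.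
  have hdiff : DifferentiableOn ℂ (fun z => ∫ a, F z a ∂μ) {z | -(c / 2) < z.re} := by
    refine differentiableOn_integral_of_bound (isOpen_lt continuous_const Complex.continuous_re)
      (fun z _ => hFm z) (fun a => ?_) (hy.norm.const_mul (Fintype.card n / (c / 2)))
      fun z hz a => (hFb z (hhalf z hz) a).trans ?_
    · refine differentiableOn_matrix_inv_mulVec (fun i k => ?_)
        (fun z hz => det_complexShift_ne_zero (hA a) (hhalf z hz)) _ j
      simp_rw [complexShift_apply]
      fun_prop
    · have : -(c / 2) < z.re := hz
      gcongr
      linarith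
  -- For large t the integral is asymptotic to the mean of y_j divided by t, so the analytic
  -- function is not identically zero.
  have hlim : Tendsto (fun t : ℝ => ∫ a, (t : ℂ) * F t a ∂μ) atTop (𝓝 (∫ a, (y a j : ℂ) ∂μ)) := by
    refine tendsto_integral_filter_of_dominated_convergence (fun a => Fintype.card n * ‖y a‖)
      (Eventually.of_forall fun t => (hFm t).const_mul _) ?_ (hy.norm.const_mul _)
      (Eventually.of_forall fun a => ?_)
    · filter_upwards [eventually_ge_atTop 0] with t ht
      refine Eventually.of_forall fun a => ?_
      rw [norm_mul, Complex.norm_real, Real.norm_of_nonneg ht]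
      have h1 := hFb t (by simp; linarith) a
      rw [Complex.ofReal_re] at h1
      calc t * ‖F t a‖ ≤ (c + t) * (Fintype.card n / (c + t) * ‖y a‖) := by gcongr; linarith
        _ = _ := by field_simp
    · exact (tendsto_pi_nhds.1 (tendsto_smul_complexShift_inv_mulVec (hA a) _)) j
  have hne : (∫ a, (y a j : ℂ) ∂μ) ≠ 0 := by
    rw [integral_complex_ofReal]
    exact_mod_cast hj
  obtain ⟨t₀, ht₀, ht₀'⟩ := ((hlim.eventually_ne hne).and (eventually_ge_atTop 0)).exists
  rw [integral_const_mul] at ht₀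
  filter_upwards [ae_ne_zero_of_differentiableOn hdiff (t₀ := t₀) (by linarith)
    (right_ne_zero_of_mul ht₀)] with t ht ht0 h
  refine ht (by linarith) ?_
  have h1 : ∀ a, F t a = (((A a + t • 1)⁻¹ *ᵥ y a) j : ℝ) := fun a =>
    complexShift_inv_mulVec_ofReal (hA a) (by linarith) _ (fun h0 => by
      obtain ⟨w, hw0, hw⟩ := Matrix.exists_mulVec_eq_zero_iff.2 h0
      have h2 := hA a w
      have h3 : A a *ᵥ w = -(t • w) := by
        rw [Matrix.add_mulVec, Matrix.smul_mulVec, Matrix.one_mulVec] at hw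
        exact eq_neg_of_add_eq_zero_left hw
      rw [h3, dotProduct_neg, dotProduct_smul, smul_eq_mul] at h2
      have h4 : 0 < w ⬝ᵥ w := lt_of_le_of_ne (dotProduct_self_nonneg_real w)
        (Ne.symm (dotProduct_self_eq_zero.not.2 hw0))
      nlinarith) j
  simp_rw [h1, integral_complex_ofReal, h, Complex.ofReal_zero]

end Resolvent

/-! ### The mean of the omitted variable limit for generic parameters. -/

section GenericMean

variable {k₁ k₂ kᵥ : ℕ} {Γ : Matrix (AllIdx k₁ k₂ kᵥ) (AllIdx k₁ k₂ kᵥ) ℝ}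
  {SigmaU : Matrix (ObsIdx k₁ k₂) (ObsIdx k₁ k₂) ℝ} {ν : Measure (LimitSpace k₁ k₂ kᵥ)}

variable (k₁ k₂ kᵥ) in
/-- The projection on the loadings on the observed factors. -/
def obsBlock : Matrix (AllIdx k₁ k₂ kᵥ) (AllIdx k₁ k₂ kᵥ) ℝ := Matrix.fromBlocks 1 0 0 0

lemma toBlocks₁₂_add_smul_obsBlock (t : ℝ) :
    (Γ + t • obsBlock k₁ k₂ kᵥ).toBlocks₁₂ = Γ.toBlocks₁₂ := by
  ext i j
  simp [obsBlock, Matrix.toBlocks₁₂]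

lemma toBlocks₂₂_add_smul_obsBlock (t : ℝ) :
    (Γ + t • obsBlock k₁ k₂ kᵥ).toBlocks₂₂ = Γ.toBlocks₂₂ := by
  ext i j
  simp [obsBlock, Matrix.toBlocks₂₂]

/-- This direction in Γ shifts M by tI, and leaves the blocks in the scores untouched, so the
resolvent argument applies. -/
lemma limGram_add_smul_obsBlock (t : ℝ) (η : ObsIdx k₁ k₂ → Fin kᵥ → ℝ) :
    limGram (Γ + t • obsBlock k₁ k₂ kᵥ) SigmaU η = limGram Γ SigmaU η + t • 1 := by
  have h : Matrix.fromCols (1 : Matrix (ObsIdx k₁ k₂) (ObsIdx k₁ k₂) ℝ) (etaTilde η) *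
      obsBlock k₁ k₂ kᵥ *
      (Matrix.fromCols (1 : Matrix (ObsIdx k₁ k₂) (ObsIdx k₁ k₂) ℝ) (etaTilde η))ᵀ = 1 := by
    rw [obsBlock, Matrix.transpose_fromCols, Matrix.fromCols_mul_fromBlocks,
      Matrix.fromCols_mul_fromRows]
    simp
  rw [limGram, limGram, Matrix.mul_add, Matrix.add_mul, Matrix.mul_smul, Matrix.smul_mul, h]
  abel

lemma dotProduct_obsBlock_mulVec_le (x : AllIdx k₁ k₂ kᵥ → ℝ) :
    x ⬝ᵥ obsBlock k₁ k₂ kᵥ *ᵥ x ≤ x ⬝ᵥ x := by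
  have hx : x = Sum.elim (x ∘ Sum.inl) (x ∘ Sum.inr) := (Sum.elim_comp_inl_inr x).symm
  rw [hx, obsBlock, Matrix.fromBlocks_mulVec, sumElim_dotProduct_sumElim,
    sumElim_dotProduct_sumElim]
  simpa using dotProduct_self_nonneg_real (x ∘ Sum.inr)

/-- The random vector whose mean determines how the mean of the omitted variable bias depends on
the `j`-th risk premium. -/
noncomputable def premiumResponse (Γ : Matrix (AllIdx k₁ k₂ kᵥ) (AllIdx k₁ k₂ kᵥ) ℝ)
    (SigmaU : Matrix (ObsIdx k₁ k₂) (ObsIdx k₁ k₂) ℝ) (j : ObsIdx k₁ k₂)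
    (x : LimitSpace k₁ k₂ kᵥ) : ObsIdx k₁ k₂ → ℝ :=
  (limGram Γ SigmaU x.2.1)⁻¹ *ᵥ ((Γ.toBlocks₁₂ + etaTilde x.2.1 * Γ.toBlocks₂₂) *ᵥ x.2.1 j)

/-- M does not involve λ, so X^OV is affine in λ. -/
lemma limOV_add_single (lam : ObsIdx k₁ k₂ → ℝ) (t : ℝ) (j : ObsIdx k₁ k₂)
    (x : LimitSpace k₁ k₂ kᵥ) : limOV Γ SigmaU (lam + t • Pi.single j 1) x =
      limOV Γ SigmaU lam x - t • premiumResponse Γ SigmaU j x := by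
  have h : (Matrix.of x.2.1)ᵀ *ᵥ (lam + t • Pi.single j 1) =
      (Matrix.of x.2.1)ᵀ *ᵥ lam + t • x.2.1 j := by
    rw [Matrix.mulVec_add, Matrix.mulVec_smul]
    congr 2
    ext l
    simp
  rw [limOV, limOV, premiumResponse, h, ← sub_sub, Matrix.mulVec_sub, Matrix.mulVec_sub,
    Matrix.mulVec_smul, Matrix.mulVec_smul]

lemma continuous_scores (j : ObsIdx k₁ k₂) : Continuous fun x : LimitSpace k₁ k₂ kᵥ =>
    (Γ.toBlocks₁₂ + etaTilde x.2.1 * Γ.toBlocks₂₂) *ᵥ x.2.1 j :=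
  (continuous_const.add ((continuous_etaTilde.comp (by fun_prop)).matrix_mul
    continuous_const)).matrix_mulVec (by fun_prop)

lemma integrable_scores (hν : NonsingularNormal ν) (j : ObsIdx k₁ k₂) :
    Integrable (fun x => (Γ.toBlocks₁₂ + etaTilde x.2.1 * Γ.toBlocks₂₂) *ᵥ x.2.1 j) ν := by
  obtain ⟨C, hC, h⟩ := exists_norm_scores_mulVec_le Γ
  refine ((hν.integrable_one_add_norm_pow 2).const_mul C).mono'
    (continuous_scores j).aestronglyMeasurable (Eventually.of_forall fun x => (h _ _).trans ?_)
  have hη : ‖x.2.1‖ ≤ ‖x.2‖ := norm_fst_le _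
  have hj : ‖x.2.1 j‖ ≤ 1 + ‖x.2‖ := by linarith [norm_le_pi_norm x.2.1 j]
  rw [pow_two, ← mul_assoc]
  gcongr

lemma continuous_premiumResponse (hΓ : Γ.PosDef) (hS : SigmaU.PosSemidef) (j : ObsIdx k₁ k₂) :
    Continuous (premiumResponse Γ SigmaU j) :=
  ((continuous_limGram_inv hΓ hS).comp (by fun_prop)).matrix_mulVec (continuous_scores j)

lemma integrable_premiumResponse (hν : NonsingularNormal ν) (hΓ : Γ.PosDef)
    (hS : SigmaU.PosSemidef) (j : ObsIdx k₁ k₂) :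
    Integrable (premiumResponse Γ SigmaU j) ν := by
  obtain ⟨C, hC, h⟩ := exists_norm_limGram_inv_mulVec_le hΓ hS
  exact ((integrable_scores hν j).norm.const_mul C).mono'
    (continuous_premiumResponse hΓ hS j).aestronglyMeasurable
    (Eventually.of_forall fun x => h _ _)

lemma NonsingularNormal.integral_eta (hν : NonsingularNormal ν) (j : ObsIdx k₁ k₂) (l : Fin kᵥ) :
    ∫ x, x.2.1 j l ∂ν = 0 := by
  obtain ⟨V, -, h⟩ := hν
  have h1 := h.2 (Pi.single (Sum.inl (l, j)) 1)
  have h2 := integral_id_gaussianReal (μ := 0) (v := (Pi.single (Sum.inl (l, j)) 1 ⬝ᵥ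
    V *ᵥ Pi.single (Sum.inl (l, j)) 1).toNNReal)
  rw [← h1, integral_map (measurable_dotProduct_left _).aemeasurable (by fun_prop),
    integral_map continuous_stack.measurable.aemeasurable
      (measurable_dotProduct_left _).aestronglyMeasurable] at h2
  simp at h2
  exact h2

/-- The part linear in η has mean zero. As j is weak, row j of η̃ is η_j, and what remains is the
mean of the positive definite quadratic form η_j'Γ_μμ η_j, which is positive by full support. -/
lemma integral_scores_ne_zero (hkᵥ : 1 ≤ kᵥ) (hν : NonsingularNormal ν) (hΓ : Γ.PosDef)
    (b : Fin k₂) :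
    ∫ x, ((Γ.toBlocks₁₂ + etaTilde x.2.1 * Γ.toBlocks₂₂) *ᵥ x.2.1 (Sum.inr b)) (Sum.inr b) ∂ν ≠
      0 := by
  set j : ObsIdx k₁ k₂ := Sum.inr b with hj
  have h0 : ∀ x : LimitSpace k₁ k₂ kᵥ,
      ((Γ.toBlocks₁₂ + etaTilde x.2.1 * Γ.toBlocks₂₂) *ᵥ x.2.1 j) j =
        (∑ l, Γ.toBlocks₁₂ j l * x.2.1 j l) + x.2.1 j ⬝ᵥ Γ.toBlocks₂₂ *ᵥ x.2.1 j := by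
    intro x
    rw [Matrix.add_mulVec, ← Matrix.mulVec_mulVec]
    have : etaTilde x.2.1 j = x.2.1 j := by ext l; simp [etaTilde_apply, hj]
    simp only [Pi.add_apply, Matrix.mulVec, this]
    rfl
  have hI : Integrable (fun x => ∑ l, Γ.toBlocks₁₂ j l * x.2.1 j l) ν :=
    integrable_finsetSum _ fun l _ => by
      refine ((hν.integrable_one_add_norm_pow 1).mono'
        (Continuous.aestronglyMeasurable (by fun_prop)) (Eventually.of_forall fun x => ?_)).const_mul _
      have h1 : ‖x.2.1 j l‖ ≤ ‖x.2‖ := (norm_le_pi_norm (x.2.1 j) l).trans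
        ((norm_le_pi_norm x.2.1 j).trans (norm_fst_le _))
      linarith
  have hJ : Integrable (fun x : LimitSpace k₁ k₂ kᵥ => x.2.1 j ⬝ᵥ Γ.toBlocks₂₂ *ᵥ x.2.1 j) ν := by
    have h1 := ((integrable_scores (Γ := Γ) hν j).eval j).sub hI
    refine h1.congr (Eventually.of_forall fun x => ?_)
    simp only [Pi.sub_apply, h0, add_sub_cancel_left]
  have hpos : ∀ y : Fin kᵥ → ℝ, 0 ≤ y ⬝ᵥ Γ.toBlocks₂₂ *ᵥ y := fun y => by
    simpa using (posDef_toBlocks₂₂ hΓ).posSemidef.dotProduct_mulVec_nonneg y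
  simp_rw [h0]
  rw [integral_add hI hJ, integral_finsetSum _ fun l _ => ?_]
  · simp_rw [integral_const_mul, hν.integral_eta, mul_zero, Finset.sum_const_zero, zero_add]
    intro h1
    rw [integral_eq_zero_iff_of_nonneg (fun x => hpos _) hJ] at h1
    have h2 := hν.eq_of_ae_eq (f := fun p => p.1 j ⬝ᵥ Γ.toBlocks₂₂ *ᵥ p.1 j) (g := fun _ => 0)
      (Continuous.dotProduct (by fun_prop) (continuous_const.matrix_mulVec (by fun_prop)))
      continuous_const h1
    have h3 := congrFun h2 (fun _ _ => 1, 0)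
    have h4 := (posDef_toBlocks₂₂ hΓ).dotProduct_mulVec_pos (x := fun _ => 1)
      fun h => one_ne_zero (congrFun h ⟨0, hkᵥ⟩)
    rw [star_trivial] at h4
    exact h4.ne' h3
  · refine ((hν.integrable_one_add_norm_pow 1).mono'
        (Continuous.aestronglyMeasurable (by fun_prop)) (Eventually.of_forall fun x => ?_)).const_mul _
    have h1 : ‖x.2.1 j l‖ ≤ ‖x.2‖ := (norm_le_pi_norm (x.2.1 j) l).trans
      ((norm_le_pi_norm x.2.1 j).trans (norm_fst_le _))
    linarith

/-- Positive definiteness survives a small decrease of t. Rational starting points make countably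
many half-lines sufficient, hence a countable union of null sets. -/
lemma exists_rat_le_posDef_add_smul_obsBlock {t : ℝ} (h : (Γ + t • obsBlock k₁ k₂ kᵥ).PosDef) :
    ∃ r : ℚ, (r : ℝ) ≤ t ∧ (Γ + (r : ℝ) • obsBlock k₁ k₂ kᵥ).PosDef := by
  obtain ⟨c, hc, hcb⟩ := h.exists_pos_mul_le
  obtain ⟨r, hr1, hr2⟩ := exists_rat_btwn (sub_lt_self t hc)
  have hsplit : Γ + (r : ℝ) • obsBlock k₁ k₂ kᵥ =
      Γ + t • obsBlock k₁ k₂ kᵥ - (t - r) • obsBlock k₁ k₂ kᵥ := by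
    rw [sub_smul]; abel
  refine ⟨r, hr2.le, Matrix.PosDef.of_dotProduct_mulVec_pos ?_ fun x hx => ?_⟩
  · rw [hsplit]
    refine h.isHermitian.sub ?_
    rw [Matrix.IsHermitian, Matrix.conjTranspose_eq_transpose_of_trivial, Matrix.transpose_smul,
      obsBlock, Matrix.fromBlocks_transpose]
    simp
  · have hx0 : 0 < x ⬝ᵥ x := lt_of_le_of_ne (dotProduct_self_nonneg_real x)
      (Ne.symm (dotProduct_self_eq_zero.not.2 hx))
    have h1 := dotProduct_obsBlock_mulVec_le x
    have h2 := hcb x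
    rw [star_trivial, hsplit, Matrix.sub_mulVec, dotProduct_sub, Matrix.smul_mulVec,
      dotProduct_smul, smul_eq_mul]
    nlinarith

/-- Along the direction of the loadings on the observed factors, the mean response to a weak risk
premium vanishes almost nowhere. -/
lemma ae_integral_premiumResponse_ne_zero (hkᵥ : 1 ≤ kᵥ) (hν : NonsingularNormal ν)
    (hS : SigmaU.PosSemidef) (Γ : Matrix (AllIdx k₁ k₂ kᵥ) (AllIdx k₁ k₂ kᵥ) ℝ) (b : Fin k₂) :
    ∀ᵐ t : ℝ, (Γ + t • obsBlock k₁ k₂ kᵥ).PosDef →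
      ∫ x, premiumResponse (Γ + t • obsBlock k₁ k₂ kᵥ) SigmaU (Sum.inr b) x (Sum.inr b) ∂ν ≠ 0 := by
  have key : ∀ r : ℚ, (Γ + (r : ℝ) • obsBlock k₁ k₂ kᵥ).PosDef → ∀ᵐ t : ℝ, (r : ℝ) ≤ t →
      ∫ x, premiumResponse (Γ + t • obsBlock k₁ k₂ kᵥ) SigmaU (Sum.inr b) x (Sum.inr b) ∂ν ≠ 0 := by
    intro r hr
    obtain ⟨c, hc, hcb⟩ := hr.exists_pos_mul_le
    have hη : Continuous fun x : LimitSpace k₁ k₂ kᵥ => x.2.1 := by fun_prop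
    have hgc := (continuous_const (y := Γ + (r : ℝ) • obsBlock k₁ k₂ kᵥ)).limGram
      (SigmaU := SigmaU) hη
    have hy := (continuous_scores (Γ := Γ + (r : ℝ) • obsBlock k₁ k₂ kᵥ)
      (Sum.inr b)).measurable
    have h1 := ae_integral_shift_inv_mulVec_ne_zero (μ := ν) (j := Sum.inr b)
      (fun i k => (hgc.matrix_elem i k).measurable) (fun i => measurable_pi_iff.1 hy i) hc
      (fun x => mul_le_dotProduct_limGram_mulVec hS hc.le hcb x.2.1)
      (integrable_scores hν (Sum.inr b)) (integral_scores_ne_zero hkᵥ hν hr b)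
    have h2 := (measurePreserving_sub_right (volume : Measure ℝ) (r : ℝ)).quasiMeasurePreserving.ae h1
    filter_upwards [h2] with t ht htr
    have h3 : Γ + t • obsBlock k₁ k₂ kᵥ =
        Γ + (r : ℝ) • obsBlock k₁ k₂ kᵥ + (t - r) • obsBlock k₁ k₂ kᵥ := by
      rw [sub_smul]; abel
    simp only [premiumResponse]
    rw [h3]
    simp only [limGram_add_smul_obsBlock, toBlocks₁₂_add_smul_obsBlock,
      toBlocks₂₂_add_smul_obsBlock] at ht ⊢
    exact ht (sub_nonneg.2 htr)
  -- Countability of ℚ yields a single null set for all starting points.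
  have key' : ∀ᵐ t : ℝ, ∀ r : ℚ, (Γ + (r : ℝ) • obsBlock k₁ k₂ kᵥ).PosDef → (r : ℝ) ≤ t →
      ∫ x, premiumResponse (Γ + t • obsBlock k₁ k₂ kᵥ) SigmaU (Sum.inr b) x (Sum.inr b) ∂ν ≠ 0 := by
    refine ae_all_iff.2 fun r => ?_
    by_cases hr : (Γ + (r : ℝ) • obsBlock k₁ k₂ kᵥ).PosDef
    · filter_upwards [key r hr] with t ht _ using ht
    · exact Eventually.of_forall fun t h => absurd h hr
  filter_upwards [key'] with t ht hpd
  obtain ⟨r, hrt, hr⟩ := exists_rat_le_posDef_add_smul_obsBlock hpd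
  exact ht r hr hrt

lemma continuous_symMatrix {κ : Type*} : Continuous (symMatrix (κ := κ)) :=
  continuous_matrix fun i j => by simp only [symMatrix, Matrix.of_apply]; fun_prop

lemma measurableSet_posDef_symMatrix {κ : Type*} [Fintype κ] [DecidableEq κ] :
    MeasurableSet {θ : Sym2 κ → ℝ | (symMatrix θ).PosDef} := by
  have h : {θ : Sym2 κ → ℝ | (symMatrix θ).PosDef} =
      {θ | (symMatrix θ).PosSemidef} ∩ {θ | (symMatrix θ).det ≠ 0} := by
    ext θ
    exact ⟨fun h => ⟨h.posSemidef, h.det_pos.ne'⟩, fun h => h.1.posDef_iff_det_ne_zero.2 h.2⟩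
  rw [h]
  exact (Matrix.isClosed_posSemidef.preimage continuous_symMatrix).measurableSet.inter
    (isOpen_ne_fun continuous_symMatrix.matrix_det continuous_const).measurableSet

/-- The direction in the space of free entries which corresponds to `obsBlock`. -/
def obsBlockEntries (k₁ k₂ kᵥ : ℕ) : Sym2 (AllIdx k₁ k₂ kᵥ) → ℝ :=
  Sym2.lift ⟨fun a b => obsBlock k₁ k₂ kᵥ a b, fun a b => by
    have h : (obsBlock k₁ k₂ kᵥ)ᵀ = obsBlock k₁ k₂ kᵥ := by
      rw [obsBlock, Matrix.fromBlocks_transpose]; simp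
    exact congrFun (congrFun h b) a⟩

lemma symMatrix_add_smul (θ : Sym2 (AllIdx k₁ k₂ kᵥ) → ℝ) (t : ℝ) :
    symMatrix (θ + t • obsBlockEntries k₁ k₂ kᵥ) = symMatrix θ + t • obsBlock k₁ k₂ kᵥ := by
  ext a b
  simp [symMatrix, obsBlockEntries]

lemma continuous_symMatrix_param :
    Continuous fun p : ((ObsIdx k₁ k₂ → ℝ) × (Sym2 (AllIdx k₁ k₂ kᵥ) → ℝ)) ×
      LimitSpace k₁ k₂ kᵥ => symMatrix p.1.2 := by
  have h : Continuous fun p : ((ObsIdx k₁ k₂ → ℝ) × (Sym2 (AllIdx k₁ k₂ kᵥ) → ℝ)) ×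
      LimitSpace k₁ k₂ kᵥ => p.1.2 := by fun_prop
  exact continuous_symMatrix.comp h

lemma continuous_limGram_symMatrix :
    Continuous fun p : ((ObsIdx k₁ k₂ → ℝ) × (Sym2 (AllIdx k₁ k₂ kᵥ) → ℝ)) ×
      LimitSpace k₁ k₂ kᵥ => limGram (symMatrix p.1.2) SigmaU p.2.2.1 := by
  have h : Continuous fun p : ((ObsIdx k₁ k₂ → ℝ) × (Sym2 (AllIdx k₁ k₂ kᵥ) → ℝ)) ×
      LimitSpace k₁ k₂ kᵥ => p.2.2.1 := by fun_prop
  exact continuous_symMatrix_param.limGram h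

lemma continuous_scores_symMatrix : Continuous fun p :
    ((ObsIdx k₁ k₂ → ℝ) × (Sym2 (AllIdx k₁ k₂ kᵥ) → ℝ)) × LimitSpace k₁ k₂ kᵥ =>
      (symMatrix p.1.2).toBlocks₁₂ + etaTilde p.2.2.1 * (symMatrix p.1.2).toBlocks₂₂ := by
  have h : Continuous fun p : ((ObsIdx k₁ k₂ → ℝ) × (Sym2 (AllIdx k₁ k₂ kᵥ) → ℝ)) ×
      LimitSpace k₁ k₂ kᵥ => p.2.2.1 := by fun_prop
  have h12 : Continuous fun p : ((ObsIdx k₁ k₂ → ℝ) × (Sym2 (AllIdx k₁ k₂ kᵥ) → ℝ)) ×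
      LimitSpace k₁ k₂ kᵥ => (symMatrix p.1.2).toBlocks₁₂ :=
    continuous_matrix fun i k => continuous_symMatrix_param.matrix_elem _ _
  have h22 : Continuous fun p : ((ObsIdx k₁ k₂ → ℝ) × (Sym2 (AllIdx k₁ k₂ kᵥ) → ℝ)) ×
      LimitSpace k₁ k₂ kᵥ => (symMatrix p.1.2).toBlocks₂₂ :=
    continuous_matrix fun i k => continuous_symMatrix_param.matrix_elem _ _
  exact h12.add ((continuous_etaTilde.comp h).matrix_mul h22)

lemma Continuous.measurable_inv_mulVec_apply {X n : Type*} [TopologicalSpace X] [MeasurableSpace X]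
    [OpensMeasurableSpace X] [Fintype n] [DecidableEq n] {M : X → Matrix n n ℝ} {y : X → n → ℝ}
    (hM : Continuous M) (hy : Continuous y) (j : n) : Measurable fun p => ((M p)⁻¹ *ᵥ y p) j :=
  measurable_matrix_inv_mulVec_apply (fun i k => (hM.matrix_elem i k).measurable)
    (fun i => (continuous_pi_iff.1 hy i).measurable) j

/-- Measurability in the parameters is what Fubini requires. It holds on the whole parameter space,
including points where M is singular and its inverse discontinuous. -/
lemma measurable_integral_limGram_inv_mulVec [SFinite ν]
    {y : ((ObsIdx k₁ k₂ → ℝ) × (Sym2 (AllIdx k₁ k₂ kᵥ) → ℝ)) × LimitSpace k₁ k₂ kᵥ →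
      ObsIdx k₁ k₂ → ℝ} (hy : Continuous y) (j : ObsIdx k₁ k₂) :
    Measurable fun q : (ObsIdx k₁ k₂ → ℝ) × (Sym2 (AllIdx k₁ k₂ kᵥ) → ℝ) =>
      ∫ x, ((limGram (symMatrix q.2) SigmaU x.2.1)⁻¹ *ᵥ y (q, x)) j ∂ν := by
  have h := (continuous_limGram_symMatrix (SigmaU := SigmaU)).measurable_inv_mulVec_apply hy j
  exact (StronglyMeasurable.integral_prod_right' (ν := ν) h.stronglyMeasurable).measurable

lemma measurable_integral_premiumResponse [SFinite ν] (j : ObsIdx k₁ k₂) :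
    Measurable fun q : (ObsIdx k₁ k₂ → ℝ) × (Sym2 (AllIdx k₁ k₂ kᵥ) → ℝ) =>
      ∫ x, premiumResponse (symMatrix q.2) SigmaU j x j ∂ν := by
  have h : Continuous fun p : ((ObsIdx k₁ k₂ → ℝ) × (Sym2 (AllIdx k₁ k₂ kᵥ) → ℝ)) ×
      LimitSpace k₁ k₂ kᵥ => p.2.2.1 j := by fun_prop
  exact measurable_integral_limGram_inv_mulVec (continuous_scores_symMatrix.matrix_mulVec h) j

lemma measurable_integral_limOV [SFinite ν] (j : ObsIdx k₁ k₂) :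
    Measurable fun q : (ObsIdx k₁ k₂ → ℝ) × (Sym2 (AllIdx k₁ k₂ kᵥ) → ℝ) =>
      ∫ x, limOV (symMatrix q.2) SigmaU q.1 x j ∂ν := by
  have hη : Continuous fun p : ((ObsIdx k₁ k₂ → ℝ) × (Sym2 (AllIdx k₁ k₂ kᵥ) → ℝ)) ×
      LimitSpace k₁ k₂ kᵥ => (Matrix.of p.2.2.1)ᵀ :=
    continuous_matrix fun l r => by simp only [Matrix.transpose_apply, Matrix.of_apply]; fun_prop
  have hlam : Continuous fun p : ((ObsIdx k₁ k₂ → ℝ) × (Sym2 (AllIdx k₁ k₂ kᵥ) → ℝ)) ×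
      LimitSpace k₁ k₂ kᵥ => p.1.1 := by fun_prop
  have hv : Continuous fun p : ((ObsIdx k₁ k₂ → ℝ) × (Sym2 (AllIdx k₁ k₂ kᵥ) → ℝ)) ×
      LimitSpace k₁ k₂ kᵥ => p.2.2.2 := by fun_prop
  exact measurable_integral_limGram_inv_mulVec
    (continuous_scores_symMatrix.matrix_mulVec (hv.sub (hη.matrix_mulVec hlam))) j

/-- The mean of the limit of the omitted variable bias is nonzero for almost all risk premia and
limiting second moments of the loadings. -/
lemma ae_integral_limOV_ne_zero [IsProbabilityMeasure ν] (hk₂ : 1 ≤ k₂) (hkᵥ : 1 ≤ kᵥ)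
    (hν : NonsingularNormal ν) (hS : SigmaU.PosSemidef) :
    ∀ᵐ q : (ObsIdx k₁ k₂ → ℝ) × (Sym2 (AllIdx k₁ k₂ kᵥ) → ℝ), (symMatrix q.2).PosDef →
      ∫ x, limOV (symMatrix q.2) SigmaU q.1 x ∂ν ≠ 0 := by
  have : (volume : Measure ((ObsIdx k₁ k₂ → ℝ) ×
      (Sym2 (AllIdx k₁ k₂ kᵥ) → ℝ))).IsAddHaarMeasure := by
    rw [Measure.volume_eq_prod]; exact Measure.prod.instIsAddHaarMeasure _ _
  set b : Fin k₂ := ⟨0, hk₂⟩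
  set j : ObsIdx k₁ k₂ := Sum.inr b
  have hpd : MeasurableSet {q : (ObsIdx k₁ k₂ → ℝ) × (Sym2 (AllIdx k₁ k₂ kᵥ) → ℝ) |
      (symMatrix q.2).PosDef} := measurable_snd measurableSet_posDef_symMatrix
  have hR : MeasurableSet {q : (ObsIdx k₁ k₂ → ℝ) × (Sym2 (AllIdx k₁ k₂ kᵥ) → ℝ) |
      ∫ x, premiumResponse (symMatrix q.2) SigmaU j x j ∂ν ≠ 0} :=
    (measurable_integral_premiumResponse j (measurableSet_singleton 0)).compl
  have hO : MeasurableSet {q : (ObsIdx k₁ k₂ → ℝ) × (Sym2 (AllIdx k₁ k₂ kᵥ) → ℝ) |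
      ∫ x, limOV (symMatrix q.2) SigmaU q.1 x j ∂ν ≠ 0} :=
    (measurable_integral_limOV j (measurableSet_singleton 0)).compl
  -- Fubini along the lines q + t(0, `obsBlockEntries`): the slope in the premium j is nonzero
  -- almost everywhere.
  have h1 : ∀ᵐ q : (ObsIdx k₁ k₂ → ℝ) × (Sym2 (AllIdx k₁ k₂ kᵥ) → ℝ),
      q ∈ {q | (symMatrix q.2).PosDef → ∫ x, premiumResponse (symMatrix q.2) SigmaU j x j ∂ν ≠ 0} :=
    ae_mem_of_ae_add_linearMap_mem
      (LinearMap.toSpanSingleton ℝ ((ObsIdx k₁ k₂ → ℝ) × (Sym2 (AllIdx k₁ k₂ kᵥ) → ℝ))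
        (0, obsBlockEntries k₁ k₂ kᵥ)) volume volume (hpd.imp hR) fun q => by
      filter_upwards [ae_integral_premiumResponse_ne_zero hkᵥ hν hS (symMatrix q.2) b] with t ht
      simpa [symMatrix_add_smul] using ht
  -- Fubini along the lines that move only λ_j. The slope does not depend on λ, so the mean is
  -- affine on each line.
  have h2 : ∀ᵐ q : (ObsIdx k₁ k₂ → ℝ) × (Sym2 (AllIdx k₁ k₂ kᵥ) → ℝ),
      q ∈ {q | (symMatrix q.2).PosDef → ∫ x, premiumResponse (symMatrix q.2) SigmaU j x j ∂ν ≠ 0 →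
        ∫ x, limOV (symMatrix q.2) SigmaU q.1 x j ∂ν ≠ 0} :=
    ae_mem_of_ae_add_linearMap_mem
      (LinearMap.toSpanSingleton ℝ ((ObsIdx k₁ k₂ → ℝ) × (Sym2 (AllIdx k₁ k₂ kᵥ) → ℝ))
        (Pi.single j 1, 0)) volume volume (hpd.imp (hR.imp hO)) fun q => by
      set R := ∫ x, premiumResponse (symMatrix q.2) SigmaU j x j ∂ν with hRdef
      set E := ∫ x, limOV (symMatrix q.2) SigmaU q.1 x j ∂ν with hE
      -- On such a line the mean is E - tR, with at most the zero t = E/R when R ≠ 0.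
      filter_upwards [compl_mem_ae_iff.2 (measure_singleton (E / R))] with t ht
      simp only [LinearMap.toSpanSingleton_apply, Prod.smul_mk, smul_zero,
        Prod.snd_add, Prod.fst_add, add_zero, ← hRdef]
      intro hΓ hR0 h
      refine ht ?_
      simp_rw [limOV_add_single] at h
      have h3 : ∫ x, (limOV (symMatrix q.2) SigmaU q.1 x - t •
          premiumResponse (symMatrix q.2) SigmaU j x) j ∂ν = E - t * R := by
        rw [hE, hRdef, ← integral_const_mul, ← integral_sub
          ((integrable_limOV hν hΓ hS q.1).eval j)
          (((integrable_premiumResponse hν hΓ hS j).eval j).const_mul t)]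
        rfl
      rw [h3] at h
      rw [Set.mem_singleton_iff, eq_div_iff hR0]
      linarith
  filter_upwards [h1, h2] with q hq1 hq2 hΓ h0
  refine hq2 hΓ (hq1 hΓ) ?_
  rw [← eval_integral fun i => (integrable_limOV hν hΓ hS q.1).eval i, h0, Pi.zero_apply]

end GenericMean
-- Assembly of the claims.
theorem corollary3 {k₁ k₂ kᵥ : ℕ} (hk₂ : 1 ≤ k₂) (hkᵥ : 1 ≤ kᵥ)
    (D : FactorPanel.{u} k₁ k₂ kᵥ)
    (OmegaF : Matrix (ObsIdx k₁ k₂) (ObsIdx k₁ k₂) ℝ)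
    (OmegavF : Matrix (Fin kᵥ × ObsIdx k₁ k₂) (Fin kᵥ × ObsIdx k₁ k₂) ℝ)
    (ν : Measure (LimitSpace k₁ k₂ kᵥ)) [IsProbabilityMeasure ν]
    (Γ : Matrix (AllIdx k₁ k₂ kᵥ) (AllIdx k₁ k₂ kᵥ) ℝ)
    (SigmaSF2 SigmaU : Matrix (ObsIdx k₁ k₂) (ObsIdx k₁ k₂) ℝ)
    (hmodel : D.IsPricingModel) (hfactors : D.Factors OmegaF OmegavF ν)
    (hloadings : D.Loadings Γ) (herrors : D.Errors SigmaSF2)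
    (hSigmaU : SigmaU = D.SigmaF⁻¹ * SigmaSF2 * D.SigmaF⁻¹) :
    -- decomposition of the two-pass estimator on the strong factors
    (∀ a : Fin k₁, D.ConvInProb (fun N T ω =>
      √(T : ℝ) * (D.lamTP N T ω (Sum.inl a) - D.lam (Sum.inl a))
        - (√(T : ℝ) * (D.lamTilde N T ω (Sum.inl a) - D.lam (Sum.inl a))
          + √(T : ℝ) * D.biasA N T ω (Sum.inl a) + √(T : ℝ) * D.biasOV N T ω (Sum.inl a))) 0) ∧
    -- decomposition of the two-pass estimator on the weak factors
    (∀ b : Fin k₂, D.ConvInProb (fun N T ω =>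
      (D.lamTP N T ω (Sum.inr b) - D.lam (Sum.inr b))
        - (D.biasA N T ω (Sum.inr b) + D.biasOV N T ω (Sum.inr b))) 0) ∧
    -- joint limits of the ex-post error and of the two normalized biases
    TendstoInDistribution
      (fun (p : ℕ × ℕ) (ω : D.Ω p.1 p.2) =>
        (√(p.2 : ℝ) • (D.lamTilde p.1 p.2 ω - D.lam),
          scaleStrong p.2 (D.biasOV p.1 p.2 ω), scaleStrong p.2 (D.biasA p.1 p.2 ω)))
      atTop (fun x => (x.1, limOV Γ SigmaU D.lam x, limA Γ SigmaU D.lam x))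
      (fun p => D.P p.1 p.2) ν ∧
    -- limit of the two-pass estimation error on the weak factors
    TendstoInDistribution
      (fun (p : ℕ × ℕ) (ω : D.Ω p.1 p.2) (b : Fin k₂) =>
        D.lamTP p.1 p.2 ω (Sum.inr b) - D.lam (Sum.inr b))
      atTop (fun x b => limA Γ SigmaU D.lam x (Sum.inr b) + limOV Γ SigmaU D.lam x (Sum.inr b))
      (fun p => D.P p.1 p.2) ν ∧
    (NonsingularNormal ν →
      -- the limit of the omitted variable bias is not normal
      ¬ IsGaussian (ν.map (limOV Γ SigmaU D.lam)) ∧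
      -- the limit of the attenuation bias is not normal and has a nonzero mean
      ((weakProj k₁ k₂ * SigmaU) *ᵥ D.lam ≠ 0 →
        ¬ IsGaussian (ν.map (limA Γ SigmaU D.lam)) ∧
        Integrable (limA Γ SigmaU D.lam) ν ∧ ∫ x, limA Γ SigmaU D.lam x ∂ν ≠ 0) ∧
      -- the limit of the omitted variable bias is integrable, and has a nonzero mean for Lebesgue
      -- almost all values of the risk premia and of the limiting second moments of the loadings
      Integrable (limOV Γ SigmaU D.lam) ν ∧
      (∀ᵐ q : (ObsIdx k₁ k₂ → ℝ) × (Sym2 (AllIdx k₁ k₂ kᵥ) → ℝ), (symMatrix q.2).PosDef →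
        Integrable (limOV (symMatrix q.2) SigmaU q.1) ν ∧
        ∫ x, limOV (symMatrix q.2) SigmaU q.1 x ∂ν ≠ 0) ∧
      -- the limit of the two-pass estimation error on the weak factors is not normal, and the
      -- two-pass estimator of the risk premia on the weak factors is inconsistent
      ¬ IsGaussian (ν.map fun x (b : Fin k₂) =>
        limA Γ SigmaU D.lam x (Sum.inr b) + limOV Γ SigmaU D.lam x (Sum.inr b)) ∧
      ¬ (∀ b : Fin k₂, D.ConvInProb (fun N T ω => D.lamTP N T ω (Sum.inr b)) (D.lam (Sum.inr b)))) := by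
  have hS := FactorPanel.posSemidef_SigmaU hmodel hfactors herrors hSigmaU
  have hΓ := hloadings.posDef
  have hlim := FactorPanel.tendstoInDistribution_lamTP_weak hmodel hfactors hloadings herrors hSigmaU
  refine ⟨FactorPanel.convInProb_lamTP_strong hmodel hfactors hloadings herrors hSigmaU,
    FactorPanel.convInProb_lamTP_weak hmodel hfactors hloadings herrors hSigmaU,
    FactorPanel.tendstoInDistribution_biases hmodel hfactors hloadings herrors hSigmaU,
    hlim, fun hν => ⟨not_isGaussian_map_limOV hk₂ hkᵥ hν hΓ hS D.lam,
      fun hc => ⟨not_isGaussian_map_limA hkᵥ hν hΓ hS hc, integrable_limA hΓ hS D.lam,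
        integral_limA_ne_zero hΓ hS hc⟩,
      integrable_limOV hν hΓ hS D.lam, ?_,
      not_isGaussian_map_limA_add_limOV hk₂ hkᵥ hν hΓ hS D.lam, fun hcons => ?_⟩⟩
  · filter_upwards [ae_integral_limOV_ne_zero hk₂ hkᵥ hν hS] with q hq hpd
    exact ⟨integrable_limOV hν hpd hS q.1, hq hpd⟩
  -- Consistency would make the limit law of λ̂₂ - λ₂ the point mass at zero. By uniqueness of weak
  -- limits X^A₂ + X^OV₂ would have this law, which counts as a degenerate normal law.
  · refine not_isGaussian_map_limA_add_limOV hk₂ hkᵥ hν hΓ hS D.lam ?_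
    have h0 : TendsToProb (fun p : ℕ × ℕ => D.P p.1 p.2) atTop
        (fun (p : ℕ × ℕ) (ω : D.Ω p.1 p.2) (b : Fin k₂) =>
          D.lamTP p.1 p.2 ω (Sum.inr b) - D.lam (Sum.inr b)) 0 :=
      TendsToProb.pi fun b => TendsToProb.iff_real.2 fun ε hε => by
        simpa only [Pi.zero_apply, sub_zero] using hcons b ε hε
    have h1 := tendstoInDistribution_unique _ hlim
      (h0.tendstoInDistribution (ν := ν) hlim.forall_aemeasurable)
    rw [h1, Measure.map_const, measure_univ, one_smul]
    infer_instance
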